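/- For a probability vector $\vec p=(p_1,\dots,p_k)$ let $H(\vec p)=-\sum_i p_i\log p_i$ be its Shannon entropy (natural logarithm, $0\log 0=0$) and $S_{\vec p}=|\{i: p_i>0\}|$ its support size. For an estimator $\hat F$ that maps sequences of $n$ symbols to real numbers let $$L(\hat F,\vec p,n)=\mathbb E_{X^n\sim\vec p}\,\bigl|\hat F(X^n)-H(\vec p)\bigr|$$ be its mean absolute error, where $X^n$ consists of $n$ independent samples from $\vec p$. The empirical estimator from $m$ samples is $\hat H^E(X^m)=-\sum_i \frac{N_i}{m}\log\frac{N_i}{m}$, where $N_i$ is the number of occurrences of symbol $i$ in $X^m$; from $m=0$ samples it returns $0$. A non-integer number of samples is rounded to an integer by a fixed rule, either always down or always up. **Theorem (Shannon entropy).** There is an absolute constant $c>0$ such that, for either rounding rule, there is an estimator $\hat H=\hat H_{\varepsilon}$, with a single parameter $\varepsilon\in[0,1]$, that is given only $\varepsilon$ and the sample sequence (neither the alphabet size $k$ nor $S_{\vec p}$) and has the following two properties. 1. $\hat H$ is computable in linear time: a single program for a unit-cost random access machine with real registers (indirect addressing; addition, subtraction and comparison of natural numbers; arithmetic, comparison,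 $\log$ and $\exp$ of real numbers) computes $\hat H_\varepsilon(X^n)$ in at most $C\,n$ steps for all $\varepsilon\in[0,1]$, all $n\ge 1$ and all sequences $X^n$ of $n$ symbols (natural numbers), where $C$ is an absolute constant. 2. For all $\varepsilon\in[0,1]$, all $n\ge1$, all $k$ and all distributions $\vec p$ on $k$ symbols, $$L(\hat H_\varepsilon,\vec p,n)\le L\bigl(\hat H^E,\vec p,\varepsilon n\log n\bigr)+c\cdot\min\Bigl\{\varepsilon,\ \frac{S_{\vec p}}{n}+\frac1{n^{0.49}}\Bigr\}.$$ -/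

import Mathlib

/-! ### Distributions, samples, entropy, mean absolute error -/

/-- Shannon entropy `H(p) = ∑ᵢ -pᵢ log pᵢ` (natural logarithm, `0 log 0 = 0`). -/
noncomputable def shannonEntropy {k : ℕ} (p : Fin k → ℝ) : ℝ :=
  ∑ i, Real.negMulLog (p i)

/-- The number of symbols of positive probability. -/
noncomputable def supportSize {k : ℕ} (p : Fin k → ℝ) : ℕ :=
  (Finset.univ.filter fun i => 0 < p i).card

/-- Mean absolute error `E |F̂(X^n) - F(p)|` of an estimator `Fhat` of the property `F`, where
`X^n` is a sequence of `n` independent samples from `p`. -/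
noncomputable def meanAbsError {k n : ℕ} (F : (Fin k → ℝ) → ℝ) (Fhat : (Fin n → Fin k) → ℝ)
    (p : Fin k → ℝ) : ℝ :=
  ∑ x : Fin n → Fin k, (∏ j, p (x j)) * |Fhat x - F p|

/-- The number of times the symbol `i` appears in the sample sequence `x`. -/
def symbolCount {k n : ℕ} (x : Fin n → Fin k) (i : Fin k) : ℕ :=
  (Finset.univ.filter fun j => x j = i).card

/-- The empirical entropy estimator `∑ᵢ h(Nᵢ / n)`, `h(t) = -t log t`.
From the empty sample sequence (`n = 0`) it returns `0`. -/
noncomputable def empiricalEntropy {k n : ℕ} (x : Fin n → Fin k) : ℝ :=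
  ∑ i, Real.negMulLog ((symbolCount x i : ℝ) / n)

/-! ### A unit-cost random access machine with real registers

Programs are finite. They work on natural-number variables, real variables, and finitely many
arrays of either sort that are indexed by natural numbers (so indirect addressing is available).
Natural numbers can be added, subtracted (truncated) and compared; real numbers can be added,
subtracted, multiplied, divided and compared, and `log` and `exp` are available.
Naturals can be converted to reals, but there is no rounding of reals to naturals, and the only
constants are natural numbers.  Every instruction and every test costs one step. -/
namespace RealRAM

/-- Memory contents: variables and arrays, named by natural numbers. -/
structure State where
  nvar : ℕ → ℕ
  rvar : ℕ → ℝ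
  narr : ℕ → ℕ → ℕ
  rarr : ℕ → ℕ → ℝ

inductive Instr where
  | nconst (x c : ℕ)
  | nadd (x y z : ℕ)
  | nsub (x y z : ℕ)
  | nload (x a y : ℕ)
  | nstore (a y x : ℕ)
  | rcast (r x : ℕ)
  | radd (r s t : ℕ)
  | rsub (r s t : ℕ)
  | rmul (r s t : ℕ)
  | rdiv (r s t : ℕ)
  | rlog (r s : ℕ)
  | rexp (r s : ℕ)
  | rload (r a y : ℕ)
  | rstore (a y r : ℕ)

def State.setN (σ : State) (x v : ℕ) : State :=
  { σ with nvar := Function.update σ.nvar x v }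

def State.setR (σ : State) (r : ℕ) (v : ℝ) : State :=
  { σ with rvar := Function.update σ.rvar r v }

/-- The effect of one instruction. The first argument of an instruction is its target. -/
noncomputable def Instr.apply : Instr → State → State
  | nconst x c, σ => σ.setN x c
  | nadd x y z, σ => σ.setN x (σ.nvar y + σ.nvar z)
  | nsub x y z, σ => σ.setN x (σ.nvar y - σ.nvar z)
  | nload x a y, σ => σ.setN x (σ.narr a (σ.nvar y))
  | nstore a y x, σ =>
      { σ with narr :=
          Function.update σ.narr a (Function.update (σ.narr a) (σ.nvar y) (σ.nvar x)) }
  | rcast r x, σ => σ.setR r (σ.nvar x : ℝ)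
  | radd r s t, σ => σ.setR r (σ.rvar s + σ.rvar t)
  | rsub r s t, σ => σ.setR r (σ.rvar s - σ.rvar t)
  | rmul r s t, σ => σ.setR r (σ.rvar s * σ.rvar t)
  | rdiv r s t, σ => σ.setR r (σ.rvar s / σ.rvar t)
  | rlog r s, σ => σ.setR r (Real.log (σ.rvar s))
  | rexp r s, σ => σ.setR r (Real.exp (σ.rvar s))
  | rload r a y, σ => σ.setR r (σ.rarr a (σ.nvar y))
  | rstore a y r, σ =>
      { σ with rarr :=
          Function.update σ.rarr a (Function.update (σ.rarr a) (σ.nvar y) (σ.rvar r)) }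

/-- Comparison of two natural-number variables, or of two real variables. -/
inductive Test where
  | nlt (x y : ℕ)
  | rlt (r s : ℕ)

def Test.Holds : Test → State → Prop
  | nlt x y, σ => σ.nvar x < σ.nvar y
  | rlt r s, σ => σ.rvar r < σ.rvar s

inductive Prog where
  | skip
  | instr (i : Instr)
  | seq (P Q : Prog)
  | branch (b : Test) (P Q : Prog)
  | loop (b : Test) (P : Prog)

/-- `Exec P σ t τ`: started in `σ`, the program `P` halts after exactly `t` steps in `τ`. -/
inductive Exec : Prog → State → ℕ → State → Prop where
  | skip (σ : State) : Exec .skip σ 1 σ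
  | instr (i : Instr) (σ : State) : Exec (.instr i) σ 1 (i.apply σ)
  | seq {P Q : Prog} {σ τ ρ : State} {s t : ℕ} :
      Exec P σ s τ → Exec Q τ t ρ → Exec (.seq P Q) σ (s + t) ρ
  | branch_true {b : Test} {P Q : Prog} {σ τ : State} {t : ℕ} :
      b.Holds σ → Exec P σ t τ → Exec (.branch b P Q) σ (t + 1) τ
  | branch_false {b : Test} {P Q : Prog} {σ τ : State} {t : ℕ} :
      ¬ b.Holds σ → Exec Q σ t τ → Exec (.branch b P Q) σ (t + 1) τ
  | loop_done {b : Test} {P : Prog} {σ : State} :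
      ¬ b.Holds σ → Exec (.loop b P) σ 1 σ
  | loop_step {b : Test} {P : Prog} {σ τ ρ : State} {s t : ℕ} :
      b.Holds σ → Exec P σ s τ → Exec (.loop b P) τ t ρ → Exec (.loop b P) σ (s + t + 1) ρ

/-- The initial memory on parameter `ε` and sample sequence `x`: natural variable `0` holds the
sample size, real variable `0` holds `ε`, array `0` holds the samples, all else is zero. -/
def input (ε : ℝ) {n : ℕ} (x : Fin n → ℕ) : State where
  nvar := Function.update (fun _ => 0) 0 n
  rvar := Function.update (fun _ => 0) 0 ε
  narr := Function.update (fun _ _ => 0) 0 fun j => if h : j < n then x ⟨j, h⟩ else 0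
  rarr := fun _ _ => 0

end RealRAM

/-- An estimator with a parameter `ε ∈ [0, 1]`, for every sample size `n ≥ 1`. The symbols are
natural numbers; no alphabet is given. -/
abbrev ParamEstimator : Type := ℝ → (n : ℕ) → (Fin n → ℕ) → ℝ

/-- One program computes the estimator (leaving the estimate in real variable `0`), for all
parameters, all sample sizes and all sample sequences, in time linear in the sample size. -/
def LinearTime (Fhat : ParamEstimator) : Prop :=
  ∃ (P : RealRAM.Prog) (C : ℕ), ∀ ε : ℝ, 0 ≤ ε → ε ≤ 1 → ∀ n : ℕ, 1 ≤ n → ∀ x : Fin n → ℕ,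
    ∃ (t : ℕ) (τ : RealRAM.State),
      RealRAM.Exec P (RealRAM.input ε x) t τ ∧ t ≤ C * n ∧ τ.rvar 0 = Fhat ε n x

/-! Let `m` be the rounding of `ε n log n`. If `m ≤ n`, the plug-in estimate from the first `m`
samples has exactly the loss required. If `n` is below an absolute constant and `m > n`, both sides
are controlled by constants. The remaining case has `ε log n > 1`: `n` samples must do the work of
`m > n`.

Size biasing, `E[(N/m) g(N)] = p E[g(N'+1)]` with `N` binomial of `m` trials and `N'` of `m - 1`,
reduces entropy estimation to estimating `-log p` for each symbol. The plug-in estimate has mean `∑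
p * logCount m p`. It underestimates (`logCount_le`), and for `p ≤ 1/2` it is no better than `-log
(p + 1/(16 m))` (`logCount_le_of_le_half`). So it suffices that the estimate of `-log p` has mean
between `logCount m p - O(e)` and `-log p + O(e)` with `e = min ε (1/(n p))`: its total bias is then
at most that of the plug-in from `m` samples plus `∑ p e`, which is at most `min ε (S/n)`. The bias
of the plug-in is at most its mean absolute error.

Such an estimate is built as follows. Split the sample into halves. For symbols of probability at
most of order `log n / n`, truncate the series `∑ 2 ρ^k T_k(1 - 2x) / k = -log ((1-ρ)² + 4ρx)`, `x =
p w / 4`, at degree `L` close to `log n / 1024`. Up to a constant this is a polynomial approximating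
`-log (p + s)` with `s = (1-ρ)²/(ρ w)`. Taking `1 - ρ` of order `1/(√ε L)` gives both `s ≤ 1/(16 m)`
(`shift_le`) and a truncation error `O(e)` (`mean_logEst`). Falling factorials of counts estimate
the polynomial without bias. For frequent symbols the ordinary log-frequency already has bias
`O(1/(n p))` (`logCount_ge`). The count in the first half, independent of the second, selects
between the two estimates; `mean_hybridEst_bounds` combines them.

The polynomial is used only for counts `O(L)`, where its value is a very small power of `n`. Hence
changing one sample moves the estimate by `O(n^0.01 / n)`, and the standard deviation is
`O(n^(-0.49))`.

For the running time, the polynomial estimate depends only on a count of size `O(L)`. A table of its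
values costs `O(L³) = O(n)` steps; everything else is a constant number of passes over the sample.
-/

namespace EntropyAmplification

/-! ### Binomial expectations -/

/-- Expectation of `f` under the binomial distribution with `n` trials of success probability `p`. -/
noncomputable def binE : ℕ → ℝ → (ℕ → ℝ) → ℝ
  | 0, _, f => f 0
  | n + 1, p, f => p * binE n p (fun N => f (N + 1)) + (1 - p) * binE n p f

theorem binE_zero (p : ℝ) (f : ℕ → ℝ) : binE 0 p f = f 0 := rfl

theorem binE_succ (n : ℕ) (p : ℝ) (f : ℕ → ℝ) :
    binE (n + 1) p f = p * binE n p (fun N => f (N + 1)) + (1 - p) * binE n p f := rfl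

theorem binE_add (n : ℕ) (p : ℝ) (f g : ℕ → ℝ) :
    binE n p (fun N => f N + g N) = binE n p f + binE n p g := by
  induction n generalizing f g with
  | zero => rfl
  | succ n ih => simp only [binE_succ, ih]; ring

theorem binE_mul_left (n : ℕ) (p c : ℝ) (f : ℕ → ℝ) :
    binE n p (fun N => c * f N) = c * binE n p f := by
  induction n generalizing f with
  | zero => rfl
  | succ n ih => simp only [binE_succ, ih]; ring

theorem binE_sub (n : ℕ) (p : ℝ) (f g : ℕ → ℝ) :
    binE n p (fun N => f N - g N) = binE n p f - binE n p g := by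
  induction n generalizing f g with
  | zero => rfl
  | succ n ih => simp only [binE_succ, ih]; ring

theorem binE_const (n : ℕ) (p c : ℝ) : binE n p (fun _ => c) = c := by
  induction n with
  | zero => rfl
  | succ n ih => simp only [binE_succ, ih]; ring

theorem binE_sum {ι : Type*} (s : Finset ι) (n : ℕ) (p : ℝ) (f : ι → ℕ → ℝ) :
    binE n p (fun N => ∑ i ∈ s, f i N) = ∑ i ∈ s, binE n p (f i) := by
  classical
  induction s using Finset.induction_on with
  | empty => simpa using binE_const n p 0
  | insert a s ha ih => simp only [Finset.sum_insert ha, binE_add, ih]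

theorem binE_mono {n : ℕ} {p : ℝ} (h0 : 0 ≤ p) (h1 : p ≤ 1) {f g : ℕ → ℝ}
    (h : ∀ N ≤ n, f N ≤ g N) : binE n p f ≤ binE n p g := by
  induction n generalizing f g with
  | zero => exact h 0 le_rfl
  | succ n ih =>
    simp only [binE_succ]
    have := ih (f := fun N => f (N + 1)) (g := fun N => g (N + 1)) fun N hN => h _ (by omega)
    have := ih (f := f) (g := g) fun N hN => h _ (by omega)
    have : 0 ≤ 1 - p := by linarith
    gcongr

theorem binE_nonneg {n : ℕ} {p : ℝ} (h0 : 0 ≤ p) (h1 : p ≤ 1) {f : ℕ → ℝ}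
    (h : ∀ N ≤ n, 0 ≤ f N) : 0 ≤ binE n p f := by
  simpa [binE_const] using binE_mono h0 h1 (f := fun _ => 0) h

theorem binE_pow (n : ℕ) (p u : ℝ) : binE n p (fun N => u ^ N) = (1 - p + p * u) ^ n := by
  induction n with
  | zero => simp [binE_zero]
  | succ n ih =>
    have : binE n p (fun N => u ^ (N + 1)) = u * binE n p (fun N => u ^ N) := by
      rw [← binE_mul_left]; simp only [pow_succ']
    rw [binE_succ, this, ih]; ring

/-- Size biasing of the binomial distribution. -/
theorem binE_size_bias (n : ℕ) (p : ℝ) (f : ℕ → ℝ) :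
    binE (n + 1) p (fun N => N * f N) = (n + 1) * p * binE n p (fun N => f (N + 1)) := by
  induction n generalizing f with
  | zero => simp [binE_succ, binE_zero]
  | succ n ih =>
    rw [binE_succ, ih f]
    have : (fun N : ℕ => ((N + 1 : ℕ) : ℝ) * f (N + 1)) =
        fun N : ℕ => (N : ℝ) * f (N + 1) + f (N + 1) := by ext N; push_cast; ring
    rw [this, binE_add, ih fun N => f (N + 1), binE_succ n p fun N => f (N + 1)]
    push_cast; ring

theorem binE_mean (n : ℕ) (p : ℝ) : binE n p (fun N => (N : ℝ)) = n * p := by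
  cases n with
  | zero => simp [binE_zero]
  | succ n => simpa [binE_const] using binE_size_bias n p fun _ => 1

theorem binE_sq (n : ℕ) (p : ℝ) :
    binE n p (fun N => (N : ℝ) ^ 2) = n * p * (1 - p) + (n * p) ^ 2 := by
  cases n with
  | zero => simp [binE_zero]
  | succ n =>
    have h := binE_size_bias n p fun N => (N : ℝ)
    have h2 : binE n p (fun N => ((N + 1 : ℕ) : ℝ)) = n * p + 1 := by
      push_cast; rw [binE_add, binE_mean, binE_const]
    rw [h2] at h
    simp only [sq] at h ⊢
    rw [h]; push_cast; ring

theorem binE_cube (n : ℕ) (p : ℝ) :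
    binE n p (fun N => (N : ℝ) ^ 3) =
      n * p * (1 - p) * (1 - 2 * p) + 3 * (n * p) * (n * p * (1 - p)) + (n * p) ^ 3 := by
  cases n with
  | zero => simp [binE_zero]
  | succ n =>
    have h := binE_size_bias n p fun N => (N : ℝ) ^ 2
    have h2 : binE n p (fun N => ((N + 1 : ℕ) : ℝ) ^ 2) =
        n * p * (1 - p) + (n * p) ^ 2 + 2 * (n * p) + 1 := by
      have : (fun N : ℕ => ((N + 1 : ℕ) : ℝ) ^ 2) = fun N : ℕ => ((N : ℝ) ^ 2 + 2 * N) + 1 := by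
        ext N; push_cast; ring
      rw [this, binE_add, binE_add, binE_mul_left, binE_mean, binE_const, binE_sq]
    rw [h2] at h
    have h3 : (fun N : ℕ => (N : ℝ) ^ 3) = fun N : ℕ => (N : ℝ) * (N : ℝ) ^ 2 := by ext; ring
    rw [h3, h]; push_cast; ring

/-- Falling factorials give unbiased estimates of powers. -/
theorem binE_prod_falling (M j : ℕ) (hj : j ≤ M) (p : ℝ) :
    binE M p (fun N => ∏ i ∈ Finset.range j, ((N : ℝ) - i) / ((M : ℝ) - i)) = p ^ j := by
  induction j generalizing M with
  | zero => simp [binE_const]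
  | succ j ih =>
    obtain ⟨M, rfl⟩ : ∃ K, M = K + 1 := ⟨M - 1, by omega⟩
    have hM : ((M : ℝ) + 1) ≠ 0 := by positivity
    have key : (fun N : ℕ => ∏ i ∈ Finset.range (j + 1),
        ((N : ℝ) - i) / (((M + 1 : ℕ) : ℝ) - i)) =
        fun N : ℕ => ((M : ℝ) + 1)⁻¹ * (N * ∏ i ∈ Finset.range j,
          ((N : ℝ) - 1 - i) / ((M : ℝ) - i)) := by
      ext N
      rw [Finset.prod_range_succ']
      have : ∀ i : ℕ, ((N : ℝ) - ((i + 1 : ℕ) : ℝ)) / (((M + 1 : ℕ) : ℝ) - ((i + 1 : ℕ) : ℝ)) =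
          ((N : ℝ) - 1 - i) / ((M : ℝ) - i) := by
        intro i; push_cast; congr 1 <;> ring
      simp only [this]
      push_cast; simp only [sub_zero]; field_simp
    rw [key, binE_mul_left, binE_size_bias M p fun N => ∏ i ∈ Finset.range j,
          ((N : ℝ) - 1 - i) / ((M : ℝ) - i)]
    have : (fun N : ℕ => ∏ i ∈ Finset.range j, (((N + 1 : ℕ) : ℝ) - 1 - i) / ((M : ℝ) - i)) =
        fun N : ℕ => ∏ i ∈ Finset.range j, ((N : ℝ) - i) / ((M : ℝ) - i) := by
      ext N; push_cast; simp
    rw [this, ih M (by omega)]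
    field_simp; ring

/-! ### Expected log-counts -/

/-- `p * logCount m p` is the contribution of a symbol of probability `p` to the mean of the
empirical entropy of `m` samples. -/
noncomputable def logCount (m : ℕ) (p : ℝ) : ℝ :=
  binE (m - 1) p fun N => -Real.log (((N : ℝ) + 1) / m)

theorem mul_logCount {m : ℕ} (hm : 1 ≤ m) (p : ℝ) :
    p * logCount m p = binE m p fun N => Real.negMulLog ((N : ℝ) / m) := by
  obtain ⟨m, rfl⟩ : ∃ K, m = K + 1 := ⟨m - 1, by omega⟩
  have : (fun N : ℕ => Real.negMulLog ((N : ℝ) / ((m + 1 : ℕ) : ℝ))) =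
      fun N : ℕ => ((m : ℝ) + 1)⁻¹ * ((N : ℝ) * -Real.log ((N : ℝ) / ((m + 1 : ℕ) : ℝ))) := by
    ext N; rw [Real.negMulLog]; push_cast; ring
  rw [this, binE_mul_left, binE_size_bias m p fun N => -Real.log ((N : ℝ) / ((m + 1 : ℕ) : ℝ))]
  have : ((m : ℝ) + 1) ≠ 0 := by positivity
  simp only [logCount, Nat.add_sub_cancel]
  field_simp
  push_cast; rfl

/-- The plug-in estimate underestimates. -/
theorem logCount_le {m : ℕ} (hm : 1 ≤ m) {p : ℝ} (h0 : 0 < p) (h1 : p ≤ 1) :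
    logCount m p ≤ -Real.log p := by
  obtain ⟨m, rfl⟩ : ∃ K, m = K + 1 := ⟨m - 1, by omega⟩
  have hM : (0 : ℝ) < (m : ℝ) + 1 := by positivity
  -- Size biasing applied to `N * N⁻¹`, which is at most `1` and equals `0` at `N = 0`.
  have h2 : binE m p (fun N => ((N : ℝ) + 1)⁻¹) ≤ (((m : ℝ) + 1) * p)⁻¹ := by
    have h := binE_size_bias m p fun N => ((N : ℝ))⁻¹
    have h3 : binE (m + 1) p (fun N => (N : ℝ) * ((N : ℝ))⁻¹) ≤ 1 := by
      have := binE_mono (n := m + 1) h0.le h1 (f := fun N => (N : ℝ) * ((N : ℝ))⁻¹)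
        (g := fun _ => 1) fun N _ => mul_inv_le_one
      rwa [binE_const] at this
    rw [h] at h3
    push_cast at h3
    rw [← one_div, le_div_iff₀ (by positivity)]
    linarith
  have h4 : logCount (m + 1) p ≤ binE m p fun N => (-Real.log p - 1) +
      (((m : ℝ) + 1) * p) * ((N : ℝ) + 1)⁻¹ := by
    refine binE_mono h0.le h1 fun N _ => ?_
    have hN : (0 : ℝ) < (N : ℝ) + 1 := by positivity
    have := Real.log_le_sub_one_of_pos (x := (((m : ℝ) + 1) * p) * ((N : ℝ) + 1)⁻¹) (by positivity)
    rw [Real.log_mul (by positivity) (by positivity), Real.log_mul (by positivity) (by positivity),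
      Real.log_inv] at this
    rw [Real.log_div (by positivity) (by positivity)]
    push_cast
    linarith
  rw [binE_add, binE_const, binE_mul_left] at h4
  have h5 : (((m : ℝ) + 1) * p) * binE m p (fun N => ((N : ℝ) + 1)⁻¹) ≤ 1 := by
    calc _ ≤ (((m : ℝ) + 1) * p) * (((m : ℝ) + 1) * p)⁻¹ := by gcongr
      _ = 1 := by field_simp
  linarith

/-- The inequality `log x ≤ x - 1` at `x = (N + 1)/(m p)`; the mean of `x - 1` is at most `1/(m p)`.
-/
theorem logCount_ge {m : ℕ} (hm : 1 ≤ m) {p : ℝ} (h0 : 0 < p) (h1 : p ≤ 1) :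
    -Real.log p - 1 / (m * p) ≤ logCount m p := by
  obtain ⟨m, rfl⟩ : ∃ K, m = K + 1 := ⟨m - 1, by omega⟩
  have hM : (0 : ℝ) < (m : ℝ) + 1 := by positivity
  have h4 : binE m p (fun N => (-Real.log p + 1) + -(((m : ℝ) + 1) * p)⁻¹ * ((N : ℝ) + 1)) ≤
      logCount (m + 1) p := by
    refine binE_mono h0.le h1 fun N _ => ?_
    have hN : (0 : ℝ) < (N : ℝ) + 1 := by positivity
    have := Real.log_le_sub_one_of_pos (x := (((m : ℝ) + 1) * p)⁻¹ * ((N : ℝ) + 1)) (by positivity)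
    rw [Real.log_mul (by positivity) (by positivity), Real.log_inv,
      Real.log_mul (by positivity) (by positivity)] at this
    rw [Real.log_div (by positivity) (by positivity)]
    push_cast
    linarith
  rw [binE_add, binE_const, binE_mul_left, binE_add, binE_const, binE_mean] at h4
  have h5 : (((m : ℝ) + 1) * p)⁻¹ * (m * p + 1) ≤ 1 + 1 / (((m : ℝ) + 1) * p) := by
    rw [inv_mul_le_iff₀ (by positivity), mul_add, mul_one_div_cancel (by positivity)]
    nlinarith
  push_cast
  linarith

/-- The left side is the cubic Taylor polynomial of `u log u` at `1`. The difference has derivative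
`log v - (v - 1) + (v - 1)²/2`, which is increasing and vanishes at `1`, so its minimum is at `1`.
-/
theorem entropy_taylor {u : ℝ} (hu : 0 ≤ u) :
    (u - 1) + (u - 1) ^ 2 / 2 - (u - 1) ^ 3 / 6 ≤ u * Real.log u := by
  rcases hu.eq_or_lt with rfl | hu
  · norm_num
  have hg : MonotoneOn (fun v : ℝ => Real.log v - (v - 1) + (v - 1) ^ 2 / 2) (Set.Ioi 0) := by
    have hd : ∀ v ∈ Set.Ioi (0 : ℝ), HasDerivAt
        (fun v : ℝ => Real.log v - (v - 1) + (v - 1) ^ 2 / 2) ((v - 1) ^ 2 / v) v := by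
      intro v hv
      have hv' : v ≠ 0 := (Set.mem_Ioi.mp hv).ne'
      have h1 := (hasDerivAt_id v).sub_const 1
      refine (((Real.hasDerivAt_log hv').sub h1).add ((h1.pow 2).div_const 2)).congr_deriv ?_
      simp only [id]; field_simp; ring
    refine monotoneOn_of_deriv_nonneg (convex_Ioi 0)
      (fun v hv => (hd v hv).continuousAt.continuousWithinAt)
      (fun v hv => (hd v (interior_subset hv)).differentiableAt.differentiableWithinAt)
      fun v hv => ?_
    rw [(hd v (interior_subset hv)).deriv]
    have : (0 : ℝ) < v := interior_subset hv
    positivity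
  set F : ℝ → ℝ := fun v => v * Real.log v - ((v - 1) + (v - 1) ^ 2 / 2 - (v - 1) ^ 3 / 6) with hF
  have hd : ∀ v ∈ Set.Ioi (0 : ℝ), HasDerivAt F
      (Real.log v - (v - 1) + (v - 1) ^ 2 / 2) v := by
    intro v hv
    have hv' : v ≠ 0 := (Set.mem_Ioi.mp hv).ne'
    have h1 := (hasDerivAt_id v).sub_const 1
    refine (((hasDerivAt_id v).mul (Real.hasDerivAt_log hv')).sub
      ((h1.add ((h1.pow 2).div_const 2)).sub ((h1.pow 3).div_const 6))).congr_deriv ?_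
    simp only [id]; field_simp; ring
  have hF1 : F 1 = 0 := by simp [hF]
  suffices F 1 ≤ F u by
    rw [hF1] at this
    exact sub_nonneg.mp this
  have hc : ContinuousOn F (Set.Ioi 0) := fun v hv => (hd v hv).continuousAt.continuousWithinAt
  rcases le_total u 1 with h | h
  · have hs : Set.Icc u 1 ⊆ Set.Ioi 0 := fun v hv => lt_of_lt_of_le hu hv.1
    refine antitoneOn_of_deriv_nonpos (convex_Icc u 1) (hc.mono hs)
      (fun v hv => (hd v (hs (interior_subset hv))).differentiableAt.differentiableWithinAt)
      (fun v hv => ?_) (Set.left_mem_Icc.mpr h) (Set.right_mem_Icc.mpr h) h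
    have hv := interior_subset hv
    rw [(hd v (hs hv)).deriv]
    simpa using hg (hs hv) (Set.mem_Ioi.mpr one_pos) hv.2
  · have hs : Set.Icc 1 u ⊆ Set.Ioi 0 := fun v hv => lt_of_lt_of_le one_pos hv.1
    refine monotoneOn_of_deriv_nonneg (convex_Icc 1 u) (hc.mono hs)
      (fun v hv => (hd v (hs (interior_subset hv))).differentiableAt.differentiableWithinAt)
      (fun v hv => ?_) (Set.left_mem_Icc.mpr h) (Set.right_mem_Icc.mpr h) h
    have hv := interior_subset hv
    rw [(hd v (hs hv)).deriv]
    simpa using hg (Set.mem_Ioi.mpr one_pos) (hs hv) hv.1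

/-- The plug-in estimate from `m` samples cannot resolve probabilities below order `1/m`. If `m p ≤
1/2`, it never exceeds `log m`, and this is enough. If `m p ≥ 1/2`, the cubic minorant of `u log u`
at `u = N/(m p)`, together with the first three binomial moments, yields a deficit of order `1/(m
p)`. -/
theorem logCount_le_of_le_half {m : ℕ} (hm : 1 ≤ m) {p : ℝ} (h0 : 0 < p) (h1 : p ≤ 1 / 2) :
    logCount m p ≤ -Real.log (p + 1 / (16 * m)) := by
  have hm' : (1 : ℝ) ≤ m := by exact_mod_cast hm
  have hmp : 0 < (m : ℝ) * p := by positivity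
  rcases le_total ((m : ℝ) * p) (1 / 2) with h | h
  · have h2 : logCount m p ≤ Real.log m := by
      have := binE_mono (n := m - 1) h0.le (by linarith) (f := fun N => -Real.log (((N : ℝ) + 1) / m))
        (g := fun _ => Real.log m) fun N _ => by
          rw [Real.log_div (by positivity) (by positivity)]
          have : 0 ≤ Real.log ((N : ℝ) + 1) :=
            Real.log_nonneg (by have : (0 : ℝ) ≤ N := by positivity
                                linarith)
          linarith
      rwa [binE_const] at this
    refine h2.trans ?_
    rw [← Real.log_inv]
    refine Real.log_le_log (by positivity) ?_
    rw [← one_div, le_div_iff₀ (by positivity), mul_add]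
    have : (m : ℝ) * (1 / (16 * m)) = 1 / 16 := by field_simp
    linarith
  · have h3 : (m * p) * (logCount m p + Real.log p) ≤ -(1 / 16) := by
      have e1 : (m * p) * (logCount m p + Real.log p) =
          binE m p fun N => -(N * Real.log (N / (m * p))) := by
        have : (m * p) * (logCount m p + Real.log p) =
          m * (p * logCount m p) + Real.log p * (m * p) := by ring
        have hmean := binE_mul_left m p (Real.log p) fun N => (N : ℝ)
        rw [binE_mean] at hmean
        rw [this, mul_logCount hm, ← binE_mul_left, ← hmean, ← binE_add]
        congr 1
        ext N
        rcases Nat.eq_zero_or_pos N with rfl | hN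
        · simp
        have hN : (0 : ℝ) < N := by exact_mod_cast hN
        rw [Real.negMulLog, Real.log_div hN.ne' (by positivity), Real.log_div hN.ne' (by positivity),
          Real.log_mul (by positivity) h0.ne']
        field_simp
        ring
      rw [e1]
      set l := (m : ℝ) * p with hl
      have h4 : binE m p (fun N => -((N : ℝ) * Real.log (N / l))) ≤
          binE m p fun N => ((1 / (6 * l ^ 2)) * (N : ℝ) ^ 3 + (-1 / l) * (N : ℝ) ^ 2) +
            ((1 / 2) * (N : ℝ) + l * (1 - 1 / 2 - 1 / 6)) := by
        refine binE_mono h0.le (by linarith) fun N _ => ?_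
        have h5 := entropy_taylor (u := N / l) (by positivity)
        have h6 := mul_le_mul_of_nonneg_left h5 hmp.le
        have h7 : l * (N / l * Real.log (N / l)) = N * Real.log (N / l) := by field_simp
        rw [h7] at h6
        have h8 : l * ((N / l - 1) + (N / l - 1) ^ 2 / 2 - (N / l - 1) ^ 3 / 6) =
          -(((1 / (6 * l ^ 2)) * (N : ℝ) ^ 3 + (-1 / l) * (N : ℝ) ^ 2) +
            ((1 / 2) * (N : ℝ) + l * (1 - 1 / 2 - 1 / 6))) := by
          field_simp; ring
        linarith
      refine h4.trans ?_
      simp only [binE_add, binE_mul_left, binE_cube, binE_sq, binE_mean, binE_const, ← hl]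
      have h9 : 1 / (6 * l ^ 2) * (l * (1 - p) * (1 - 2 * p) + 3 * l * (l * (1 - p)) + l ^ 3) +
          -1 / l * (l * (1 - p) + l ^ 2) + (1 / 2 * l + l * (1 - 1 / 2 - 1 / 6)) =
          (1 - p) * (1 - 2 * p) / (6 * l) - (1 - p) / 2 := by
        field_simp; ring
      rw [h9]
      -- With `l ≥ 1/2` the whole expression is at most `-(1 - p)(1 + 4p)/6`, hence at most `-1/6`
      -- on `0 ≤ p ≤ 1/2`.
      have h10 : (1 - p) * (1 - 2 * p) / (6 * l) ≤ (1 - p) * (1 - 2 * p) / 3 := by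
        apply div_le_div_of_nonneg_left _ (by norm_num) (by linarith)
        have : 0 ≤ 1 - p := by linarith
        have : 0 ≤ 1 - 2 * p := by linarith
        positivity
      nlinarith
    have h11 : p + 1 / (16 * m) = p * (1 + 1 / (16 * (m * p))) := by field_simp
    rw [h11, Real.log_mul h0.ne' (by positivity)]
    have h12 := Real.log_le_sub_one_of_pos (x := 1 + 1 / (16 * (m * p))) (by positivity)
    have h13 : logCount m p + Real.log p ≤ -(1 / (16 * (m * p))) := by
      have : -(1 / (16 * (m * p))) = -(1 / 16) / (m * p) := by field_simp
      rw [this, le_div_iff₀ hmp]; linarith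
    linarith

end EntropyAmplification

namespace EntropyAmplification

/-! ### Expectations over sample sequences -/

/-- Expectation of `F` over `n` independent samples from `p`. -/
noncomputable def expect {k : ℕ} (n : ℕ) (p : Fin k → ℝ) (F : (Fin n → Fin k) → ℝ) : ℝ :=
  ∑ x : Fin n → Fin k, (∏ j, p (x j)) * F x

section
variable {k n : ℕ} {p : Fin k → ℝ}

theorem meanAbsError_eq_expect (F : (Fin k → ℝ) → ℝ) (Fhat : (Fin n → Fin k) → ℝ) :
    meanAbsError F Fhat p = expect n p fun x => |Fhat x - F p| := rfl

theorem expect_add (F G : (Fin n → Fin k) → ℝ) :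
    expect n p (fun x => F x + G x) = expect n p F + expect n p G := by
  simp only [expect, mul_add, Finset.sum_add_distrib]

theorem expect_sub (F G : (Fin n → Fin k) → ℝ) :
    expect n p (fun x => F x - G x) = expect n p F - expect n p G := by
  simp only [expect, mul_sub, Finset.sum_sub_distrib]

theorem expect_mul_left (c : ℝ) (F : (Fin n → Fin k) → ℝ) :
    expect n p (fun x => c * F x) = c * expect n p F := by
  simp only [expect, Finset.mul_sum]
  exact Finset.sum_congr rfl fun _ _ => by ring

theorem expect_sum {ι : Type*} (s : Finset ι) (F : ι → (Fin n → Fin k) → ℝ) :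
    expect n p (fun x => ∑ i ∈ s, F i x) = ∑ i ∈ s, expect n p (F i) := by
  simp only [expect, Finset.mul_sum]
  exact Finset.sum_comm

theorem expect_mono (hp : ∀ i, 0 ≤ p i) {F G : (Fin n → Fin k) → ℝ} (h : ∀ x, F x ≤ G x) :
    expect n p F ≤ expect n p G :=
  Finset.sum_le_sum fun x _ =>
    mul_le_mul_of_nonneg_left (h x) (Finset.prod_nonneg fun _ _ => hp _)

theorem expect_zero (F : (Fin 0 → Fin k) → ℝ) : expect 0 p F = F default := by
  simp [expect, Subsingleton.elim _ (default : Fin 0 → Fin k)]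

theorem expect_succ (F : (Fin (n + 1) → Fin k) → ℝ) :
    expect (n + 1) p F = ∑ i, p i * expect n p fun x => F (Fin.cons i x) := by
  simp only [expect]
  rw [← (Fin.consEquiv fun _ : Fin (n + 1) => Fin k).sum_comp, Fintype.sum_prod_type]
  refine Finset.sum_congr rfl fun i _ => ?_
  rw [Finset.mul_sum]
  refine Finset.sum_congr rfl fun x _ => ?_
  simp [Fin.consEquiv, Fin.prod_univ_succ, mul_assoc]

theorem expect_append (a b : ℕ) (F : (Fin (a + b) → Fin k) → ℝ) :
    expect (a + b) p F = expect a p fun u => expect b p fun v => F (Fin.append u v) := by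
  simp only [expect]
  rw [← (Fin.appendEquiv a b).sum_comp, Fintype.sum_prod_type]
  refine Finset.sum_congr rfl fun u _ => ?_
  rw [Finset.mul_sum]
  refine Finset.sum_congr rfl fun v _ => ?_
  simp [Fin.appendEquiv, Fin.prod_univ_add, mul_assoc]

theorem expect_const (hp : ∑ i, p i = 1) (c : ℝ) : expect n p (fun _ => c) = c := by
  induction n with
  | zero => exact expect_zero _
  | succ n ih => rw [expect_succ, ih, ← Finset.sum_mul, hp, one_mul]

theorem symbolCount_cons (x : Fin n → Fin k) (a i : Fin k) :
    symbolCount (Fin.cons a x : Fin (n + 1) → Fin k) i =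
      symbolCount x i + if a = i then 1 else 0 := by
  simp only [symbolCount, Finset.card_filter, Fin.sum_univ_succ, Fin.cons_zero, Fin.cons_succ]
  ring

/-- The number of occurrences of a symbol is binomial. -/
theorem expect_symbolCount (hp : ∑ i, p i = 1) (i : Fin k) (f : ℕ → ℝ) :
    expect n p (fun x => f (symbolCount x i)) = binE n (p i) f := by
  induction n generalizing f with
  | zero => rw [expect_zero, binE_zero]; simp [symbolCount]
  | succ n ih =>
    rw [expect_succ, binE_succ, ← Finset.add_sum_erase _ _ (Finset.mem_univ i), ← ih, ← ih]
    congr 1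
    · simp [symbolCount_cons]
    · have h : (1 - p i) = ∑ a ∈ Finset.univ.erase i, p a := by
        rw [← hp, ← Finset.add_sum_erase _ _ (Finset.mem_univ i)]; ring
      rw [h, Finset.sum_mul]
      refine Finset.sum_congr rfl fun a ha => ?_
      simp [symbolCount_cons, Finset.ne_of_mem_erase ha]

/-- A function of bounded differences has small variance. -/
theorem variance_le_of_bounded_differences (hp : p ∈ stdSimplex ℝ (Fin k)) {D : ℝ}
    (F : (Fin n → Fin k) → ℝ)
    (hF : ∀ x j a, |F (Function.update x j a) - F x| ≤ D) :
    expect n p (fun x => (F x - expect n p F) ^ 2) ≤ n * D ^ 2 := by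
  induction n with
  | zero => simp [expect_zero]
  | succ n ih =>
    obtain ⟨hp0, hp1⟩ := hp
    set μ := expect (n + 1) p F
    set e : Fin k → ℝ := fun i => expect n p fun x => F (Fin.cons i x) with he
    have hμ : μ = ∑ i, p i * e i := expect_succ F
    have hconst : ∀ c : ℝ, expect n p (fun _ => c) = c := expect_const hp1
    -- Law of total variance, conditioning on the first sample. The conditional variance falls under
    -- the induction hypothesis, and the conditional means lie within `D` of each other, so each
    -- sample contributes at most `D ^ 2`.
    have hvar : ∀ i, expect n p (fun x => (F (Fin.cons i x) - μ) ^ 2) =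
        expect n p (fun x => (F (Fin.cons i x) - e i) ^ 2) + (e i - μ) ^ 2 := by
      intro i
      have : (fun x : Fin n → Fin k => (F (Fin.cons i x) - μ) ^ 2) = fun x =>
          ((F (Fin.cons i x) - e i) ^ 2 + (2 * (e i - μ)) * (F (Fin.cons i x) - e i)) +
            (e i - μ) ^ 2 := by ext x; ring
      rw [this, expect_add, expect_add, expect_mul_left, expect_sub, hconst, hconst]
      simp only [he]; ring
    have h1 : ∀ i, expect n p (fun x => (F (Fin.cons i x) - e i) ^ 2) ≤ n * D ^ 2 := by
      intro i
      refine ih _ fun x j a => ?_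
      have := hF (Fin.cons i x) j.succ a
      rwa [← Fin.cons_update] at this
    have h2 : ∀ i i', |e i - e i'| ≤ D := by
      intro i i'
      simp only [he, ← expect_sub]
      have hb : ∀ x : Fin n → Fin k, |F (Fin.cons i x) - F (Fin.cons i' x)| ≤ D := by
        intro x
        have := hF (Fin.cons i' x) 0 i
        rwa [Fin.update_cons_zero] at this
      rw [abs_le]
      constructor
      · have := expect_mono (n := n) hp0 fun x => (abs_le.mp (hb x)).1
        rwa [hconst] at this
      · have := expect_mono (n := n) hp0 fun x => (abs_le.mp (hb x)).2
        rwa [hconst] at this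
    have h3 : ∀ i, (e i - μ) ^ 2 ≤ D ^ 2 := by
      intro i
      have : |e i - μ| ≤ D := by
        have : e i - μ = ∑ a, p a * (e i - e a) := by
          simp only [mul_sub, Finset.sum_sub_distrib, ← Finset.sum_mul, hp1, hμ, one_mul]
        rw [this]
        refine (Finset.abs_sum_le_sum_abs _ _).trans ?_
        calc _ ≤ ∑ a, p a * D := Finset.sum_le_sum fun a _ => by
              rw [abs_mul, abs_of_nonneg (hp0 a)]
              exact mul_le_mul_of_nonneg_left (h2 _ _) (hp0 a)
          _ = D := by rw [← Finset.sum_mul, hp1, one_mul]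
      exact sq_le_sq' (by linarith [abs_le.mp this]) (abs_le.mp this).2
    rw [expect_succ]
    calc _ ≤ ∑ i, p i * ((n + 1 : ℕ) * D ^ 2) := Finset.sum_le_sum fun i _ => by
          refine mul_le_mul_of_nonneg_left ?_ (hp0 i)
          rw [hvar]; push_cast; linarith [h1 i, h3 i]
      _ = _ := by rw [← Finset.sum_mul, hp1, one_mul]

theorem abs_expect_le (hp : ∀ i, 0 ≤ p i) (F : (Fin n → Fin k) → ℝ) :
    |expect n p F| ≤ expect n p fun x => |F x| := by
  refine (Finset.abs_sum_le_sum_abs _ _).trans (le_of_eq (Finset.sum_congr rfl fun x _ => ?_))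
  rw [abs_mul, abs_of_nonneg (Finset.prod_nonneg fun _ _ => hp _)]

/-- Bias-variance bound for the mean absolute error. -/
theorem expect_abs_sub_le (hp : p ∈ stdSimplex ℝ (Fin k)) {V : ℝ} (hV : 0 ≤ V)
    (F : (Fin n → Fin k) → ℝ) (c : ℝ)
    (hF : expect n p (fun x => (F x - expect n p F) ^ 2) ≤ V ^ 2) :
    expect n p (fun x => |F x - c|) ≤ |expect n p F - c| + V := by
  obtain ⟨hp0, hp1⟩ := hp
  set μ := expect n p F
  have h1 : expect n p (fun x => |F x - c|) ≤ expect n p (fun x => |μ - c| + |F x - μ|) :=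
    expect_mono hp0 fun x => by
      have := abs_add_le (F x - μ) (μ - c)
      rw [sub_add_sub_cancel] at this
      linarith
  rw [expect_add, expect_const hp1] at h1
  refine h1.trans ((add_le_add_iff_left _).mpr ?_)
  set A := expect n p fun x => |F x - μ|
  -- Nonnegativity of the variance of `|F - μ|` bounds its mean by the standard deviation of `F`.
  have h2 : 0 ≤ expect n p (fun x => (|F x - μ| - A) ^ 2) := by
    have := expect_mono (n := n) hp0 (F := fun _ => 0) (G := fun x => (|F x - μ| - A) ^ 2)
      fun x => sq_nonneg _
    rwa [expect_const hp1] at this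
  have h3 : expect n p (fun x => (|F x - μ| - A) ^ 2) =
      expect n p (fun x => (F x - μ) ^ 2) - A ^ 2 := by
    have : (fun x : Fin n → Fin k => (|F x - μ| - A) ^ 2) = fun x =>
        ((F x - μ) ^ 2 + (-2 * A) * |F x - μ|) + A ^ 2 := by
      ext x; rw [sub_sq, sq_abs]; ring
    rw [this, expect_add, expect_add, expect_mul_left, expect_const hp1]
    change _ + -2 * A * A + _ = _
    ring
  exact le_of_sq_le_sq (by linarith) hV

/-! ### The empirical entropy -/

theorem expect_empiricalEntropy {m : ℕ} (hm : 1 ≤ m) (hp : ∑ i, p i = 1) :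
    expect m p empiricalEntropy = ∑ i, p i * logCount m (p i) := by
  unfold empiricalEntropy
  rw [expect_sum]
  refine Finset.sum_congr rfl fun i _ => ?_
  rw [mul_logCount hm, ← expect_symbolCount hp i]

theorem sum_symbolCount (x : Fin n → Fin k) : ∑ i, symbolCount x i = n := by
  simp only [symbolCount]
  rw [← Finset.card_eq_sum_card_fiberwise (f := x) (s := Finset.univ) (t := Finset.univ)
    fun _ _ => Finset.mem_univ _]
  simp

theorem symbolCount_le (x : Fin n → Fin k) (i : Fin k) : symbolCount x i ≤ n := by
  simpa [symbolCount] using Finset.card_filter_le (Finset.univ : Finset (Fin n)) fun j => x j = i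

/-- Summing over samples instead of symbols. -/
theorem sum_apply_symbol (x : Fin n → Fin k) (f : Fin k → ℝ) :
    ∑ j, f (x j) = ∑ i, symbolCount x i * f i := by
  rw [← Finset.sum_fiberwise Finset.univ x]
  refine Finset.sum_congr rfl fun i _ => ?_
  rw [Finset.sum_congr rfl fun j hj => by rw [(Finset.mem_filter.mp hj).2]]
  simp [symbolCount]

theorem empiricalEntropy_nonneg (x : Fin n → Fin k) : 0 ≤ empiricalEntropy x :=
  Finset.sum_nonneg fun i _ => Real.negMulLog_nonneg (by positivity)
    (div_le_one_of_le₀ (by exact_mod_cast symbolCount_le x i) (by positivity))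

theorem empiricalEntropy_le (hn : 1 ≤ n) (x : Fin n → Fin k) :
    empiricalEntropy x ≤ Real.log n := by
  have hn' : (0 : ℝ) < n := by exact_mod_cast hn
  have h : ∀ i, Real.negMulLog ((symbolCount x i : ℝ) / n) ≤
      (symbolCount x i : ℝ) / n * Real.log n := by
    intro i
    rcases Nat.eq_zero_or_pos (symbolCount x i) with h0 | h0
    · simp [h0]
    have h0' : (1 : ℝ) ≤ symbolCount x i := by exact_mod_cast h0
    rw [Real.negMulLog, Real.log_div (by positivity) hn'.ne']
    have := Real.log_nonneg h0'
    have : 0 ≤ (symbolCount x i : ℝ) / n * Real.log (symbolCount x i) := by positivity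
    linarith
  calc _ ≤ ∑ i, (symbolCount x i : ℝ) / n * Real.log n := Finset.sum_le_sum fun i _ => h i
    _ = _ := by
      rw [← Finset.sum_mul, ← Finset.sum_div, ← Nat.cast_sum, sum_symbolCount, div_self hn'.ne',
        one_mul]

/-- The only property of the competitor's loss that is used for large `n`: it dominates the bias.
The fluctuations of the plug-in estimate from `m` samples play no role. -/
theorem bias_le_meanAbsError {m : ℕ} (hp : p ∈ stdSimplex ℝ (Fin k)) :
    shannonEntropy p - expect m p empiricalEntropy ≤
      meanAbsError shannonEntropy (empiricalEntropy : (Fin m → Fin k) → ℝ) p := by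
  rw [meanAbsError_eq_expect]
  have h := abs_expect_le (n := m) hp.1 fun x => empiricalEntropy x - shannonEntropy p
  rw [expect_sub, expect_const hp.2] at h
  linarith [neg_abs_le (expect m p empiricalEntropy - shannonEntropy p)]

end

end EntropyAmplification

namespace EntropyAmplification

/-! ### Chebyshev polynomials in hypergeometric form -/

/-- Coefficients of the polynomial `x ↦ T_k (1 - 2 x)`. -/
noncomputable def chebCoef (k : ℝ) (j : ℕ) : ℝ :=
  ∏ i ∈ Finset.range j, 4 * ((i : ℝ) ^ 2 - k ^ 2) / ((2 * i + 1) * (2 * i + 2))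

/-- The polynomial `T_k (1 - 2 x)`, for `k ≤ L`. -/
noncomputable def chebSum (L : ℕ) (k x : ℝ) : ℝ :=
  ∑ j ∈ Finset.range (L + 1), chebCoef k j * x ^ j

theorem chebCoef_succ (k : ℝ) (j : ℕ) : chebCoef k (j + 1) =
    chebCoef k j * (4 * ((j : ℝ) ^ 2 - k ^ 2) / ((2 * j + 1) * (2 * j + 2))) :=
  Finset.prod_range_succ _ _

theorem chebCoef_eq_zero {k j : ℕ} (h : k < j) : chebCoef k j = 0 :=
  Finset.prod_eq_zero (Finset.mem_range.mpr h) (by simp)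

/-- The four coefficients in the three-term recurrence share all but a few linear factors.
Exhibiting the common factor `X` avoids division by `k - j`, which may vanish, and leaves a
polynomial identity. At `j = 0` the last formula would force `X = -2/k`, so that case is set apart.
-/
theorem exists_common_factor (k : ℝ) (j : ℕ) : ∃ X : ℝ,
    chebCoef (k + 1) (j + 1) = (k + 1) * (k + j) * (k + j + 1) * X ∧
    chebCoef (k - 1) (j + 1) = (k - 1) * (k - j) * (k - j - 1) * X ∧
    chebCoef k (j + 1) = k * (k - j) * (k + j) * X ∧
    chebCoef k j = -(k * X) * ((2 * j + 1) * (2 * j + 2)) / 4 ∨ j = 0 := by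
  induction j with
  | zero => exact ⟨0, Or.inr rfl⟩
  | succ j ih =>
    have e1 : (2 * (j : ℝ) + 1) ≠ 0 := by positivity
    have e2 : (2 * (j : ℝ) + 2) ≠ 0 := by positivity
    have e3 : (2 * ((j : ℝ) + 1) + 1) ≠ 0 := by positivity
    have e4 : (2 * ((j : ℝ) + 1) + 2) ≠ 0 := by positivity
    obtain ⟨X, ⟨h1, h2, h3, h4⟩ | rfl⟩ := ih
    · refine ⟨X * (4 * ((j : ℝ) - k) * (j + k) / ((2 * (j + 1) + 1) * (2 * (j + 1) + 2))), Or.inl ?_⟩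
      refine ⟨?_, ?_, ?_, ?_⟩
      · rw [chebCoef_succ, h1]; push_cast; field_simp; ring
      · rw [chebCoef_succ, h2]; push_cast; field_simp; ring
      · rw [chebCoef_succ, h3]; push_cast; field_simp; ring
      · rw [h3]; push_cast; field_simp; ring
    · refine ⟨4 * k / 6, Or.inl ?_⟩
      simp only [chebCoef, Finset.prod_range_succ, Finset.prod_range_zero]
      norm_num
      refine ⟨?_, ?_, ?_, ?_⟩ <;> ring

theorem chebCoef_recurrence (k : ℝ) (j : ℕ) :
    chebCoef (k + 1) (j + 1) =
      2 * chebCoef k (j + 1) - 4 * chebCoef k j - chebCoef (k - 1) (j + 1) := by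
  obtain ⟨X, ⟨h1, h2, h3, h4⟩ | rfl⟩ := exists_common_factor k j
  · rw [h1, h2, h3, h4]; ring
  · simp [chebCoef]; ring

theorem chebSum_recurrence {L k : ℕ} (h : k + 1 < L) (x : ℝ) :
    chebSum L (k + 2 : ℕ) x =
      2 * (1 - 2 * x) * chebSum L (k + 1 : ℕ) x - chebSum L k x := by
  -- The middle polynomial has degree below `L`, so multiplying it by `x` stays within the range of
  -- summation.
  have e : chebSum L (k + 1 : ℕ) x = ∑ j ∈ Finset.range L, chebCoef (k + 1 : ℕ) j * x ^ j := by
    rw [chebSum, Finset.sum_range_succ, chebCoef_eq_zero h]; simp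
  have e2 : 2 * (1 - 2 * x) * chebSum L (k + 1 : ℕ) x = 2 * chebSum L (k + 1 : ℕ) x -
      ∑ j ∈ Finset.range L, 4 * chebCoef (k + 1 : ℕ) j * x ^ (j + 1) := by
    have : 2 * (1 - 2 * x) * chebSum L (k + 1 : ℕ) x = 2 * chebSum L (k + 1 : ℕ) x -
      4 * x * chebSum L (k + 1 : ℕ) x := by ring
    rw [this]
    congr 1
    rw [e, Finset.mul_sum]
    exact Finset.sum_congr rfl fun j _ => by ring
  rw [e2]
  simp only [chebSum]
  rw [Finset.sum_range_succ' _ L, Finset.sum_range_succ' _ L, Finset.sum_range_succ' _ L]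
  have h0 : ∀ t : ℝ, chebCoef t 0 = 1 := fun t => by simp [chebCoef]
  have h1 : ∀ j, chebCoef (k + 2 : ℕ) (j + 1) = 2 * chebCoef (k + 1 : ℕ) (j + 1) -
      4 * chebCoef (k + 1 : ℕ) j - chebCoef k (j + 1) := by
    intro j
    have := chebCoef_recurrence (k + 1 : ℕ) j
    push_cast at this ⊢
    rw [show (k : ℝ) + 1 + 1 = k + 2 by ring, add_sub_cancel_right] at this
    exact this
  simp only [h0, h1, sub_mul, Finset.sum_sub_distrib, mul_add, Finset.mul_sum, mul_assoc]
  ring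

/-- Both sides satisfy the same recurrence in `k`. The explicit coefficients serve for unbiased
estimation and size bounds, the cosine form for the truncation error. -/
theorem chebSum_cos {L k : ℕ} (h : k ≤ L) (θ : ℝ) :
    chebSum L k ((1 - Real.cos θ) / 2) = Real.cos (k * θ) := by
  induction k using Nat.twoStepInduction with
  | zero =>
    rw [chebSum, Finset.sum_range_succ']
    have h0 : ∀ j : ℕ, chebCoef (0 : ℕ) (j + 1) = 0 := fun j => chebCoef_eq_zero (Nat.succ_pos j)
    simp only [h0]
    simp [chebCoef]
  | one =>
    obtain ⟨L, rfl⟩ : ∃ K, L = K + 1 := ⟨L - 1, by omega⟩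
    rw [chebSum, Finset.sum_range_succ', Finset.sum_range_succ']
    have h1 : ∀ j : ℕ, chebCoef (1 : ℕ) (j + 1 + 1) = 0 := fun j => chebCoef_eq_zero (by omega)
    simp only [h1]
    simp [chebCoef]; ring
  | more k ih1 ih2 =>
    rw [chebSum_recurrence (by omega), ih1 (by omega), ih2 (by omega)]
    have h1 := Real.cos_add ((k + 1 : ℕ) * θ) θ
    have h2 := Real.cos_sub ((k + 1 : ℕ) * θ) θ
    rw [show ((k + 1 : ℕ) : ℝ) * θ + θ = (k + 2 : ℕ) * θ by push_cast; ring] at h1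
    rw [show ((k + 1 : ℕ) : ℝ) * θ - θ = k * θ by push_cast; ring] at h2
    linear_combination -h1 - h2

/-! ### Truncating the logarithmic series -/

/-- Summation by parts: multiplication by `1 - z` leaves a first term, a boundary term (moved to the
left) and a sum weighted by `1/(i(i+1))`, which telescopes. -/
theorem norm_mul_sum_le {z : ℂ} (hz : ‖z‖ ≤ 1) (L d : ℕ) :
    ‖(1 - z) * ∑ i ∈ Finset.range (d + 1), z ^ (L + 1 + i) / ((L + 1 + i : ℕ) : ℂ) +
      z ^ (L + 1 + d + 1) / ((L + 1 + d : ℕ) : ℂ)‖ ≤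
      ‖z‖ ^ (L + 1) * (2 / (L + 1) - 1 / (L + 1 + d)) := by
  have hL : ((L : ℝ) + 1) ≠ 0 := by positivity
  induction d with
  | zero =>
    have : (1 - z) * ∑ i ∈ Finset.range (0 + 1), z ^ (L + 1 + i) / ((L + 1 + i : ℕ) : ℂ) +
      z ^ (L + 1 + 0 + 1) / ((L + 1 + 0 : ℕ) : ℂ) = z ^ (L + 1) / ((L + 1 : ℕ) : ℂ) := by
      simp; ring
    rw [this, norm_div, norm_pow, Complex.norm_natCast]
    apply le_of_eq
    push_cast; field_simp; ring
  | succ d ih =>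
    have hd : ((L + 1 + d : ℕ) : ℂ) ≠ 0 := Nat.cast_ne_zero.mpr (by omega)
    have hd' : ((L + 1 + (d + 1) : ℕ) : ℂ) ≠ 0 := Nat.cast_ne_zero.mpr (by omega)
    have e : (1 - z) * ∑ i ∈ Finset.range (d + 1 + 1), z ^ (L + 1 + i) / ((L + 1 + i : ℕ) : ℂ) +
        z ^ (L + 1 + (d + 1) + 1) / ((L + 1 + (d + 1) : ℕ) : ℂ) =
        ((1 - z) * ∑ i ∈ Finset.range (d + 1), z ^ (L + 1 + i) / ((L + 1 + i : ℕ) : ℂ) +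
          z ^ (L + 1 + d + 1) / ((L + 1 + d : ℕ) : ℂ)) -
        z ^ (L + 1 + d + 1) / (((L + 1 + d : ℕ) : ℂ) * ((L + 1 + (d + 1) : ℕ) : ℂ)) := by
      rw [Finset.sum_range_succ]
      field_simp
      push_cast
      ring
    rw [e]
    refine (norm_sub_le _ _).trans ?_
    have h2 : ‖z ^ (L + 1 + d + 1) / (((L + 1 + d : ℕ) : ℂ) * ((L + 1 + (d + 1) : ℕ) : ℂ))‖ ≤
        ‖z‖ ^ (L + 1) * (1 / (L + 1 + d) - 1 / (L + 1 + (d + 1))) := by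
      rw [norm_div, norm_mul, norm_pow, Complex.norm_natCast, Complex.norm_natCast]
      have : (1 : ℝ) / (L + 1 + d) - 1 / (L + 1 + (d + 1)) =
          1 / ((L + 1 + d : ℕ) * (L + 1 + (d + 1) : ℕ)) := by
        push_cast
        have : (L : ℝ) + 1 + d ≠ 0 := by positivity
        have : (L : ℝ) + 1 + (d + 1) ≠ 0 := by positivity
        field_simp; ring
      rw [this, mul_one_div]
      gcongr ?_ / _
      exact pow_le_pow_of_le_one (norm_nonneg _) hz (by omega)
    push_cast at ih h2 ⊢
    calc _ ≤ _ := add_le_add ih h2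
      _ = _ := by ring

/-- The limit `d → ∞` of the preceding bound. Having `‖1 - z‖` rather than `1 - ‖z‖` in the
denominator is what produces an error that decays as the probability grows. -/
theorem norm_log_series_tail_le {z : ℂ} (hz : ‖z‖ < 1) (L : ℕ) :
    ‖-Complex.log (1 - z) - ∑ i ∈ Finset.range L, z ^ (i + 1) / ((i + 1 : ℕ) : ℂ)‖ ≤
      2 * ‖z‖ ^ (L + 1) / ((L + 1) * ‖1 - z‖) := by
  have hz1 : 0 < ‖1 - z‖ := norm_pos_iff.mpr fun h => by
    rw [← sub_eq_zero.mp h] at hz; simp at hz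
  have hs := (Complex.hasSum_taylorSeries_neg_log hz).tendsto_sum_nat
  have hs2 : Filter.Tendsto (fun d : ℕ => (1 - z) *
      (∑ i ∈ Finset.range (L + 1 + (d + 1)), z ^ i / (i : ℂ) -
        ∑ i ∈ Finset.range (L + 1), z ^ i / (i : ℂ)) +
        z ^ (L + 1 + d + 1) / ((L + 1 + d : ℕ) : ℂ)) Filter.atTop
      (nhds ((1 - z) * (-Complex.log (1 - z) - ∑ i ∈ Finset.range (L + 1), z ^ i / (i : ℂ)) + 0)) := by
    refine Filter.Tendsto.add (Filter.Tendsto.const_mul _ (Filter.Tendsto.sub_const ?_ _)) ?_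
    · refine hs.comp (Filter.tendsto_atTop_mono (fun d => ?_) Filter.tendsto_id)
      simp only [id]; omega
    · refine squeeze_zero_norm (a := fun d : ℕ => ‖z‖ ^ d) (fun d => ?_)
        (tendsto_pow_atTop_nhds_zero_of_lt_one (norm_nonneg _) hz)
      rw [norm_div, norm_pow, Complex.norm_natCast]
      refine (div_le_self (by positivity) (by exact_mod_cast (by omega))).trans ?_
      exact pow_le_pow_of_le_one (norm_nonneg _) hz.le (by omega)
  have hb := le_of_tendsto' hs2.norm (b := ‖z‖ ^ (L + 1) * (2 / (L + 1))) fun d => by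
    have := norm_mul_sum_le hz.le L d
    rw [Finset.sum_range_add _ (L + 1) (d + 1)]
    rw [add_sub_cancel_left]
    refine this.trans ?_
    gcongr
    have : (0 : ℝ) ≤ 1 / (L + 1 + d) := by positivity
    linarith
  rw [add_zero, norm_mul, Finset.sum_range_succ'] at hb
  simp only [pow_zero, Nat.cast_zero, div_zero, add_zero] at hb
  rw [le_div_iff₀ (by positivity)]
  have : (0 : ℝ) < L + 1 := by positivity
  calc _ = (L + 1) * (‖1 - z‖ * ‖-Complex.log (1 - z) -
        ∑ i ∈ Finset.range L, z ^ (i + 1) / ((i + 1 : ℕ) : ℂ)‖) := by ring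
    _ ≤ (L + 1) * (‖z‖ ^ (L + 1) * (2 / (L + 1))) := by gcongr
    _ = _ := by field_simp

/-- Truncated Chebyshev expansion of the logarithm. -/
theorem abs_chebSum_series_add_log_le {ρ x : ℝ} (hρ0 : 0 < ρ) (hρ1 : ρ < 1) (hx0 : 0 ≤ x)
    (hx1 : x ≤ 1) (L : ℕ) :
    |∑ k ∈ Finset.range L, 2 * ρ ^ (k + 1) / ((k + 1 : ℕ) : ℝ) * chebSum L (k + 1 : ℕ) x +
      Real.log ((1 - ρ) ^ 2 + 4 * ρ * x)| ≤
      4 * ρ ^ (L + 1) / ((L + 1) * √((1 - ρ) ^ 2 + 4 * ρ * x)) := by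
  -- With `x = (1 - cos θ)/2` and `z = ρ e^{iθ}` one has `‖1 - z‖² = (1 - ρ)² + 4ρx`, and the
  -- Chebyshev series is twice the real part of the series of `-log (1 - z)`.
  set θ := Real.arccos (1 - 2 * x)
  have hθ : Real.cos θ = 1 - 2 * x := Real.cos_arccos (by linarith) (by linarith)
  have hx : x = (1 - Real.cos θ) / 2 := by rw [hθ]; ring
  set z : ℂ := ρ * Complex.exp (θ * Complex.I) with hz
  have hzn : ‖z‖ = ρ := by
    rw [hz, norm_mul, Complex.norm_exp_ofReal_mul_I, mul_one, Complex.norm_real, Real.norm_eq_abs,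
      abs_of_pos hρ0]
  have hre : ∀ k : ℕ, (z ^ k / (k : ℂ)).re = ρ ^ k * Real.cos (k * θ) / k := by
    intro k
    rw [Complex.div_natCast_re, hz, mul_pow, ← Complex.exp_nat_mul, ← Complex.ofReal_pow,
      Complex.re_ofReal_mul]
    congr 2
    rw [← mul_assoc, ← Complex.ofReal_natCast, ← Complex.ofReal_mul, Complex.exp_ofReal_mul_I_re]
  have hnsq : ‖1 - z‖ ^ 2 = (1 - ρ) ^ 2 + 4 * ρ * x := by
    rw [← Complex.normSq_eq_norm_sq, Complex.normSq_apply]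
    have r : z.re = ρ * Real.cos θ := by
      rw [hz, Complex.re_ofReal_mul, Complex.exp_ofReal_mul_I_re]
    have i : z.im = ρ * Real.sin θ := by
      rw [hz, Complex.im_ofReal_mul, Complex.exp_ofReal_mul_I_im]
    rw [Complex.sub_re, Complex.sub_im, r, i, hx]
    simp only [Complex.one_re, Complex.one_im]
    linear_combination ρ ^ 2 * Real.sin_sq_add_cos_sq θ
  have hn : √((1 - ρ) ^ 2 + 4 * ρ * x) = ‖1 - z‖ := by
    rw [← hnsq, Real.sqrt_sq (norm_nonneg _)]
  have ht := norm_log_series_tail_le (z := z) (by rw [hzn]; exact hρ1) L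
  have hre2 : ∑ k ∈ Finset.range L, 2 * ρ ^ (k + 1) / ((k + 1 : ℕ) : ℝ) * chebSum L (k + 1 : ℕ) x +
      Real.log ((1 - ρ) ^ 2 + 4 * ρ * x) =
      -2 * (-Complex.log (1 - z) - ∑ i ∈ Finset.range L, z ^ (i + 1) / ((i + 1 : ℕ) : ℂ)).re := by
    rw [Complex.sub_re, Complex.neg_re, Complex.log_re, Complex.re_sum, ← hnsq, Real.log_pow]
    simp only [hre]
    have : ∑ k ∈ Finset.range L, 2 * ρ ^ (k + 1) / ((k + 1 : ℕ) : ℝ) * chebSum L (k + 1 : ℕ) x =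
        2 * ∑ k ∈ Finset.range L, ρ ^ (k + 1) * Real.cos ((k + 1 : ℕ) * θ) / ((k + 1 : ℕ) : ℝ) := by
      rw [Finset.mul_sum]
      refine Finset.sum_congr rfl fun k hk => ?_
      rw [hx, chebSum_cos (Finset.mem_range.mp hk)]; ring
    rw [this]; push_cast; ring
  rw [hre2, hn, abs_mul]
  norm_num
  have := (Complex.abs_re_le_norm _).trans ht
  rw [hzn] at this
  calc _ ≤ 2 * (2 * ρ ^ (L + 1) / ((L + 1) * ‖1 - z‖)) := by
        refine mul_le_mul_of_nonneg_left ?_ (by norm_num)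
        simpa using this
    _ = _ := by ring

end EntropyAmplification

namespace EntropyAmplification

/-! ### The polynomial estimate of `-log p` -/

/-- Unbiased estimate of `T_k (1 - p w / 2)` from a binomial count `N` of `M` trials. -/
noncomputable def chebEst (L M : ℕ) (w : ℝ) (k N : ℕ) : ℝ :=
  ∑ j ∈ Finset.range (L + 1), ∏ i ∈ Finset.range j,
    w * (((i : ℝ) ^ 2 - (k : ℝ) ^ 2) * ((N : ℝ) - i)) /
      (((2 * i + 1) * (2 * i + 2)) * ((M : ℝ) - i))

/-- Unbiased estimate of a polynomial that approximates `-log p`. -/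
noncomputable def logEst (L M : ℕ) (w ρ : ℝ) (N : ℕ) : ℝ :=
  Real.log (w * ρ) +
    ∑ k ∈ Finset.range L, 2 * ρ ^ (k + 1) / ((k + 1 : ℕ) : ℝ) * chebEst L M w (k + 1) N

/-- Each summand of the estimate is a coefficient of the polynomial times a normalized falling
factorial of `N`, whose mean is a power of `p`. The condition `L ≤ M` keeps the denominators
nonzero. -/
theorem binE_chebEst {L M : ℕ} (h : L ≤ M) (w p : ℝ) (k : ℕ) :
    binE M p (chebEst L M w k) = chebSum L k (p * w / 4) := by
  unfold chebEst chebSum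
  rw [binE_sum]
  refine Finset.sum_congr rfl fun j hj => ?_
  have : (fun N : ℕ => ∏ i ∈ Finset.range j, w * (((i : ℝ) ^ 2 - (k : ℝ) ^ 2) * ((N : ℝ) - i)) /
      (((2 * i + 1) * (2 * i + 2)) * ((M : ℝ) - i))) = fun N : ℕ =>
      (chebCoef k j * (w / 4) ^ j) * ∏ i ∈ Finset.range j, ((N : ℝ) - i) / ((M : ℝ) - i) := by
    ext N
    rw [chebCoef, ← Finset.card_range j, ← Finset.prod_const, Finset.card_range,
      ← Finset.prod_mul_distrib, ← Finset.prod_mul_distrib]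
    refine Finset.prod_congr rfl fun i _ => ?_
    rw [mul_div_mul_comm]
    ring
  rw [this, binE_mul_left, binE_prod_falling M j (by have := Finset.mem_range.mp hj; omega)]
  rw [mul_div_assoc, mul_pow]; ring

theorem binE_logEst {L M : ℕ} (h : L ≤ M) (w ρ p : ℝ) :
    binE M p (logEst L M w ρ) = Real.log (w * ρ) + ∑ k ∈ Finset.range L,
      2 * ρ ^ (k + 1) / ((k + 1 : ℕ) : ℝ) * chebSum L (k + 1 : ℕ) (p * w / 4) := by
  unfold logEst
  rw [binE_add, binE_const, binE_sum]
  congr 1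
  refine Finset.sum_congr rfl fun k _ => ?_
  rw [binE_mul_left, binE_chebEst h]

/-- Since `k² - i² ≤ k²` and `(N - i)/(M - i) ≤ N/M`, the terms are dominated by those of the series
of `cosh s` with `s = k √(w N / M)`. Terms with `j > k` or `j > N` contain a zero factor. -/
theorem abs_chebEst_le {L M : ℕ} {w : ℝ} (hw : 0 ≤ w) {k N : ℕ} (hN : N ≤ M) :
    |chebEst L M w k N| ≤ Real.exp (k * √(w * N / M)) := by
  set s := (k : ℝ) * √(w * N / M) with hs
  have hs0 : 0 ≤ s := by positivity
  have hs2 : s ^ 2 = k ^ 2 * (w * N / M) := by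
    rw [hs, mul_pow, Real.sq_sqrt (by positivity)]
  have hterm : ∀ j, |∏ i ∈ Finset.range j,
      w * (((i : ℝ) ^ 2 - (k : ℝ) ^ 2) * ((N : ℝ) - i)) /
        (((2 * i + 1) * (2 * i + 2)) * ((M : ℝ) - i))| ≤ s ^ (2 * j) / (2 * j).factorial := by
    intro j
    by_cases hj : j ≤ k ∧ j ≤ N
    · have e : s ^ (2 * j) / ((2 * j).factorial : ℝ) =
          ∏ i ∈ Finset.range j, s ^ 2 / ((2 * i + 1) * (2 * i + 2)) := by
        clear hj
        induction j with
        | zero => simp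
        | succ j ih =>
          rw [Finset.prod_range_succ, ← ih, show 2 * (j + 1) = 2 * j + 1 + 1 by ring,
            Nat.factorial_succ, Nat.factorial_succ]
          push_cast
          have : ((2 * j).factorial : ℝ) ≠ 0 := by positivity
          field_simp
          ring
      rw [e, Finset.abs_prod]
      refine Finset.prod_le_prod (fun _ _ => abs_nonneg _) fun i hi => ?_
      have hi := Finset.mem_range.mp hi
      have hik : (i : ℝ) + 1 ≤ k := by exact_mod_cast (by omega)
      have hiN : (i : ℝ) + 1 ≤ N := by exact_mod_cast (by omega)
      have hNM : (N : ℝ) ≤ M := by exact_mod_cast hN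
      have hi0 : (0 : ℝ) ≤ i := by positivity
      have hMi : 0 < (M : ℝ) - i := by linarith
      have hM : 0 < (M : ℝ) := by linarith
      have e2 : w * (((i : ℝ) ^ 2 - (k : ℝ) ^ 2) * ((N : ℝ) - i)) /
          (((2 * i + 1) * (2 * i + 2)) * ((M : ℝ) - i)) =
          -((w * ((k : ℝ) ^ 2 - i ^ 2) * (((N : ℝ) - i) / ((M : ℝ) - i))) /
            ((2 * i + 1) * (2 * i + 2))) := by
        field_simp; ring
      have h1 : 0 ≤ (k : ℝ) ^ 2 - i ^ 2 := by nlinarith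
      have h2 : 0 ≤ ((N : ℝ) - i) / ((M : ℝ) - i) := div_nonneg (by linarith) hMi.le
      have h3 : ((N : ℝ) - i) / ((M : ℝ) - i) ≤ N / M := by
        rw [div_le_div_iff₀ hMi hM]; nlinarith
      rw [e2, abs_neg, abs_of_nonneg (by positivity), hs2,
        show (k : ℝ) ^ 2 * (w * N / M) = w * (k : ℝ) ^ 2 * (N / M) by ring]
      have h4 : (k : ℝ) ^ 2 - i ^ 2 ≤ (k : ℝ) ^ 2 := by nlinarith
      gcongr
    · have : ∏ i ∈ Finset.range j, w * (((i : ℝ) ^ 2 - (k : ℝ) ^ 2) * ((N : ℝ) - i)) /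
          (((2 * i + 1) * (2 * i + 2)) * ((M : ℝ) - i)) = 0 := by
        rcases not_and_or.mp hj with h | h
        · exact Finset.prod_eq_zero (i := k) (Finset.mem_range.mpr (by omega)) (by simp)
        · exact Finset.prod_eq_zero (i := N) (Finset.mem_range.mpr (by omega)) (by simp)
      rw [this, abs_zero]; positivity
  calc |chebEst L M w k N| ≤ ∑ j ∈ Finset.range (L + 1), s ^ (2 * j) / ((2 * j).factorial : ℝ) :=
        (Finset.abs_sum_le_sum_abs _ _).trans (Finset.sum_le_sum fun j _ => hterm j)
    _ ≤ Real.cosh s := sum_le_hasSum _ (fun j _ => by positivity) (Real.hasSum_cosh s)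
    _ ≤ Real.exp s := by
        rw [Real.cosh_eq]
        have := Real.exp_le_exp.mpr (show -s ≤ s by linarith)
        linarith

theorem abs_logEst_le {L M : ℕ} {w ρ : ℝ} (hw : 0 ≤ w) (hρ0 : 0 ≤ ρ) (hρ1 : ρ ≤ 1) {N : ℕ}
    (hN : N ≤ M) :
    |logEst L M w ρ N| ≤ |Real.log (w * ρ)| + 2 * L * Real.exp (L * √(w * N / M)) := by
  refine (abs_add_le _ _).trans ((add_le_add_iff_left _).mpr ?_)
  refine (Finset.abs_sum_le_sum_abs _ _).trans ?_
  have : ∀ k ∈ Finset.range L, |2 * ρ ^ (k + 1) / ((k + 1 : ℕ) : ℝ) * chebEst L M w (k + 1) N| ≤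
      2 * Real.exp (L * √(w * N / M)) := by
    intro k hk
    rw [abs_mul, abs_of_nonneg (by positivity)]
    have h1 : 2 * ρ ^ (k + 1) / ((k + 1 : ℕ) : ℝ) ≤ 2 := by
      have := pow_le_one₀ (n := k + 1) hρ0 hρ1
      refine (div_le_self (by positivity) (by push_cast; linarith [Nat.cast_nonneg (α := ℝ) k])).trans ?_
      linarith
    have h2 : |chebEst L M w (k + 1) N| ≤ Real.exp (L * √(w * N / M)) := by
      refine (abs_chebEst_le hw hN).trans (Real.exp_le_exp.mpr ?_)
      have : ((k + 1 : ℕ) : ℝ) ≤ L := by exact_mod_cast Finset.mem_range.mp hk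
      gcongr
    gcongr
  refine (Finset.sum_le_sum this).trans (le_of_eq ?_)
  simp; ring

/-- The polynomial estimate has mean close to `-log (p + a)`. -/
theorem abs_binE_logEst_add_log_le {L M : ℕ} (h : L ≤ M) {w ρ p : ℝ} (hw : 0 < w) (hρ0 : 0 < ρ)
    (hρ1 : ρ < 1) (hp : 0 ≤ p) (hpw : p * w ≤ 4) :
    |binE M p (logEst L M w ρ) + Real.log (p + (1 - ρ) ^ 2 / (ρ * w))| ≤
      4 * ρ ^ (L + 1) / ((L + 1) * √((1 - ρ) ^ 2 + ρ * (p * w))) := by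
  have h1 := abs_chebSum_series_add_log_le hρ0 hρ1 (x := p * w / 4) (by positivity) (by linarith) L
  have e : 4 * ρ * (p * w / 4) = ρ * (p * w) := by ring
  rw [e] at h1
  rw [binE_logEst h]
  have h2 : 0 < (1 - ρ) ^ 2 := by
    have : 0 < 1 - ρ := by linarith
    positivity
  have e2 : (1 - ρ) ^ 2 + ρ * (p * w) = (w * ρ) * (p + (1 - ρ) ^ 2 / (ρ * w)) := by
    field_simp; ring
  have e3 : Real.log ((1 - ρ) ^ 2 + ρ * (p * w)) =
      Real.log (w * ρ) + Real.log (p + (1 - ρ) ^ 2 / (ρ * w)) := by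
    rw [e2, Real.log_mul (by positivity) (by positivity)]
  rw [e3] at h1
  convert h1 using 2
  ring

/-! ### Choice of the parameters -/

/-- The radius at which the logarithmic series is evaluated. -/
noncomputable def radius (ε : ℝ) (L : ℕ) : ℝ := 1 - 1 / (2 ^ 14 * √ε * L)

/-- The inverse (up to a constant) of the length of the interval of approximation. -/
noncomputable def invWidth (L q : ℕ) : ℝ := (q : ℝ) / (1024 * L)

/-- The relations among the parameters when the sample size is amplified: `q₁` and `q₂` are the
sizes of the two halves of the sample, `L` is the degree of the polynomial. -/
structure Regime (ε : ℝ) (n q₁ q₂ L : ℕ) : Prop where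
  add_eq : q₁ + q₂ = n
  le_left : q₂ ≤ q₁
  left_le : q₁ ≤ q₂ + 1
  degree_pos : 1 ≤ L
  log_le : Real.log n ≤ 1024 * L
  le_log : 1024 * (L : ℝ) ≤ Real.log n + 1024
  large : 8192 * L ≤ q₂
  eps_pos : 0 < ε
  eps_le : ε ≤ 1
  one_le : 1 ≤ ε * Real.log n

end EntropyAmplification

namespace EntropyAmplification

/-! ### Size and mean of the estimates of `-log p` when the sample size is amplified. -/

namespace Regime

variable {ε : ℝ} {n q₁ q₂ L m : ℕ} {p : ℝ}

theorem one_le_degree (h : Regime ε n q₁ q₂ L) : (1 : ℝ) ≤ L := by exact_mod_cast h.degree_pos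

theorem large' (h : Regime ε n q₁ q₂ L) : 8192 * (L : ℝ) ≤ q₂ := by exact_mod_cast h.large

theorem half_pos (h : Regime ε n q₁ q₂ L) : (0 : ℝ) < q₂ := by
  linarith [h.large', h.one_le_degree]

theorem n_le (h : Regime ε n q₁ q₂ L) : (n : ℝ) ≤ 3 * q₂ := by
  have : n ≤ 3 * q₂ := by
    have := h.add_eq; have := h.left_le; have := h.large; have := h.degree_pos; omega
  exact_mod_cast this

theorem half_le (h : Regime ε n q₁ q₂ L) : (q₂ : ℝ) ≤ n := by
  have : q₂ ≤ n := by have := h.add_eq; omega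
  exact_mod_cast this

theorem left_le' (h : Regime ε n q₁ q₂ L) : (q₁ : ℝ) ≤ 2 * q₂ := by
  have : q₁ ≤ 2 * q₂ := by
    have := h.left_le; have := h.large; have := h.degree_pos; omega
  exact_mod_cast this

theorem n_pos (h : Regime ε n q₁ q₂ L) : (0 : ℝ) < n := by linarith [h.half_le, h.half_pos]

theorem n_le_exp (h : Regime ε n q₁ q₂ L) : (n : ℝ) ≤ Real.exp (1024 * L) :=
  (Real.log_le_iff_le_exp h.n_pos).mp h.log_le

/-- The place where `1 ≤ ε log n` pays: errors of order `1/L` are of order `ε`. -/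
theorem inv_degree_le (h : Regime ε n q₁ q₂ L) : 1 / (L : ℝ) ≤ 1024 * ε := by
  have := h.one_le_degree
  rw [div_le_iff₀ (by positivity)]
  nlinarith [h.log_le, h.one_le, h.eps_pos]

theorem inv_n_le_eps (h : Regime ε n q₁ q₂ L) : 1 / (n : ℝ) ≤ ε := by
  have h1 := Real.log_le_sub_one_of_pos h.n_pos
  rw [div_le_iff₀ h.n_pos]
  nlinarith [h.one_le, h.eps_pos]

theorem inv_n_le_min (h : Regime ε n q₁ q₂ L) (hp0 : 0 < p) (hp1 : p ≤ 1) :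
    1 / (n : ℝ) ≤ min ε (1 / (n * p)) := by
  have hn := h.n_pos
  refine le_min h.inv_n_le_eps (one_div_le_one_div_of_le (by positivity) ?_)
  nlinarith

theorem sub_radius (L : ℕ) (ε : ℝ) : 1 - radius ε L = 1 / (2 ^ 14 * √ε * L) := by
  simp [radius]

theorem sub_radius_pos (h : Regime ε n q₁ q₂ L) : 0 < 1 - radius ε L := by
  rw [sub_radius]
  have := Real.sqrt_pos.mpr h.eps_pos
  have := h.one_le_degree
  positivity

theorem half_le_radius (h : Regime ε n q₁ q₂ L) : 1 / 2 ≤ radius ε L := by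
  have hs := Real.sqrt_pos.mpr h.eps_pos
  have hL := h.one_le_degree
  have hi := h.inv_degree_le
  rw [div_le_iff₀ (by positivity)] at hi
  have h1 : 1 / 32 ≤ √ε * L := by
    refine le_of_sq_le_sq ?_ (by positivity)
    rw [mul_pow, Real.sq_sqrt h.eps_pos.le]
    nlinarith
  have h2 : 1 / (2 ^ 14 * √ε * L) ≤ 1 / 2 := by
    apply one_div_le_one_div_of_le (by norm_num)
    nlinarith
  rw [radius]; linarith

theorem width_ge (h : Regime ε n q₁ q₂ L) : 8 ≤ invWidth L q₂ := by
  have hL := h.one_le_degree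
  rw [invWidth, le_div_iff₀ (by positivity)]
  linarith [h.large']

theorem abs_log_width_le (h : Regime ε n q₁ q₂ L) :
    |Real.log (invWidth L q₂ * radius ε L)| ≤ 1024 * L := by
  have hw := h.width_ge
  have hr := h.half_le_radius
  have hr1 := h.sub_radius_pos
  have hL := h.one_le_degree
  rw [abs_of_nonneg (Real.log_nonneg (by nlinarith))]
  refine (Real.log_le_log (by nlinarith) ?_).trans h.log_le
  have : invWidth L q₂ ≤ q₂ := by
    rw [invWidth]; exact div_le_self h.half_pos.le (by linarith)
  nlinarith [h.half_le]

theorem sub_one_ge (h : Regime ε n q₁ q₂ L) : (q₂ : ℝ) / 2 ≤ ((q₂ - 1 : ℕ) : ℝ) := by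
  have : 1 ≤ q₂ := by have := h.large; have := h.degree_pos; omega
  rw [Nat.cast_sub this]
  push_cast
  linarith [h.large', h.one_le_degree]

/-- The exponent comes from `L² w N / (q₂ - 1)` with `w = q₂/(1024 L)` and `q₂ - 1 ≥ q₂/2`. -/
theorem abs_logEst_le' (h : Regime ε n q₁ q₂ L) {N : ℕ} (hN : N ≤ q₂ - 1) :
    |logEst L (q₂ - 1) (invWidth L q₂) (radius ε L) N| ≤
      1024 * L + 2 * L * Real.exp (√(N * L / 512)) := by
  have hw := h.width_ge
  have hr := h.half_le_radius
  have hr1 := h.sub_radius_pos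
  have hL := h.one_le_degree
  have hq := h.half_pos
  refine (abs_logEst_le (by linarith) (by linarith) (by linarith) hN).trans ?_
  refine add_le_add h.abs_log_width_le ?_
  have : (L : ℝ) * √(invWidth L q₂ * N / ((q₂ - 1 : ℕ) : ℝ)) ≤ √(N * L / 512) := by
    refine Real.le_sqrt_of_sq_le ?_
    have hw0 : 0 ≤ invWidth L q₂ := by linarith
    rw [mul_pow, Real.sq_sqrt (by positivity)]
    calc (L : ℝ) ^ 2 * (invWidth L q₂ * N / ((q₂ - 1 : ℕ) : ℝ)) ≤
          (L : ℝ) ^ 2 * (invWidth L q₂ * N / ((q₂ : ℝ) / 2)) := by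
          have := h.sub_one_ge
          gcongr
      _ = _ := by rw [invWidth]; field_simp; ring
  gcongr

/-- At the cutoff `2 ^ 15 * L` the exponent is `√(2 ^ 6 L²) = 8 L`; since `L` is about `log n /
1024`, the exponential is a very small power of `n`. -/
theorem abs_logEst_le_of_le (h : Regime ε n q₁ q₂ L) {N : ℕ} (hN : N ≤ q₂ - 1)
    (hN2 : N ≤ 2 ^ 15 * L) :
    |logEst L (q₂ - 1) (invWidth L q₂) (radius ε L) N| ≤ 1026 * L * Real.exp (8 * L) := by
  refine (h.abs_logEst_le' hN).trans ?_
  have hL := h.one_le_degree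
  have : √((N : ℝ) * L / 512) ≤ 8 * L := by
    rw [Real.sqrt_le_left (by positivity)]
    have : (N : ℝ) ≤ 2 ^ 15 * L := by exact_mod_cast hN2
    nlinarith
  have h1 := Real.exp_le_exp.mpr this
  have h2 := Real.one_le_exp (show (0 : ℝ) ≤ 8 * L by positivity)
  nlinarith

theorem abs_logEst_le_of_ge (h : Regime ε n q₁ q₂ L) {N : ℕ} (hN : N ≤ q₂ - 1)
    (hN2 : 2 ^ 15 * L ≤ N) :
    |logEst L (q₂ - 1) (invWidth L q₂) (radius ε L) N| ≤ 1026 * L * Real.exp (N / 2) := by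
  refine (h.abs_logEst_le' hN).trans ?_
  have hL := h.one_le_degree
  have hN2' : 2 ^ 15 * (L : ℝ) ≤ N := by exact_mod_cast hN2
  have : √((N : ℝ) * L / 512) ≤ N / 2 := by
    rw [Real.sqrt_le_left (by positivity)]
    nlinarith
  have h1 := Real.exp_le_exp.mpr this
  have h2 := Real.one_le_exp (show (0 : ℝ) ≤ N / 2 by positivity)
  nlinarith

/-- Log-frequencies of at most `q₂` samples. -/
theorem abs_log_div_le (h : Regime ε n q₁ q₂ L) {N : ℕ} (hN : N ≤ q₂ - 1) :
    |-Real.log (((N + 1 : ℕ) : ℝ) / q₂)| ≤ 1024 * L := by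
  have hq := h.half_pos
  have h1 : 1 ≤ q₂ := by exact_mod_cast (Nat.pos_of_ne_zero (by rintro rfl; simp at hq))
  have h2 : ((N + 1 : ℕ) : ℝ) ≤ q₂ := by exact_mod_cast (by omega)
  have h3 : (1 : ℝ) ≤ ((N + 1 : ℕ) : ℝ) := by exact_mod_cast (by omega)
  have h4 := Real.log_nonneg h3
  have h5 := Real.log_le_log (by linarith) h2
  have h6 := Real.log_le_log hq h.half_le
  rw [Real.log_div (by positivity) hq.ne', abs_of_nonneg (by linarith)]
  linarith [h.log_le]

/-- Since `n ≤ exp (1024 L)`, the surplus `912 L` in the exponent absorbs the factor `2050`. -/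
theorem exp_neg_le (h : Regime ε n q₁ q₂ L) {t : ℝ} (ht : t ≤ -1936 * L) :
    2050 * Real.exp t ≤ 1 / n := by
  have h1 : (2050 : ℝ) ≤ Real.exp 912 := by
    have := Real.quadratic_le_exp_of_nonneg (show (0 : ℝ) ≤ 912 by norm_num)
    linarith
  have hL := h.one_le_degree
  calc 2050 * Real.exp t ≤ Real.exp 912 * Real.exp t := by gcongr
    _ = Real.exp (912 + t) := (Real.exp_add _ _).symm
    _ ≤ Real.exp (-(1024 * L)) := Real.exp_le_exp.mpr (by linarith)
    _ ≤ 1 / n := by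
      rw [Real.exp_neg, ← one_div]
      exact one_div_le_one_div_of_le h.n_pos h.n_le_exp

/-- The estimate of `-log p` for a symbol that occurs `a` times in the first half of the sample and
`c` times in the second half. -/
noncomputable def _root_.EntropyAmplification.hybridEst (ε : ℝ) (L q₂ a c : ℕ) : ℝ :=
  if a ≤ 512 * L ∧ c ≤ 2 ^ 15 * L then logEst L (q₂ - 1) (invWidth L q₂) (radius ε L) (c - 1)
  else -Real.log ((c : ℝ) / q₂)

/-- The condition on `p` places `p w / 4` in `[0, 1]`. Write `δ = 1 - ρ`. The bound by `ε` uses that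
the root is at least `δ`, that `ρ ^ L ≤ exp (-δ L) ≤ 1/(δ L)`, and that `(δ L)² = 1/(2 ^ 28 ε)`. The
bound by `1/(n p)` uses only that the root is at least `p w / 4`. -/
theorem mean_logEst (h : Regime ε n q₁ q₂ L) (hp0 : 0 < p) (hp : p * q₂ ≤ 4096 * L) :
    |binE (q₂ - 1) p (logEst L (q₂ - 1) (invWidth L q₂) (radius ε L)) +
      Real.log (p + (1 - radius ε L) ^ 2 / (radius ε L * invWidth L q₂))| ≤
      2 ^ 30 * min ε (1 / (n * p)) := by
  have hL := h.one_le_degree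
  have hq := h.half_pos
  have hw := h.width_ge
  have hr := h.half_le_radius
  have hr1 := h.sub_radius_pos
  have hn := h.n_pos
  have hpw : p * invWidth L q₂ ≤ 4 := by
    rw [invWidth, ← mul_div_assoc, div_le_iff₀ (by positivity)]; linarith
  refine (abs_binE_logEst_add_log_le (by have := h.large; have := h.degree_pos; omega)
    (by linarith) (by linarith) (by linarith) hp0.le hpw).trans ?_
  set ρ := radius ε L with hρ
  set w := invWidth L q₂ with hw'
  set δ := 1 - ρ with hδ
  have hs := Real.sqrt_pos.mpr h.eps_pos
  rw [mul_min_of_nonneg _ _ (by norm_num)]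
  refine le_min ?_ ?_
  · have h1 : δ ≤ √(δ ^ 2 + ρ * (p * w)) := by
      refine Real.le_sqrt_of_sq_le ?_
      have : 0 ≤ ρ * (p * w) := by
        have : 0 ≤ ρ := by linarith
        have : 0 ≤ w := by linarith
        positivity
      linarith
    have h2 : ρ ^ (L + 1) ≤ 1 / (δ * L) := by
      calc ρ ^ (L + 1) ≤ ρ ^ L := pow_le_pow_of_le_one (by linarith) (by linarith) (by omega)
        _ ≤ (Real.exp (-δ)) ^ L := by
          have := Real.add_one_le_exp (-δ)
          gcongr
          linarith
        _ = (Real.exp (δ * L))⁻¹ := by rw [← Real.exp_nat_mul, ← Real.exp_neg]; ring_nf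
        _ ≤ 1 / (δ * L) := by
          rw [← one_div]
          refine one_div_le_one_div_of_le (by positivity) ?_
          linarith [Real.add_one_le_exp (δ * L)]
    calc 4 * ρ ^ (L + 1) / ((L + 1) * √(δ ^ 2 + ρ * (p * w))) ≤
          4 * (1 / (δ * L)) / (L * δ) := by
          gcongr
          linarith
      _ = 4 / (δ * L) ^ 2 := by field_simp
      _ = 4 * 2 ^ 28 * ε := by
        have : δ * L = 1 / (2 ^ 14 * √ε) := by
          rw [hδ, hρ, sub_radius]; field_simp
        rw [this, div_pow, mul_pow, Real.sq_sqrt h.eps_pos.le]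
        have := h.eps_pos
        field_simp
      _ ≤ _ := by linarith
  · have hw0 : 0 < w := by linarith
    have h1 : p * w / 4 ≤ √(δ ^ 2 + ρ * (p * w)) := by
      refine Real.le_sqrt_of_sq_le ?_
      have : 0 < p * w := by positivity
      nlinarith [sq_nonneg δ]
    have h2 : ρ ^ (L + 1) ≤ 1 := pow_le_one₀ (by linarith) (by linarith)
    calc 4 * ρ ^ (L + 1) / ((L + 1) * √(δ ^ 2 + ρ * (p * w))) ≤ 4 * 1 / (L * (p * w / 4)) := by
          gcongr
          linarith
      _ = 16384 / (p * q₂) := by rw [hw', invWidth]; field_simp; norm_num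
      _ ≤ 2 ^ 30 * (1 / (n * p)) := by
        rw [mul_one_div, div_le_div_iff₀ (by positivity) (by positivity)]
        nlinarith [mul_le_mul_of_nonneg_left h.n_le hp0.le]

/-- The polynomial targets `-log (p + s)`; this makes its shift `s` no larger than the one inherent
in the plug-in estimate from `m` samples. The choice of the radius gives `s ≤ 1/(2 ^ 17 ε L q₂)`,
while `16 m ≤ 16 * 6144 ε L q₂`. -/
theorem shift_le (h : Regime ε n q₁ q₂ L) (hm : 1 ≤ m) (hm2 : (m : ℝ) ≤ 2 * (ε * n * Real.log n)) :
    (1 - radius ε L) ^ 2 / (radius ε L * invWidth L q₂) ≤ 1 / (16 * m) := by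
  have hL := h.one_le_degree
  have hq := h.half_pos
  have hr := h.half_le_radius
  have hw := h.width_ge
  have hε := h.eps_pos
  have hs := Real.sqrt_pos.mpr h.eps_pos
  have hm' : (0 : ℝ) < m := by exact_mod_cast hm
  have h1 : (m : ℝ) ≤ 6144 * (ε * L * q₂) := by
    have : ε * n * Real.log n ≤ ε * (3 * q₂) * (1024 * L) := by
      have := h.n_le
      have := h.log_le
      have := h.n_pos
      gcongr
    linarith
  calc (1 - radius ε L) ^ 2 / (radius ε L * invWidth L q₂) ≤
        (1 - radius ε L) ^ 2 / (1 / 2 * invWidth L q₂) := by gcongr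
    _ = 1 / (2 ^ 17 * (ε * L * q₂)) := by
      rw [sub_radius, invWidth, div_pow, mul_pow, mul_pow, Real.sq_sqrt hε.le]
      field_simp; norm_num
    _ ≤ 1 / (16 * m) := by
      refine one_div_le_one_div_of_le (by positivity) ?_
      have : 0 < ε * L * q₂ := by positivity
      nlinarith

/-- For rare symbols the truncation of the polynomial estimate to small counts is immaterial. -/
theorem truncation_le (h : Regime ε n q₁ q₂ L) (hp0 : 0 < p) (hp1 : p ≤ 1)
    (hp : p * q₂ ≤ 4096 * L) :
    |binE (q₂ - 1) p (fun N => hybridEst ε L q₂ 0 (N + 1)) -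
      binE (q₂ - 1) p (logEst L (q₂ - 1) (invWidth L q₂) (radius ε L))| ≤ 1 / n := by
  have hL := h.one_le_degree
  -- Exponential tilting: the two differ only when `N ≥ 2 ^ 15 * L`, where `N/2 ≤ N - 2 ^ 14 * L`.
  -- The exponential moment of `N` is at most `exp (8192 L)` in the mean, leaving `exp (-8191 L)`.
  have hb : ∀ N ≤ q₂ - 1, |hybridEst ε L q₂ 0 (N + 1) -
      logEst L (q₂ - 1) (invWidth L q₂) (radius ε L) N| ≤
      (2050 * Real.exp (L - 2 ^ 14 * L)) * (Real.exp 1) ^ N := by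
    intro N hN
    rw [hybridEst]
    split_ifs with hc
    · simp only [Nat.add_sub_cancel, sub_self, abs_zero]; positivity
    · have hN2 : 2 ^ 15 * L ≤ N := by
        by_contra hcon
        exact hc ⟨by omega, by omega⟩
      have hN2' : 2 ^ 15 * (L : ℝ) ≤ N := by exact_mod_cast hN2
      refine (abs_sub _ _).trans ?_
      have h1 := h.abs_log_div_le hN
      have h2 := h.abs_logEst_le_of_ge hN hN2
      have h3 := Real.one_le_exp (show (0 : ℝ) ≤ N / 2 by positivity)
      have h4 : (L : ℝ) ≤ Real.exp L := by linarith [Real.add_one_le_exp (L : ℝ)]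
      calc _ ≤ 1024 * L + 1026 * L * Real.exp (N / 2) := add_le_add h1 h2
        _ ≤ 2050 * (L * Real.exp (N / 2)) := by nlinarith
        _ ≤ 2050 * (Real.exp L * Real.exp (N - 2 ^ 14 * L)) := by
          gcongr
          linarith
        _ = _ := by
          rw [← Real.exp_nat_mul, ← Real.exp_add, mul_assoc, ← Real.exp_add]
          ring_nf
  rw [← binE_sub]
  have hE : binE (q₂ - 1) p (fun N => (2050 * Real.exp (L - 2 ^ 14 * L)) * (Real.exp 1) ^ N) ≤
      1 / n := by
    rw [binE_mul_left, binE_pow]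
    have h1 : (1 - p + p * Real.exp 1) ^ (q₂ - 1) ≤ Real.exp (2 * 4096 * L) := by
      have he := Real.exp_one_lt_d9
      have he1 : 1 ≤ Real.exp 1 := Real.one_le_exp zero_le_one
      calc (1 - p + p * Real.exp 1) ^ (q₂ - 1) ≤ (Real.exp (2 * p)) ^ (q₂ - 1) := by
            have := Real.add_one_le_exp (2 * p)
            gcongr
            nlinarith
        _ ≤ (Real.exp (2 * p)) ^ q₂ :=
            pow_le_pow_right₀ (Real.one_le_exp (by linarith)) (by omega)
        _ = Real.exp (q₂ * (2 * p)) := (Real.exp_nat_mul _ _).symm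
        _ ≤ _ := Real.exp_le_exp.mpr (by linarith)
    calc _ ≤ (2050 * Real.exp (L - 2 ^ 14 * L)) * Real.exp (2 * 4096 * L) := by gcongr
      _ = 2050 * Real.exp (-8191 * L) := by rw [mul_assoc, ← Real.exp_add]; ring_nf
      _ ≤ 1 / n := h.exp_neg_le (by linarith)
  rw [abs_le]
  constructor
  · have := binE_mono (n := q₂ - 1) hp0.le hp1 fun N hN => (abs_le.mp (hb N hN)).1
    have e := binE_mul_left (q₂ - 1) p (-1) fun N => (2050 * Real.exp (L - 2 ^ 14 * L)) * (Real.exp 1) ^ N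
    simp only [neg_mul, one_mul] at e
    rw [e] at this
    exact (neg_le_neg hE).trans this
  · exact (binE_mono (n := q₂ - 1) hp0.le hp1 fun N hN => (abs_le.mp (hb N hN)).2).trans hE

/-- The probability of few occurrences in the first half. -/
noncomputable def _root_.EntropyAmplification.rareProb (L q₁ : ℕ) (p : ℝ) : ℝ :=
  binE q₁ p fun a => if a ≤ 512 * L then 1 else 0

theorem _root_.EntropyAmplification.rareProb_nonneg {L q₁ : ℕ} {p : ℝ} (hp0 : 0 ≤ p) (hp1 : p ≤ 1) :
    0 ≤ rareProb L q₁ p := binE_nonneg hp0 hp1 fun a _ => by split_ifs <;> norm_num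

theorem _root_.EntropyAmplification.rareProb_le_one {L q₁ : ℕ} {p : ℝ} (hp0 : 0 ≤ p) (hp1 : p ≤ 1) :
    rareProb L q₁ p ≤ 1 := by
  have := binE_mono (n := q₁) hp0 hp1 (f := fun a => if a ≤ 512 * L then (1 : ℝ) else 0)
    (g := fun _ => 1) fun a _ => by split_ifs <;> norm_num
  rwa [binE_const] at this

theorem one_sub_rareProb_le (h : Regime ε n q₁ q₂ L) (hp0 : 0 ≤ p) (hp1 : p ≤ 1) :
    1 - rareProb L q₁ p ≤ q₁ * p / (512 * L) := by
  have hL := h.one_le_degree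
  have h1 := binE_mono (n := q₁) hp0 hp1
    (f := fun a => 1 - if a ≤ 512 * L then (1 : ℝ) else 0)
    (g := fun a => (1 / (512 * (L : ℝ))) * (a : ℝ)) fun a _ => by
      split_ifs with ha
      · rw [sub_self]; positivity
      · rw [sub_zero, one_div_mul_eq_div, le_div_iff₀ (by positivity), one_mul]
        exact_mod_cast (not_le.mp ha).le
  rw [binE_sub, binE_const, binE_mul_left, binE_mean] at h1
  calc _ ≤ _ := h1
    _ = _ := by ring

/-- Chernoff bound: a mean of at least `4096 L` against the threshold `512 L` gives the exponent
`512 L - 0.6 * 4096 L`. -/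
theorem rareProb_le_exp (h : Regime ε n q₁ q₂ L) (hp0 : 0 ≤ p) (hp1 : p ≤ 1)
    (hp : 4096 * L ≤ p * q₂) : rareProb L q₁ p ≤ Real.exp (-1945 * L) := by
  have h1 := binE_mono (n := q₁) hp0 hp1
    (f := fun a => if a ≤ 512 * L then (1 : ℝ) else 0)
    (g := fun a => Real.exp (512 * L) * (Real.exp (-1)) ^ a) fun a _ => by
      split_ifs with ha
      · rw [← Real.exp_nat_mul, ← Real.exp_add]
        refine Real.one_le_exp ?_
        have : (a : ℝ) ≤ 512 * L := by exact_mod_cast ha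
        linarith
      · positivity
  rw [binE_mul_left, binE_pow] at h1
  refine h1.trans ?_
  have he : Real.exp (-1) ≤ 0.4 := by
    rw [Real.exp_neg]
    have := Real.exp_one_gt_d9
    rw [inv_le_comm₀ (by positivity) (by norm_num)]
    norm_num; linarith
  have he0 := Real.exp_pos (-1)
  have hle : (q₂ : ℝ) ≤ q₁ := by exact_mod_cast h.le_left
  calc _ ≤ Real.exp (512 * L) * (Real.exp (-(0.6 * p))) ^ q₁ := by
        have := Real.add_one_le_exp (-(0.6 * p))
        gcongr
        nlinarith
    _ = Real.exp (512 * L - q₁ * (0.6 * p)) := by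
        rw [← Real.exp_nat_mul, ← Real.exp_add]; ring_nf
    _ ≤ _ := Real.exp_le_exp.mpr (by nlinarith)

/-- The count `a` only selects a branch, so averaging over it mixes two means of the second half
with weights `rareProb` and its complement. When `a` is large the mean is that of the plug-in. -/
theorem _root_.EntropyAmplification.mean_hybridEst (ε : ℝ) (L q₁ q₂ : ℕ) (p : ℝ) :
    binE q₁ p (fun a => binE (q₂ - 1) p fun N => hybridEst ε L q₂ a (N + 1)) =
      rareProb L q₁ p * binE (q₂ - 1) p (fun N => hybridEst ε L q₂ 0 (N + 1)) +
      (1 - rareProb L q₁ p) * logCount q₂ p := by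
  set S := binE (q₂ - 1) p fun N => hybridEst ε L q₂ 0 (N + 1)
  have : (fun a => binE (q₂ - 1) p fun N => hybridEst ε L q₂ a (N + 1)) = fun a =>
      logCount q₂ p + (S - logCount q₂ p) * if a ≤ 512 * L then (1 : ℝ) else 0 := by
    ext a
    by_cases ha : a ≤ 512 * L
    · simp only [hybridEst, ha, S, if_true, Nat.zero_le]; ring
    · simp only [hybridEst, ha, if_false, false_and, logCount]; push_cast; ring
  rw [this, binE_add, binE_const, binE_mul_left, rareProb]
  ring

/-- The mean of the estimate of `-log p`. -/
theorem mean_hybridEst_bounds (h : Regime ε n q₁ q₂ L) (hm : 1 ≤ m)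
    (hm2 : (m : ℝ) ≤ 2 * (ε * n * Real.log n)) (hp0 : 0 < p) (hp1 : p ≤ 1) :
    binE q₁ p (fun a => binE (q₂ - 1) p fun N => hybridEst ε L q₂ a (N + 1)) ≤
      -Real.log p + 2 ^ 31 * min ε (1 / (n * p)) ∧
    logCount m p - 2 ^ 31 * min ε (1 / (n * p)) ≤
      binE q₁ p (fun a => binE (q₂ - 1) p fun N => hybridEst ε L q₂ a (N + 1)) := by
  have hL := h.one_le_degree
  have hq := h.half_pos
  have hn := h.n_pos
  rw [mean_hybridEst]
  set P := rareProb L q₁ p with hP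
  set S := binE (q₂ - 1) p (fun N => hybridEst ε L q₂ 0 (N + 1)) with hS
  have hP0 : 0 ≤ P := rareProb_nonneg hp0.le hp1
  have hP1 : P ≤ 1 := rareProb_le_one hp0.le hp1
  have hq1 : 1 ≤ q₂ := by have := h.large; have := h.degree_pos; omega
  have hU := logCount_le hq1 hp0 hp1
  have hU2 := logCount_ge hq1 hp0 hp1
  have hM := logCount_le hm hp0 hp1
  have hE := h.inv_n_le_min hp0 hp1
  set E := min ε (1 / (n * p)) with hEdef
  have hE0 : 0 < E := lt_of_lt_of_le (by positivity) hE
  have hqp : 1 / (q₂ * p) ≤ 3 * (1 / (n * p)) := by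
    rw [mul_one_div, div_le_div_iff₀ (by positivity) (by positivity)]
    nlinarith [mul_le_mul_of_nonneg_right h.n_le hp0.le]
  rcases le_total (p * q₂) (4096 * L) with hp | hp
  -- Rare symbol. The chain `logCount m p ≤ -log (p + 1/(16 m)) ≤ -log (p + s) ≤ -log p` places the
  -- polynomial mean between the required bounds; `p ≤ 1/2` holds because `8192 L ≤ q₂`.
  · have h1 := abs_le.mp (h.truncation_le hp0 hp1 hp)
    have h2 := abs_le.mp (h.mean_logEst hp0 hp)
    rw [← hS] at h1
    have hp2 : p ≤ 1 / 2 := by nlinarith [h.large']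
    have h3 := h.shift_le hm hm2
    set s := (1 - radius ε L) ^ 2 / (radius ε L * invWidth L q₂) with hs
    have hs0 : 0 ≤ s := by
      have := h.half_le_radius
      have := h.width_ge
      positivity
    have h4 : Real.log p ≤ Real.log (p + s) := Real.log_le_log hp0 (by linarith)
    have h5 : Real.log (p + s) ≤ Real.log (p + 1 / (16 * m)) :=
      Real.log_le_log (by linarith) (by linarith)
    have h6 := logCount_le_of_le_half hm hp0 hp2
    have hS1 : S ≤ -Real.log p + (2 ^ 30 + 1) * E := by linarith [h1.2, h2.2]
    have hS2 : logCount m p - (2 ^ 30 + 1) * E ≤ S := by linarith [h1.1, h2.1]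
    -- The plug-in branch may err by `1/(q₂ p)`, which can exceed `ε`, but it is taken with
    -- probability at most `q₁ p / (512 L)`. The product is `O(1/L)`, hence `O(ε)`.
    have h7 : (1 - P) * (1 / (q₂ * p)) ≤ 2 ^ 20 * E := by
      rw [hEdef, mul_min_of_nonneg _ _ (by norm_num)]
      refine le_min ?_ ?_
      · have h8 := h.one_sub_rareProb_le hp0.le hp1
        calc (1 - P) * (1 / (q₂ * p)) ≤ (q₁ * p / (512 * L)) * (1 / (q₂ * p)) := by gcongr
          _ = (q₁ / q₂) * (1 / L) / 512 := by field_simp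
          _ ≤ 2 * (1024 * ε) / 512 := by
            have : (q₁ : ℝ) / q₂ ≤ 2 := by rw [div_le_iff₀ hq]; exact h.left_le'
            have := h.inv_degree_le
            gcongr
          _ ≤ _ := by linarith [h.eps_pos]
      · have : 0 ≤ 1 / (n * p) := by positivity
        have : 0 ≤ 1 / (q₂ * p) := by positivity
        nlinarith
    constructor
    · have : P * S ≤ P * (-Real.log p + (2 ^ 30 + 1) * E) := by gcongr
      have : (1 - P) * logCount q₂ p ≤ (1 - P) * -Real.log p := by gcongr
      nlinarith
    · have h8 : P * (logCount m p - (2 ^ 30 + 1) * E) ≤ P * S := by gcongr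
      have h9 : (1 - P) * (-Real.log p - 1 / (q₂ * p)) ≤ (1 - P) * logCount q₂ p := by gcongr
      have h10 : (1 - P) * logCount m p ≤ (1 - P) * -Real.log p := by gcongr
      nlinarith
  -- Frequent symbol. A wrongly selected polynomial costs at most `exp (9 L)` up to a constant, but
  -- is selected with probability at most `exp (-1945 L)`; the product is below `1/n`.
  · have hS3 : |S - logCount q₂ p| ≤ 2050 * Real.exp (9 * L) := by
      rw [hS, logCount, ← binE_sub]
      have hb : ∀ N ≤ q₂ - 1, |hybridEst ε L q₂ 0 (N + 1) - -Real.log (((N : ℝ) + 1) / q₂)| ≤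
          2050 * Real.exp (9 * L) := by
        intro N hN
        have e1 : (L : ℝ) * Real.exp (8 * L) ≤ Real.exp (9 * L) := by
          have : Real.exp (9 * L) = Real.exp L * Real.exp (8 * L) := by
            rw [← Real.exp_add]; ring_nf
          rw [this]
          have := Real.add_one_le_exp (L : ℝ)
          gcongr
          linarith
        have e2 := Real.one_le_exp (show (0 : ℝ) ≤ 8 * L by positivity)
        have e3 := h.abs_log_div_le hN
        push_cast at e3
        rw [hybridEst]
        split_ifs with hc
        · simp only [Nat.add_sub_cancel]
          refine (abs_sub _ _).trans ?_
          have := h.abs_logEst_le_of_le hN (by omega)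
          nlinarith
        · push_cast; rw [sub_self, abs_zero]; positivity
      rw [abs_le]
      constructor
      · have := binE_mono (n := q₂ - 1) hp0.le hp1 fun N hN => (abs_le.mp (hb N hN)).1
        rwa [binE_const] at this
      · have := binE_mono (n := q₂ - 1) hp0.le hp1 fun N hN => (abs_le.mp (hb N hN)).2
        rwa [binE_const] at this
    have hPS : |P * (S - logCount q₂ p)| ≤ E := by
      rw [abs_mul, abs_of_nonneg hP0]
      calc P * |S - logCount q₂ p| ≤ Real.exp (-1945 * L) * (2050 * Real.exp (9 * L)) := by
            have := h.rareProb_le_exp hp0.le hp1 hp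
            gcongr
        _ = 2050 * Real.exp (-1936 * L) := by
            rw [mul_left_comm, ← Real.exp_add]; ring_nf
        _ ≤ 1 / n := h.exp_neg_le le_rfl
        _ ≤ E := hE
    have hPS' := abs_le.mp hPS
    have h7 : 1 / (q₂ * p) ≤ 3 * E := by
      rw [hEdef, mul_min_of_nonneg _ _ (by norm_num)]
      refine le_min ?_ hqp
      calc 1 / (q₂ * p) ≤ 1 / (4096 * L) := one_div_le_one_div_of_le (by positivity) (by linarith)
        _ = (1 / L) / 4096 := by field_simp
        _ ≤ _ := by linarith [h.inv_degree_le, h.eps_pos]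
    have e : P * S + (1 - P) * logCount q₂ p = logCount q₂ p + P * (S - logCount q₂ p) := by ring
    rw [e]
    constructor <;> linarith

end Regime

end EntropyAmplification

namespace EntropyAmplification

/-! ### The amplified estimator -/

/-- The contribution to the estimate of a symbol that occurs `a` times in the first half of the
sample and `c` times in the second half. -/
noncomputable def hybridTerm (ε : ℝ) (L q₂ a c : ℕ) : ℝ := (c : ℝ) / q₂ * hybridEst ε L q₂ a c

/-- The entropy estimate from a sample with halves of sizes `q₁` and `q₂`. -/
noncomputable def hybridEntropy {k q₁ q₂ : ℕ} (ε : ℝ) (L : ℕ) (x : Fin (q₁ + q₂) → Fin k) : ℝ :=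
  ∑ i, hybridTerm ε L q₂ (symbolCount (fun j => x (Fin.castAdd q₂ j)) i)
    (symbolCount (fun j => x (Fin.natAdd q₁ j)) i)

/-- For fixed first half, size biasing in the second half turns the weight `c / q₂` into the factor
`p i` and shifts the count by one; then the first half is averaged. -/
theorem expect_hybridEntropy {k q₁ q₂ : ℕ} (hq : 1 ≤ q₂) (ε : ℝ) (L : ℕ) {p : Fin k → ℝ}
    (hp : ∑ i, p i = 1) :
    expect (q₁ + q₂) p (hybridEntropy ε L) =
      ∑ i, p i * binE q₁ (p i) fun a => binE (q₂ - 1) (p i) fun N => hybridEst ε L q₂ a (N + 1) := by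
  unfold hybridEntropy
  rw [expect_sum]
  refine Finset.sum_congr rfl fun i _ => ?_
  rw [expect_append]
  simp only [Fin.append_left, Fin.append_right]
  have h1 : ∀ a : ℕ, expect q₂ p (fun v => hybridTerm ε L q₂ a (symbolCount v i)) =
      p i * binE (q₂ - 1) (p i) fun N => hybridEst ε L q₂ a (N + 1) := by
    intro a
    rw [expect_symbolCount hp i fun c => hybridTerm ε L q₂ a c]
    obtain ⟨q, rfl⟩ : ∃ q, q₂ = q + 1 := ⟨q₂ - 1, by omega⟩
    have : (fun c => hybridTerm ε L (q + 1) a c) =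
        fun c => ((q : ℝ) + 1)⁻¹ * (c * hybridEst ε L (q + 1) a c) := by
      ext c; rw [hybridTerm]; push_cast; ring
    rw [this, binE_mul_left, binE_size_bias q (p i) fun c => hybridEst ε L (q + 1) a c]
    have : (q : ℝ) + 1 ≠ 0 := by positivity
    field_simp
    rfl
  have h2 : (fun u : Fin q₁ → Fin k => expect q₂ p fun v =>
      hybridTerm ε L q₂ (symbolCount u i) (symbolCount v i)) = fun u =>
      (fun a => p i * binE (q₂ - 1) (p i) fun N => hybridEst ε L q₂ a (N + 1)) (symbolCount u i) := by
    ext u; exact h1 _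
  rw [h2, expect_symbolCount hp i
    fun a => p i * binE (q₂ - 1) (p i) fun N => hybridEst ε L q₂ a (N + 1), binE_mul_left]

/-! ### Bounded differences -/

section
variable {k n : ℕ}

theorem symbolCount_update_of_ne (x : Fin n → Fin k) (j : Fin n) (a i : Fin k) (h1 : i ≠ x j)
    (h2 : i ≠ a) : symbolCount (Function.update x j a) i = symbolCount x i := by
  unfold symbolCount
  congr 1
  ext j'
  simp only [Finset.mem_filter, Finset.mem_univ, true_and]
  rcases eq_or_ne j' j with rfl | h
  · simp [h1.symm, h2.symm]
  · simp [Function.update_of_ne h]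

theorem symbolCount_update_le (x : Fin n → Fin k) (j : Fin n) (a i : Fin k) :
    symbolCount (Function.update x j a) i ≤ symbolCount x i + 1 := by
  unfold symbolCount
  refine (Finset.card_le_card (t := insert j (Finset.univ.filter fun j => x j = i)) ?_).trans
    (Finset.card_insert_le _ _)
  intro j' hj'
  rcases eq_or_ne j' j with rfl | h
  · exact Finset.mem_insert_self _ _
  · simp only [Finset.mem_filter, Finset.mem_univ, true_and, Function.update_of_ne h] at hj'
    simp [hj']

theorem symbolCount_le_update (x : Fin n → Fin k) (j : Fin n) (a i : Fin k) :
    symbolCount x i ≤ symbolCount (Function.update x j a) i + 1 := by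
  have := symbolCount_update_le (Function.update x j a) j (x j) i
  simpa using this

/-- Changing one sample affects the counts of at most two symbols. -/
theorem abs_sum_symbolCount_update_le {D : ℝ} (f : Fin k → ℕ → ℝ)
    (hf : ∀ i c c', c ≤ n → c' ≤ n → c ≤ c' + 1 → c' ≤ c + 1 → |f i c' - f i c| ≤ D)
    (x : Fin n → Fin k) (j : Fin n) (a : Fin k) :
    |∑ i, f i (symbolCount (Function.update x j a) i) - ∑ i, f i (symbolCount x i)| ≤ 2 * D := by
  have hD : 0 ≤ D := (abs_nonneg _).trans (hf a 0 0 (by omega) (by omega) (by omega) (by omega))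
  rw [← Finset.sum_sub_distrib]
  have : ∑ i, (f i (symbolCount (Function.update x j a) i) - f i (symbolCount x i)) =
      ∑ i ∈ {x j, a}, (f i (symbolCount (Function.update x j a) i) - f i (symbolCount x i)) := by
    refine (Finset.sum_subset (Finset.subset_univ _) fun i _ hi => ?_).symm
    simp only [Finset.mem_insert, Finset.mem_singleton, not_or] at hi
    rw [symbolCount_update_of_ne x j a i hi.1 hi.2, sub_self]
  rw [this]
  refine (Finset.abs_sum_le_sum_abs _ _).trans ((Finset.sum_le_card_nsmul _ _ D fun i _ =>
    hf i _ _ (symbolCount_le _ _) (symbolCount_le _ _) (symbolCount_le_update x j a i)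
      (symbolCount_update_le x j a i)).trans ?_)
  rw [nsmul_eq_mul]
  have : ((({x j, a} : Finset (Fin k)).card : ℕ) : ℝ) ≤ 2 := by exact_mod_cast Finset.card_le_two
  gcongr

end

/-- After multiplication by `q` the difference is `log q - log (c+1)`, which lies in `[0, log q]`,
minus `c (log (c+1) - log c)`, which lies in `[0, 1]`. -/
theorem abs_negMulLog_succ_sub_le {q : ℕ} {c : ℕ} (hc : c + 1 ≤ q) :
    |Real.negMulLog (((c + 1 : ℕ) : ℝ) / q) - Real.negMulLog ((c : ℝ) / q)| ≤
      (1 + Real.log q) / q := by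
  have hq : (0 : ℝ) < q := by exact_mod_cast (by omega)
  have hcq : ((c + 1 : ℕ) : ℝ) ≤ q := by exact_mod_cast hc
  have h1 : 0 ≤ Real.log ((c + 1 : ℕ) : ℝ) := Real.log_nonneg (by push_cast; linarith [Nat.cast_nonneg (α := ℝ) c])
  have h2 : Real.log ((c + 1 : ℕ) : ℝ) ≤ Real.log q := Real.log_le_log (by positivity) hcq
  have e : Real.negMulLog (((c + 1 : ℕ) : ℝ) / q) - Real.negMulLog ((c : ℝ) / q) =
      ((Real.log q - Real.log ((c + 1 : ℕ) : ℝ)) -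
        c * (Real.log ((c + 1 : ℕ) : ℝ) - Real.log c)) / q := by
    rcases Nat.eq_zero_or_pos c with rfl | hc0
    · simp [Real.negMulLog]; field_simp
    · have hc0 : (0 : ℝ) < c := by exact_mod_cast hc0
      rw [Real.negMulLog, Real.negMulLog, Real.log_div (by positivity) hq.ne',
        Real.log_div hc0.ne' hq.ne']
      push_cast; field_simp; ring
  have h3 : 0 ≤ c * (Real.log ((c + 1 : ℕ) : ℝ) - Real.log c) ∧
      c * (Real.log ((c + 1 : ℕ) : ℝ) - Real.log c) ≤ 1 := by
    rcases Nat.eq_zero_or_pos c with rfl | hc0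
    · simp
    · have hc0 : (0 : ℝ) < c := by exact_mod_cast hc0
      rw [← Real.log_div (by positivity) hc0.ne']
      have h4 := Real.log_le_sub_one_of_pos (x := ((c + 1 : ℕ) : ℝ) / c) (by positivity)
      have h5 : 0 ≤ Real.log (((c + 1 : ℕ) : ℝ) / c) := by
        refine Real.log_nonneg ?_
        rw [le_div_iff₀ hc0]; push_cast; linarith
      refine ⟨by positivity, ?_⟩
      calc _ ≤ (c : ℝ) * (((c + 1 : ℕ) : ℝ) / c - 1) := by gcongr
        _ = 1 := by push_cast; field_simp; ring
  rw [e, abs_div, abs_of_pos hq]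
  gcongr
  rw [abs_le]
  constructor <;> linarith [h3.1, h3.2]

theorem abs_negMulLog_sub_le {q : ℕ} {c c' : ℕ} (hq : 1 ≤ q) (hc : c ≤ q) (hc' : c' ≤ q)
    (h1 : c ≤ c' + 1) (h2 : c' ≤ c + 1) :
    |Real.negMulLog ((c' : ℝ) / q) - Real.negMulLog ((c : ℝ) / q)| ≤ (1 + Real.log q) / q := by
  rcases (by omega : c' = c + 1 ∨ c = c' + 1 ∨ c = c') with rfl | rfl | rfl
  · exact abs_negMulLog_succ_sub_le hc'
  · rw [abs_sub_comm]; exact abs_negMulLog_succ_sub_le hc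
  · rw [sub_self, abs_zero]
    have : 0 ≤ Real.log q := Real.log_nonneg (by exact_mod_cast hq)
    positivity

/-! ### Sensitivity, variance and total loss of the amplified estimate. -/

namespace Regime

variable {ε : ℝ} {n q₁ q₂ L m : ℕ}

/-- The range of `c` extends one beyond the cutoff, so that both counts are covered when a changed
sample crosses it. -/
theorem abs_hybridTerm_le (h : Regime ε n q₁ q₂ L) (a : ℕ) {c : ℕ} (hc : c ≤ 2 ^ 15 * L + 1)
    (hcq : c ≤ q₂) : |hybridTerm ε L q₂ a c| ≤ 2 ^ 27 * Real.exp (10 * L) / q₂ := by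
  have hL := h.one_le_degree
  have hq := h.half_pos
  rcases Nat.eq_zero_or_pos c with rfl | hc0
  · simp only [hybridTerm, Nat.cast_zero, zero_div, zero_mul, abs_zero]; positivity
  have e1 : |hybridEst ε L q₂ a c| ≤ 1026 * L * Real.exp (8 * L) := by
    rw [hybridEst]
    split_ifs with hac
    · exact h.abs_logEst_le_of_le (by omega) (by omega)
    · have e2 := h.abs_log_div_le (N := c - 1) (by omega)
      rw [Nat.sub_add_cancel hc0] at e2
      have e3 := Real.one_le_exp (show (0 : ℝ) ≤ 8 * L by positivity)
      nlinarith
  have e2 : (c : ℝ) ≤ 2 ^ 16 * L := by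
    have : c ≤ 2 ^ 16 * L := by have := h.degree_pos; omega
    exact_mod_cast this
  have e3 : (L : ℝ) ≤ Real.exp L := by linarith [Real.add_one_le_exp (L : ℝ)]
  rw [hybridTerm, abs_mul, abs_of_nonneg (by positivity)]
  calc _ ≤ (2 ^ 16 * L) / q₂ * (1026 * L * Real.exp (8 * L)) := by gcongr
    _ = 2 ^ 16 * 1026 * (L * L * Real.exp (8 * L)) / q₂ := by ring
    _ ≤ 2 ^ 27 * (Real.exp L * Real.exp L * Real.exp (8 * L)) / q₂ := by
      gcongr
      norm_num
    _ = _ := by rw [← Real.exp_add, ← Real.exp_add]; ring_nf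

/-- No relation between `a` and `a'` is needed. If either count is below the cutoff, both terms are
small individually; otherwise both are plug-in terms, which do not depend on the first half. -/
theorem abs_hybridTerm_sub_le (h : Regime ε n q₁ q₂ L) (a a' : ℕ) {c c' : ℕ} (hc : c ≤ q₂)
    (hc' : c' ≤ q₂) (h1 : c ≤ c' + 1) (h2 : c' ≤ c + 1) :
    |hybridTerm ε L q₂ a' c' - hybridTerm ε L q₂ a c| ≤ 2 ^ 28 * Real.exp (10 * L) / q₂ := by
  have hL := h.one_le_degree
  have hq := h.half_pos
  by_cases hs : c ≤ 2 ^ 15 * L ∨ c' ≤ 2 ^ 15 * L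
  · refine (abs_sub _ _).trans ?_
    have e1 := h.abs_hybridTerm_le a (c := c) (by omega) hc
    have e2 := h.abs_hybridTerm_le a' (c := c') (by omega) hc'
    calc _ ≤ _ := add_le_add e2 e1
      _ = _ := by ring
  · have e : ∀ a c, ¬ c ≤ 2 ^ 15 * L → hybridTerm ε L q₂ a c = Real.negMulLog ((c : ℝ) / q₂) := by
      intro a c hc
      rw [hybridTerm, hybridEst, if_neg fun hh => hc hh.2, Real.negMulLog]; ring
    rw [e _ _ fun hh => hs (Or.inr hh), e _ _ fun hh => hs (Or.inl hh)]
    refine (abs_negMulLog_sub_le (by have := h.large; have := h.degree_pos; omega)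
      hc hc' h1 h2).trans ?_
    gcongr
    have e1 := Real.log_le_log hq h.half_le
    have e2 := h.log_le
    have e3 := Real.add_one_le_exp (10 * (L : ℝ))
    linarith

theorem hybridEntropy_bounded_differences {k : ℕ} (h : Regime ε n q₁ q₂ L)
    (x : Fin (q₁ + q₂) → Fin k) (j : Fin (q₁ + q₂)) (a : Fin k) :
    |hybridEntropy ε L (Function.update x j a) - hybridEntropy ε L x| ≤
      2 * (2 ^ 28 * Real.exp (10 * L) / q₂) := by
  unfold hybridEntropy
  induction j using Fin.addCases with
  | left j =>
    have e1 : (fun i => Function.update x (Fin.castAdd q₂ j) a (Fin.castAdd q₂ i)) =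
        Function.update (fun i => x (Fin.castAdd q₂ i)) j a :=
      Function.update_comp_eq_of_injective x (Fin.castAdd_injective q₁ q₂) j a
    have e2 : (fun i => Function.update x (Fin.castAdd q₂ j) a (Fin.natAdd q₁ i)) =
        fun i => x (Fin.natAdd q₁ i) := by
      ext i; rw [Function.update_of_ne]
      intro hh; have := congrArg Fin.val hh; simp at this; omega
    rw [e1, e2]
    exact abs_sum_symbolCount_update_le (fun i b => hybridTerm ε L q₂ b
        (symbolCount (fun j => x (Fin.natAdd q₁ j)) i))
      (fun i b b' _ _ _ _ => h.abs_hybridTerm_sub_le b b' (symbolCount_le _ _) (symbolCount_le _ _)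
        (by omega) (by omega)) _ j a
  | right j =>
    have e1 : (fun i => Function.update x (Fin.natAdd q₁ j) a (Fin.natAdd q₁ i)) =
        Function.update (fun i => x (Fin.natAdd q₁ i)) j a :=
      Function.update_comp_eq_of_injective x (Fin.natAdd_injective q₂ q₁) j a
    have e2 : (fun i => Function.update x (Fin.natAdd q₁ j) a (Fin.castAdd q₂ i)) =
        fun i => x (Fin.castAdd q₂ i) := by
      ext i; rw [Function.update_of_ne]
      intro hh; have := congrArg Fin.val hh; simp at this; omega
    rw [e1, e2]
    exact abs_sum_symbolCount_update_le (fun i c => hybridTerm ε L q₂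
        (symbolCount (fun j => x (Fin.castAdd q₂ j)) i) c)
      (fun i c c' hc hc' h1 h2 => h.abs_hybridTerm_sub_le _ _ hc hc' h1 h2) _ j a

/-- The reason for the constant `1024` in the degree: `10/1024 < 0.01`. -/
theorem exp_degree_le (h : Regime ε n q₁ q₂ L) :
    Real.exp (10 * L) ≤ Real.exp 10 * (n : ℝ) ^ (0.01 : ℝ) := by
  have hn : (1 : ℝ) ≤ n := by linarith [h.half_le, h.large', h.one_le_degree]
  rw [Real.rpow_def_of_pos h.n_pos, ← Real.exp_add]
  refine Real.exp_le_exp.mpr ?_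
  have := Real.log_nonneg hn
  linarith [h.le_log]

/-- From `log n ≤ n ^ 0.49 / 0.49` and `1 ≤ ε log n`. Thus the standard deviation is also of order
`ε`, as the minimum in the error term demands. -/
theorem rpow_neg_le (h : Regime ε n q₁ q₂ L) : 1 / (n : ℝ) ^ (0.49 : ℝ) ≤ 3 * ε := by
  have hn := h.n_pos
  have h1 := Real.log_le_rpow_div hn.le (show (0 : ℝ) < 0.49 by norm_num)
  have h2 : 0 < (n : ℝ) ^ (0.49 : ℝ) := by positivity
  rw [div_le_iff₀ h2]
  rw [le_div_iff₀ (by norm_num)] at h1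
  nlinarith [h.one_le, h.eps_pos]

theorem rpow_neg_le_min (h : Regime ε n q₁ q₂ L) (S : ℕ) :
    1 / (n : ℝ) ^ (0.49 : ℝ) ≤ 3 * min ε ((S : ℝ) / n + 1 / (n : ℝ) ^ (0.49 : ℝ)) := by
  rw [mul_min_of_nonneg _ _ (by norm_num)]
  refine le_min h.rpow_neg_le ?_
  have : 0 ≤ 1 / (n : ℝ) ^ (0.49 : ℝ) := by positivity
  have : 0 ≤ (S : ℝ) / n := by positivity
  linarith

/-- Averaging the first alternative over `p` gives `ε`; the second contributes `1/n` for every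
symbol of the support. -/
theorem bias_sum_le {k : ℕ} (h : Regime ε n q₁ q₂ L) {p : Fin k → ℝ}
    (hp : p ∈ stdSimplex ℝ (Fin k)) :
    ∑ i, p i * min ε (1 / (n * p i)) ≤
      min ε ((supportSize p : ℝ) / n + 1 / (n : ℝ) ^ (0.49 : ℝ)) := by
  have hn := h.n_pos
  refine le_min ?_ ?_
  · calc _ ≤ ∑ i, p i * ε := Finset.sum_le_sum fun i _ =>
          mul_le_mul_of_nonneg_left (min_le_left _ _) (hp.1 i)
      _ = ε := by rw [← Finset.sum_mul, hp.2, one_mul]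
  · have h0 : 0 ≤ 1 / (n : ℝ) ^ (0.49 : ℝ) := by positivity
    have h1 : ∑ i, p i * min ε (1 / (n * p i)) ≤ ∑ i, if 0 < p i then 1 / (n : ℝ) else 0 := by
      refine Finset.sum_le_sum fun i _ => ?_
      split_ifs with hi
      · calc _ ≤ p i * (1 / (n * p i)) := mul_le_mul_of_nonneg_left (min_le_right _ _) hi.le
          _ = _ := by field_simp
      · rw [le_antisymm (not_lt.mp hi) (hp.1 i), zero_mul]
    rw [← Finset.sum_filter, Finset.sum_const, nsmul_eq_mul, mul_one_div] at h1
    have : (supportSize p : ℝ) / n = ((Finset.univ.filter fun i => 0 < p i).card : ℝ) / n := rfl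
    linarith

/-- The loss of the amplified estimator. -/
theorem loss_hybridEntropy_le {k : ℕ} (h : Regime ε n q₁ q₂ L) (hm : 1 ≤ m)
    (hm2 : (m : ℝ) ≤ 2 * (ε * n * Real.log n)) {p : Fin k → ℝ} (hp : p ∈ stdSimplex ℝ (Fin k)) :
    meanAbsError shannonEntropy (hybridEntropy ε L : (Fin (q₁ + q₂) → Fin k) → ℝ) p ≤
      meanAbsError shannonEntropy (empiricalEntropy : (Fin m → Fin k) → ℝ) p +
      (2 ^ 31 + 3 * (6 * (2 ^ 28 * Real.exp 10))) *
        min ε ((supportSize p : ℝ) / n + 1 / (n : ℝ) ^ (0.49 : ℝ)) := by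
  have hn := h.n_pos
  have hq := h.half_pos
  have hple : ∀ i, p i ≤ 1 := fun i => by
    rw [← hp.2]; exact Finset.single_le_sum (fun j _ => hp.1 j) (Finset.mem_univ i)
  set δ := min ε ((supportSize p : ℝ) / n + 1 / (n : ℝ) ^ (0.49 : ℝ)) with hδ
  -- Bounded differences of order `n ^ 0.01 / n` give a variance of order `n ^ 0.02 / n = (n ^
  -- (-0.49))²`.
  set V := 6 * (2 ^ 28 * Real.exp 10) * (1 / (n : ℝ) ^ (0.49 : ℝ)) with hV
  have hvar := variance_le_of_bounded_differences hp (n := q₁ + q₂) (hybridEntropy ε L)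
    h.hybridEntropy_bounded_differences
  have hvarV : ((q₁ + q₂ : ℕ) : ℝ) * (2 * (2 ^ 28 * Real.exp (10 * L) / q₂)) ^ 2 ≤ V ^ 2 := by
    rw [h.add_eq]
    have e1 : 2 * (2 ^ 28 * Real.exp (10 * L) / q₂) ≤
        6 * (2 ^ 28 * Real.exp 10) * ((n : ℝ) ^ (0.01 : ℝ) / n) := by
      calc 2 * (2 ^ 28 * Real.exp (10 * L) / q₂) ≤
            2 * (2 ^ 28 * (Real.exp 10 * (n : ℝ) ^ (0.01 : ℝ)) / (n / 3)) := by
            have := h.exp_degree_le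
            have := h.n_le
            gcongr
            linarith
        _ = _ := by field_simp; norm_num
    calc (n : ℝ) * (2 * (2 ^ 28 * Real.exp (10 * L) / q₂)) ^ 2 ≤
          n * (6 * (2 ^ 28 * Real.exp 10) * ((n : ℝ) ^ (0.01 : ℝ) / n)) ^ 2 := by gcongr
      _ = (6 * (2 ^ 28 * Real.exp 10)) ^ 2 * (((n : ℝ) ^ (0.01 : ℝ)) ^ 2 / n) := by
          field_simp
      _ = V ^ 2 := by
          rw [hV, mul_pow _ (1 / (n : ℝ) ^ (0.49 : ℝ))]
          congr 1
          rw [div_pow, one_pow, ← Real.rpow_natCast, ← Real.rpow_mul hn.le, ← Real.rpow_natCast,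
            ← Real.rpow_mul hn.le, div_eq_div_iff hn.ne' (by positivity), ← Real.rpow_add hn]
          norm_num
  have hloss := expect_abs_sub_le hp (by positivity) (hybridEntropy ε L) (shannonEntropy p)
    (hvar.trans hvarV)
  rw [meanAbsError_eq_expect]
  refine hloss.trans ?_
  have hbias := bias_le_meanAbsError (m := m) hp
  have hq1 : 1 ≤ q₂ := by have := h.large; have := h.degree_pos; omega
  have hmean := expect_hybridEntropy (q₁ := q₁) hq1 ε L hp.2
  have hmeanE := expect_empiricalEntropy hm hp.2
  have hsum := h.bias_sum_le hp
  have hH : shannonEntropy p = ∑ i, p i * -Real.log (p i) :=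
    Finset.sum_congr rfl fun i _ => by rw [Real.negMulLog]; ring
  have hpw : ∀ i, 0 < p i ∨ p i = 0 := fun i => (hp.1 i).lt_or_eq.imp_right Eq.symm
  have hup : expect (q₁ + q₂) p (hybridEntropy ε L) ≤ shannonEntropy p + 2 ^ 31 * δ := by
    rw [hmean, hH]
    calc _ ≤ ∑ i, (p i * -Real.log (p i) + 2 ^ 31 * (p i * min ε (1 / (n * p i)))) :=
          Finset.sum_le_sum fun i _ => by
            rcases hpw i with hi | hi
            · have := mul_le_mul_of_nonneg_left (h.mean_hybridEst_bounds hm hm2 hi (hple i)).1 hi.le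
              linarith
            · simp [hi]
      _ ≤ _ := by
        rw [Finset.sum_add_distrib, ← Finset.mul_sum]
        gcongr
  have hlow : expect m p empiricalEntropy - 2 ^ 31 * δ ≤
      expect (q₁ + q₂) p (hybridEntropy ε L) := by
    rw [hmean, hmeanE]
    calc _ ≤ ∑ i, (p i * logCount m (p i) - 2 ^ 31 * (p i * min ε (1 / (n * p i)))) := by
          rw [Finset.sum_sub_distrib, ← Finset.mul_sum]
          gcongr
      _ ≤ _ := Finset.sum_le_sum fun i _ => by
            rcases hpw i with hi | hi
            · have := mul_le_mul_of_nonneg_left (h.mean_hybridEst_bounds hm hm2 hi (hple i)).2 hi.le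
              linarith
            · simp [hi]
  have hEle : expect m p empiricalEntropy ≤ shannonEntropy p := by
    rw [hmeanE, hH]
    refine Finset.sum_le_sum fun i _ => ?_
    rcases hpw i with hi | hi
    · exact mul_le_mul_of_nonneg_left (logCount_le hm hi (hple i)) hi.le
    · simp [hi]
  have hVle : V ≤ 3 * (6 * (2 ^ 28 * Real.exp 10)) * δ := by
    have := h.rpow_neg_le_min (supportSize p)
    calc V ≤ 6 * (2 ^ 28 * Real.exp 10) * (3 * δ) := by rw [hV]; gcongr
      _ = _ := by ring
  -- An underestimate is bounded by the bias of the plug-in from `m` samples; an overestimate is at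
  -- most `2 ^ 31 * δ`, and the plug-in bias may be added because it is nonnegative.
  have habs : |expect (q₁ + q₂) p (hybridEntropy ε L) - shannonEntropy p| ≤
      (shannonEntropy p - expect m p empiricalEntropy) + 2 ^ 31 * δ := by
    rw [abs_le]; constructor <;> linarith
  linarith

end Regime

end EntropyAmplification

namespace RealRAM

/-! ### Reasoning about programs -/

/-- Started in `σ`, the program `P` halts after at most `T` steps in a state that satisfies `Q`. -/
def Halts (P : Prog) (σ : State) (T : ℕ) (Q : State → Prop) : Prop :=
  ∃ t τ, Exec P σ t τ ∧ t ≤ T ∧ Q τ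

theorem Halts.mono {P : Prog} {σ : State} {T T' : ℕ} {Q Q' : State → Prop} (h : Halts P σ T Q)
    (hT : T ≤ T') (hQ : ∀ τ, Q τ → Q' τ) : Halts P σ T' Q' := by
  obtain ⟨t, τ, he, ht, hq⟩ := h
  exact ⟨t, τ, he, ht.trans hT, hQ τ hq⟩

theorem halts_skip {σ : State} {Q : State → Prop} (h : Q σ) : Halts .skip σ 1 Q :=
  ⟨1, σ, .skip σ, le_rfl, h⟩

theorem halts_instr {i : Instr} {σ : State} {Q : State → Prop} (h : Q (i.apply σ)) :
    Halts (.instr i) σ 1 Q :=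
  ⟨1, _, .instr i σ, le_rfl, h⟩

theorem halts_seq {P P' : Prog} {σ : State} {T T' : ℕ} {Q : State → Prop}
    (h : Halts P σ T fun τ => Halts P' τ T' Q) : Halts (.seq P P') σ (T + T') Q := by
  obtain ⟨t, τ, he, ht, t', τ', he', ht', hq⟩ := h
  exact ⟨t + t', τ', .seq he he', add_le_add ht ht', hq⟩

theorem halts_branch {b : Test} {P P' : Prog} {σ : State} {T : ℕ} {Q : State → Prop}
    (h1 : b.Holds σ → Halts P σ T Q) (h2 : ¬ b.Holds σ → Halts P' σ T Q) :
    Halts (.branch b P P') σ (T + 1) Q := by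
  by_cases hb : b.Holds σ
  · obtain ⟨t, τ, he, ht, hq⟩ := h1 hb
    exact ⟨t + 1, τ, .branch_true hb he, by omega, hq⟩
  · obtain ⟨t, τ, he, ht, hq⟩ := h2 hb
    exact ⟨t + 1, τ, .branch_false hb he, by omega, hq⟩

/-- A loop with an invariant, a bound on the cost of its body and a known number of rounds. -/
theorem halts_loop {b : Test} {P : Prog} {I : ℕ → State → Prop} {N c : ℕ}
    (hstep : ∀ i < N, ∀ τ, I i τ → b.Holds τ ∧ Halts P τ c (I (i + 1)))
    (hend : ∀ τ, I N τ → ¬ b.Holds τ) {σ : State} (h0 : I 0 σ) :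
    Halts (.loop b P) σ (N * (c + 1) + 1) (I N) := by
  suffices ∀ d i, i + d = N → ∀ τ, I i τ → Halts (.loop b P) τ (d * (c + 1) + 1) (I N) from
    this N 0 (by omega) σ h0
  intro d
  induction d with
  | zero =>
    intro i hi τ hτ
    obtain rfl : i = N := by omega
    exact ⟨1, τ, .loop_done (hend τ hτ), by omega, hτ⟩
  | succ d ih =>
    intro i hi τ hτ
    obtain ⟨hb, t, τ', he, ht, hq⟩ := hstep i (by omega) τ hτ
    obtain ⟨t', τ'', he', ht', hq'⟩ := ih (i + 1) (by omega) τ' hq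
    refine ⟨t + t' + 1, τ'', .loop_step hb he he', ?_, hq'⟩
    rw [add_mul]; omega

/-- Straight-line code. -/
def block : List Instr → Prog
  | [] => .skip
  | i :: l => .seq (.instr i) (block l)

theorem halts_block {l : List Instr} {σ : State} {Q : State → Prop}
    (h : Q (l.foldl (fun τ i => i.apply τ) σ)) : Halts (block l) σ (l.length + 1) Q := by
  induction l generalizing σ with
  | nil => exact halts_skip h
  | cons i l ih =>
    have := halts_seq (halts_instr (i := i) (σ := σ) (ih h))
    exact this.mono (by simp only [List.length_cons]; omega) fun _ h => h

/-! ### Memory that a program does not write -/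

/-- These checks are Boolean, so for a concrete program and location they hold by `rfl`. -/
def Instr.keepsN : Instr → ℕ → Bool
  | nconst x _, v | nadd x _ _, v | nsub x _ _, v | nload x _ _, v => v != x
  | _, _ => true

def Instr.keepsR : Instr → ℕ → Bool
  | rcast r _, v | radd r _ _, v | rsub r _ _, v | rmul r _ _, v | rdiv r _ _, v | rlog r _, v
  | rexp r _, v | rload r _ _, v => v != r
  | _, _ => true

def Instr.keepsNArr : Instr → ℕ → Bool
  | nstore a _ _, v => v != a
  | _, _ => true

def Instr.keepsRArr : Instr → ℕ → Bool
  | rstore a _ _, v => v != a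
  | _, _ => true

/-- All instructions of the program satisfy `f`. -/
def Prog.all (f : Instr → Bool) : Prog → Bool
  | skip => true
  | instr i => f i
  | seq P Q => P.all f && Q.all f
  | branch _ P Q => P.all f && Q.all f
  | loop _ P => P.all f

theorem Exec.keeps {α : Type*} (g : State → α) (f : Instr → Bool)
    (hf : ∀ i σ, f i = true → g (i.apply σ) = g σ) {P : Prog} {σ τ : State} {t : ℕ}
    (h : Exec P σ t τ) (hP : P.all f = true) : g τ = g σ := by
  induction h with
  | skip => rfl
  | instr i σ => exact hf i σ hP
  | seq _ _ ih1 ih2 =>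
    simp only [Prog.all, Bool.and_eq_true] at hP
    rw [ih2 hP.2, ih1 hP.1]
  | branch_true _ _ ih => simp only [Prog.all, Bool.and_eq_true] at hP; exact ih hP.1
  | branch_false _ _ ih => simp only [Prog.all, Bool.and_eq_true] at hP; exact ih hP.2
  | loop_done => rfl
  | loop_step _ _ _ ih1 ih2 => rw [ih2 hP, ih1 hP]

/-- The states agree on all memory that `P` does not write. -/
structure Frame (P : Prog) (σ τ : State) : Prop where
  n : ∀ v, P.all (·.keepsN v) = true → τ.nvar v = σ.nvar v
  r : ∀ v, P.all (·.keepsR v) = true → τ.rvar v = σ.rvar v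
  na : ∀ v, P.all (·.keepsNArr v) = true → τ.narr v = σ.narr v
  ra : ∀ v, P.all (·.keepsRArr v) = true → τ.rarr v = σ.rarr v

theorem Frame.rfl {P : Prog} {σ : State} : Frame P σ σ :=
  ⟨fun _ _ => Eq.refl _, fun _ _ => Eq.refl _, fun _ _ => Eq.refl _, fun _ _ => Eq.refl _⟩

theorem Frame.trans {P : Prog} {σ τ ρ : State} (h : Frame P σ τ) (h' : Frame P τ ρ) :
    Frame P σ ρ :=
  ⟨fun v hv => (h'.n v hv).trans (h.n v hv), fun v hv => (h'.r v hv).trans (h.r v hv),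
    fun v hv => (h'.na v hv).trans (h.na v hv), fun v hv => (h'.ra v hv).trans (h.ra v hv)⟩

theorem Exec.frame {P : Prog} {σ τ : State} {t : ℕ} (h : Exec P σ t τ) : Frame P σ τ where
  n v hv := h.keeps (·.nvar v) (·.keepsN v) (fun i σ hi => by
    cases i <;> simp_all [Instr.keepsN, Instr.apply, State.setN, State.setR,
      Function.update_of_ne]) hv
  r v hv := h.keeps (·.rvar v) (·.keepsR v) (fun i σ hi => by
    cases i <;> simp_all [Instr.keepsR, Instr.apply, State.setN, State.setR,
      Function.update_of_ne]) hv
  na v hv := h.keeps (·.narr v) (·.keepsNArr v) (fun i σ hi => by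
    cases i <;> simp_all [Instr.keepsNArr, Instr.apply, State.setN, State.setR,
      Function.update_of_ne]) hv
  ra v hv := h.keeps (·.rarr v) (·.keepsRArr v) (fun i σ hi => by
    cases i <;> simp_all [Instr.keepsRArr, Instr.apply, State.setN, State.setR,
      Function.update_of_ne]) hv

theorem Halts.frame {P : Prog} {σ : State} {T : ℕ} {Q : State → Prop} (h : Halts P σ T Q) :
    Halts P σ T fun τ => Q τ ∧ Frame P σ τ := by
  obtain ⟨t, τ, he, ht, hq⟩ := h
  exact ⟨t, τ, he, ht, hq, he.frame⟩

/-- Memory untouched by the body is preserved automatically, so the invariant `I` need only mention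
what changes. -/
theorem halts_loop_frame {b : Test} {P : Prog} {σ : State} {I : ℕ → State → Prop} {N c : ℕ}
    (h0 : I 0 σ)
    (hstep : ∀ i < N, ∀ τ, Frame P σ τ → I i τ → b.Holds τ ∧ Halts P τ c (I (i + 1)))
    (hend : ∀ τ, Frame P σ τ → I N τ → ¬ b.Holds τ) :
    Halts (.loop b P) σ (N * (c + 1) + 1) (fun τ => I N τ ∧ Frame P σ τ) := by
  refine halts_loop (I := fun i τ => I i τ ∧ Frame P σ τ) (fun i hi τ hτ => ?_)
    (fun τ hτ => hend τ hτ.2 hτ.1) ⟨h0, Frame.rfl⟩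
  obtain ⟨hb, hP⟩ := hstep i hi τ hτ.2 hτ.1
  exact ⟨hb, hP.frame.mono le_rfl fun ρ hρ => ⟨hρ.1, hτ.2.trans hρ.2⟩⟩

end RealRAM

namespace EntropyAmplification

open RealRAM

/-! ### Building blocks of the program -/

/-- The number of occurrences of `s` among the samples with index in `[lo, hi)`. -/
def countIn (xs : ℕ → ℕ) (lo hi s : ℕ) : ℕ := ((Finset.Ico lo hi).filter fun j => xs j = s).card

theorem countIn_self (xs : ℕ → ℕ) (lo : ℕ) : countIn xs lo lo = fun _ => 0 := by
  ext s; simp [countIn]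

theorem countIn_succ (xs : ℕ → ℕ) {lo hi : ℕ} (h : lo ≤ hi) :
    countIn xs lo (hi + 1) =
      Function.update (countIn xs lo hi) (xs hi) (countIn xs lo hi (xs hi) + 1) := by
  ext s
  rw [Function.update_apply]
  simp only [countIn, Finset.card_filter, Finset.sum_Ico_succ_top h]
  split_ifs with h1 h2 h2
  · subst h1; rfl
  · exact absurd h1.symm h2
  · exact absurd h2.symm h1
  · rfl

theorem one_le_countIn (xs : ℕ → ℕ) {lo hi j : ℕ} (h1 : lo ≤ j) (h2 : j < hi) :
    1 ≤ countIn xs lo hi (xs j) :=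
  Finset.card_pos.mpr ⟨j, by simp [h1, h2]⟩

/-- Tabulates in array `a` the number of occurrences of every symbol. -/
def countProg (hi a : ℕ) : Prog :=
  .loop (.nlt 3 hi) (block [.nload 6 0 3, .nload 7 a 6, .nadd 7 7 1, .nstore a 6 7, .nadd 3 3 1])

/-- One round costs five instructions, the closing `skip` and the test. The upper limit must not sit
in a variable that the body writes. The start `lo` is arbitrary, so the second half can be counted
by continuing after the first. -/
theorem countProg_halts {σ : State} {hi a lo H : ℕ} (h1 : σ.nvar 1 = 1) (hlo : σ.nvar 3 = lo)
    (hH : σ.nvar hi = H) (hle : lo ≤ H) (hz : σ.narr a = fun _ => 0) (ha : a ≠ 0)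
    (h3 : hi ≠ 3) (h6 : hi ≠ 6) (h7 : hi ≠ 7) :
    Halts (countProg hi a) σ ((H - lo) * 7 + 1) fun τ =>
      τ.nvar 3 = H ∧ τ.narr a = countIn (σ.narr 0) lo H := by
  refine (halts_loop_frame (N := H - lo) (c := 6) (I := fun i τ =>
    τ.nvar 3 = lo + i ∧ τ.narr a = countIn (σ.narr 0) lo (lo + i)) ?_ ?_ ?_).mono le_rfl ?_
  · exact ⟨hlo, by rw [hz, add_zero, countIn_self]⟩
  · rintro i hi' τ hF ⟨e3, ea⟩
    have e1 : τ.nvar 1 = 1 := (hF.n 1 rfl).trans h1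
    have ehi : τ.nvar hi = H :=
      (hF.n hi (by simp [Prog.all, block, Instr.keepsN, h3, h6, h7])).trans hH
    have e0 : τ.narr 0 = σ.narr 0 :=
      hF.na 0 (by simp [Prog.all, block, Instr.keepsNArr, ha.symm])
    refine ⟨by simp only [Test.Holds, e3, ehi]; omega, halts_block ?_⟩
    simp [Instr.apply, State.setN, e3, e1, e0, ea, ← add_assoc,
      countIn_succ]
  · rintro τ hF ⟨e3, -⟩
    have ehi : τ.nvar hi = H :=
      (hF.n hi (by simp [Prog.all, block, Instr.keepsN, h3, h6, h7])).trans hH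
    simp only [Test.Holds, e3, ehi]; omega
  · rintro τ ⟨⟨e3, ea⟩, -⟩
    rw [Nat.add_sub_cancel' hle] at e3 ea
    exact ⟨e3, ea⟩

/-- The empirical entropy of the first `m` samples. -/
noncomputable def plugIn (xs : ℕ → ℕ) (m : ℕ) : ℝ :=
  (∑ j ∈ Finset.range m, -Real.log ((countIn xs 0 m (xs j) : ℝ) / m)) / m

/-- Adds up the log-frequencies of the first samples. -/
def plugInSumProg : Prog :=
  .loop (.nlt 3 2) (block [.nload 6 0 3, .nload 7 1 6, .rcast 9 7, .rdiv 9 9 8, .rlog 9 9,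
    .rsub 4 4 9, .nadd 3 3 1])

/-- Computes the empirical entropy of the first `min m n` samples, `m` in variable `2`. -/
def plugInProg : Prog :=
  .seq (block [.nsub 14 2 0, .nsub 2 2 14, .nconst 3 0]) <|
  .seq (countProg 2 1) <|
  .seq (block [.nconst 3 0, .rcast 8 2, .rcast 4 3]) <|
  .seq plugInSumProg (.instr (.rdiv 0 4 8))

theorem plugInProg_halts {σ : State} {n m : ℕ} (h0 : σ.nvar 0 = n) (h1 : σ.nvar 1 = 1)
    (h2 : σ.nvar 2 = m) (hz : σ.narr 1 = fun _ => 0) :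
    Halts plugInProg σ (17 * n + 20) fun τ => τ.rvar 0 = plugIn (σ.narr 0) (min m n) := by
  set m' := min m n with hm'
  have hmn : m' ≤ n := min_le_right _ _
  have key : Halts plugInProg σ (4 + ((m' - 0) * 7 + 1 + (4 + (m' * 9 + 1 + 1)))) fun τ =>
      τ.rvar 0 = plugIn (σ.narr 0) m' := by
    refine halts_seq (halts_block (l := [_, _, _]) ?_)
    -- Two truncated subtractions compute a minimum.
    have e : m - (m - n) = m' := by omega
    set σ₁ := [Instr.nsub 14 2 0, .nsub 2 2 14, .nconst 3 0].foldl (fun τ i => i.apply τ) σ with hσ₁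
    have a1 : σ₁.nvar 1 = 1 := by simp [hσ₁, Instr.apply, State.setN, h1]
    have a2 : σ₁.nvar 2 = m' := by
      simp [hσ₁, Instr.apply, State.setN, h0, h2, e]
    have a3 : σ₁.nvar 3 = 0 := by simp [hσ₁, Instr.apply, State.setN]
    have a4 : σ₁.narr = σ.narr := by simp [hσ₁, Instr.apply, State.setN]
    refine halts_seq ((countProg_halts a1 a3 a2 (Nat.zero_le _) (by rw [a4, hz]) (by norm_num)
      (by norm_num) (by norm_num) (by norm_num)).frame.mono le_rfl ?_)
    rintro σ₂ ⟨⟨-, b1⟩, hF₂⟩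
    refine halts_seq (halts_block (l := [_, _, _]) ?_)
    have c1 : σ₂.nvar 1 = 1 := (hF₂.n 1 rfl).trans a1
    have c2 : σ₂.nvar 2 = m' := (hF₂.n 2 rfl).trans a2
    have c0 : σ₂.narr 0 = σ.narr 0 := by rw [hF₂.na 0 rfl, a4]
    rw [a4] at b1
    refine halts_seq ((halts_loop_frame (N := m') (c := 8) (I := fun i τ =>
      τ.nvar 3 = i ∧ τ.rvar 4 =
        ∑ j ∈ Finset.range i, -Real.log ((countIn (σ.narr 0) 0 m' (σ.narr 0 j) : ℝ) / m'))
      ?_ ?_ ?_).mono le_rfl ?_)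
    · simp [Instr.apply, State.setN, State.setR]
    · rintro i hi τ hF ⟨e3, e4⟩
      have d1 := hF.n 1 rfl
      have d2 := hF.n 2 rfl
      have d8 := hF.r 8 rfl
      have dn0 := hF.na 0 rfl
      have dn1 := hF.na 1 rfl
      simp [Instr.apply, State.setN, State.setR, c1, c2, c0, b1]
        at d1 d2 d8 dn0 dn1
      refine ⟨by simp only [Test.Holds, e3, d2]; omega, halts_block ?_⟩
      simp [Instr.apply, State.setN, State.setR, e3, e4, d1, d8, dn0, dn1,
        Finset.sum_range_succ, sub_eq_add_neg]
      exact add_comm _ _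
    · rintro τ hF ⟨e3, -⟩
      have d2 := hF.n 2 rfl
      simp [Instr.apply, State.setN, State.setR, c2] at d2
      simp only [Test.Holds, e3, d2]; omega
    · rintro τ ⟨⟨-, e4⟩, hF⟩
      have d8 := hF.r 8 rfl
      simp [Instr.apply, State.setN, State.setR, c2] at d8
      refine halts_instr ?_
      simp [Instr.apply, State.setR, e4, d8, plugIn]
  exact key.mono (by omega) fun _ h => h

/-! ### Tabulating the polynomial estimate -/

/-- The sum over `j` in `chebEst`. -/
def chebProg : Prog :=
  .loop (.nlt 13 16) (block [.radd 25 25 26, .rmul 28 27 27, .rsub 28 28 24, .rsub 29 22 27,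
    .rmul 28 28 29, .rmul 28 13 28, .rmul 29 15 27, .radd 29 29 4, .radd 30 29 4, .rmul 29 29 30,
    .rsub 30 14 27, .rmul 29 29 30, .rdiv 28 28 29, .rmul 26 26 28, .nadd 13 13 1, .rcast 27 13])

theorem chebProg_halts {σ : State} {L M k N : ℕ} {w : ℝ} (h1 : σ.nvar 1 = 1)
    (h16 : σ.nvar 16 = L + 1) (r4 : σ.rvar 4 = 1) (r13 : σ.rvar 13 = w) (r14 : σ.rvar 14 = M)
    (r15 : σ.rvar 15 = 2) (r22 : σ.rvar 22 = N) (r24 : σ.rvar 24 = (k : ℝ) * k)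
    (n13 : σ.nvar 13 = 0) (r25 : σ.rvar 25 = 0) (r26 : σ.rvar 26 = 1) (r27 : σ.rvar 27 = 0) :
    Halts chebProg σ ((L + 1) * 18 + 1) fun τ => τ.rvar 25 = chebEst L M w k N := by
  -- Real variable `26` carries the product up to the current index, `25` the sum of the earlier
  -- products and `27` the index, so each new term costs a constant number of steps.
  refine (halts_loop_frame (N := L + 1) (c := 17) (I := fun i τ => τ.nvar 13 = i ∧ τ.rvar 27 = i ∧
    τ.rvar 25 = ∑ j ∈ Finset.range i, ∏ i ∈ Finset.range j,
      w * (((i : ℝ) ^ 2 - (k : ℝ) ^ 2) * ((N : ℝ) - i)) /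
        (((2 * i + 1) * (2 * i + 2)) * ((M : ℝ) - i)) ∧
    τ.rvar 26 = ∏ i ∈ Finset.range i,
      w * (((i : ℝ) ^ 2 - (k : ℝ) ^ 2) * ((N : ℝ) - i)) /
        (((2 * i + 1) * (2 * i + 2)) * ((M : ℝ) - i))) ?_ ?_ ?_).mono le_rfl ?_
  · simp [n13, r25, r26, r27]
  · rintro i hi τ hF ⟨e13, e27, e25, e26⟩
    have d1 := (hF.n 1 rfl).trans h1
    have d16 := (hF.n 16 rfl).trans h16
    have d4 := (hF.r 4 rfl).trans r4
    have d13 := (hF.r 13 rfl).trans r13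
    have d14 := (hF.r 14 rfl).trans r14
    have d15 := (hF.r 15 rfl).trans r15
    have d22 := (hF.r 22 rfl).trans r22
    have d24 := (hF.r 24 rfl).trans r24
    refine ⟨by simp only [Test.Holds, e13, d16]; omega, halts_block ?_⟩
    simp only [List.foldl, Instr.apply, State.setN, State.setR, Function.update_apply, e13, e27,
      e25, e26, d1, d4, d13, d14, d15, d22, d24, Finset.sum_range_succ, Finset.prod_range_succ]
    norm_num
    left
    ring
  · rintro τ hF ⟨e13, -⟩
    have d16 := (hF.n 16 rfl).trans h16
    simp only [Test.Holds, e13, d16]; omega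
  · rintro τ ⟨⟨-, -, e25, -⟩, -⟩
    exact e25

/-- The sum over `k` in `logEst`. -/
def logEstProg : Prog :=
  .loop (.nlt 11 8) <|
    .seq (block [.nadd 11 11 1, .rcast 23 11, .rmul 24 23 23, .rmul 21 21 17, .rsub 25 4 4,
      .rmul 26 4 4, .nconst 13 0, .rcast 27 13]) <|
    .seq chebProg (block [.rmul 28 15 21, .rdiv 28 28 23, .rmul 28 28 25, .radd 20 20 28])

theorem logEstProg_halts {σ : State} {L M N : ℕ} {w ρ : ℝ} (h1 : σ.nvar 1 = 1)
    (h8 : σ.nvar 8 = L) (h16 : σ.nvar 16 = L + 1) (r4 : σ.rvar 4 = 1) (r13 : σ.rvar 13 = w)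
    (r14 : σ.rvar 14 = M) (r15 : σ.rvar 15 = 2) (r17 : σ.rvar 17 = ρ) (r22 : σ.rvar 22 = N)
    (n11 : σ.nvar 11 = 0) (r20 : σ.rvar 20 = Real.log (w * ρ)) (r21 : σ.rvar 21 = 1) :
    Halts logEstProg σ (L * (18 * L + 34) + 1) fun τ => τ.rvar 20 = logEst L M w ρ N := by
  refine (halts_loop_frame (N := L) (c := 9 + ((L + 1) * 18 + 1 + 5)) (I := fun i τ =>
    τ.nvar 11 = i ∧ τ.rvar 21 = ρ ^ i ∧ τ.rvar 20 = Real.log (w * ρ) + ∑ k ∈ Finset.range i,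
      2 * ρ ^ (k + 1) / ((k + 1 : ℕ) : ℝ) * chebEst L M w (k + 1) N) ?_ ?_ ?_).mono ?_ ?_
  · simp [n11, r20, r21]
  · rintro i hi τ hF ⟨e11, e21, e20⟩
    have d1 := (hF.n 1 rfl).trans h1
    have d8 := (hF.n 8 rfl).trans h8
    have d16 := (hF.n 16 rfl).trans h16
    have d4 := (hF.r 4 rfl).trans r4
    have d13 := (hF.r 13 rfl).trans r13
    have d14 := (hF.r 14 rfl).trans r14
    have d15 := (hF.r 15 rfl).trans r15
    have d17 := (hF.r 17 rfl).trans r17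
    have d22 := (hF.r 22 rfl).trans r22
    refine ⟨by simp only [Test.Holds, e11, d8]; omega, halts_seq (halts_block (l := [_, _, _, _, _, _, _, _]) ?_)⟩
    refine halts_seq ((chebProg_halts (L := L) (M := M) (k := i + 1) (N := N) (w := w)
      ?_ ?_ ?_ ?_ ?_ ?_ ?_ ?_ ?_ ?_ ?_ ?_).frame.mono le_rfl ?_)
    iterate 12
      simp [Instr.apply, State.setN, State.setR, d1, d16, d4, d13, d14, d15,
        d22, e11]
    rintro τ' ⟨f25, hF'⟩
    refine halts_block (l := [_, _, _, _]) ?_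
    have g11 := hF'.n 11 rfl
    have g21 := hF'.r 21 rfl
    have g20 := hF'.r 20 rfl
    have g15 := hF'.r 15 rfl
    have g23 := hF'.r 23 rfl
    simp [Instr.apply, State.setN, State.setR, d1, d17, d15, e11, e21, e20]
      at g11 g21 g20 g15 g23
    simp [Instr.apply, State.setN, State.setR, f25, g11, g21, g20, g15, g23,
      Finset.sum_range_succ, pow_succ, add_assoc]
  · rintro τ hF ⟨e11, -⟩
    have d8 := (hF.n 8 rfl).trans h8
    simp only [Test.Holds, e11, d8]; omega
  · apply le_of_eq; ring
  · rintro τ ⟨⟨-, -, e20⟩, -⟩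
    exact e20

/-- Tabulates `logEst`. -/
def tableProg : Prog :=
  .loop (.nlt 12 10) <|
    .seq (block [.rmul 20 18 4, .rmul 21 4 4, .nconst 11 0, .rcast 22 12]) <|
    .seq logEstProg (block [.rstore 0 12 20, .nadd 12 12 1])

/-- Each entry costs `O(L²)`. Tabulating it once for each of the `W` counts, with `W` of order `L`,
replaces an evaluation for each sample. -/
theorem tableProg_halts {σ : State} {L M W : ℕ} {w ρ : ℝ} (h1 : σ.nvar 1 = 1)
    (h8 : σ.nvar 8 = L) (h10 : σ.nvar 10 = W) (h16 : σ.nvar 16 = L + 1) (r4 : σ.rvar 4 = 1)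
    (r13 : σ.rvar 13 = w) (r14 : σ.rvar 14 = M) (r15 : σ.rvar 15 = 2) (r17 : σ.rvar 17 = ρ)
    (r18 : σ.rvar 18 = Real.log (w * ρ)) (n12 : σ.nvar 12 = 0) :
    Halts tableProg σ (W * (L * (18 * L + 34) + 10) + 1) fun τ =>
      ∀ N < W, τ.rarr 0 N = logEst L M w ρ N := by
  refine (halts_loop_frame (N := W) (c := 5 + (L * (18 * L + 34) + 1 + 3)) (I := fun i τ =>
    τ.nvar 12 = i ∧ ∀ N < i, τ.rarr 0 N = logEst L M w ρ N) ?_ ?_ ?_).mono ?_ ?_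
  · exact ⟨n12, fun N hN => absurd hN (Nat.not_lt_zero N)⟩
  · rintro i hi τ hF ⟨e12, etab⟩
    have d1 := (hF.n 1 rfl).trans h1
    have d8 := (hF.n 8 rfl).trans h8
    have d10 := (hF.n 10 rfl).trans h10
    have d16 := (hF.n 16 rfl).trans h16
    have d4 := (hF.r 4 rfl).trans r4
    have d13 := (hF.r 13 rfl).trans r13
    have d14 := (hF.r 14 rfl).trans r14
    have d15 := (hF.r 15 rfl).trans r15
    have d17 := (hF.r 17 rfl).trans r17
    have d18 := (hF.r 18 rfl).trans r18
    refine ⟨by simp only [Test.Holds, e12, d10]; omega, halts_seq (halts_block (l := [_, _, _, _]) ?_)⟩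
    refine halts_seq ((logEstProg_halts (L := L) (M := M) (N := i) (w := w) (ρ := ρ)
      ?_ ?_ ?_ ?_ ?_ ?_ ?_ ?_ ?_ ?_ ?_ ?_).frame.mono le_rfl ?_)
    iterate 12
      simp [Instr.apply, State.setN, State.setR, d1, d8, d16, d4, d13, d14,
        d15, d17, d18, e12]
    rintro τ' ⟨f20, hF'⟩
    refine halts_block (l := [_, _]) ?_
    have g12 := hF'.n 12 rfl
    have g1 := hF'.n 1 rfl
    have gtab := hF'.ra 0 rfl
    simp [Instr.apply, State.setN, State.setR, d1, e12] at g12 g1 gtab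
    refine ⟨by simp [Instr.apply, State.setN, g12, g1], fun N hN => ?_⟩
    simp only [List.foldl, Instr.apply, State.setN, Function.update_apply, g12, gtab, if_true, f20]
    split_ifs with hNi
    · rw [hNi]
    · exact etab N (by omega)
  · rintro τ hF ⟨e12, -⟩
    have d10 := (hF.n 10 rfl).trans h10
    simp only [Test.Holds, e12, d10]; omega
  · apply le_of_eq; ring
  · rintro τ ⟨⟨-, h⟩, -⟩
    exact h

end EntropyAmplification

namespace EntropyAmplification

open RealRAM

/-! ### The program of the amplified estimator -/

/-- The amplified estimate from a sequence of `n` samples that is split at `q₁`. -/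
noncomputable def hybridSeq (ε : ℝ) (L q₁ n : ℕ) (xs : ℕ → ℕ) : ℝ :=
  (∑ j ∈ Finset.Ico q₁ n, hybridEst ε L (n - q₁) (countIn xs 0 q₁ (xs j)) (countIn xs q₁ n (xs j))) /
    ((n - q₁ : ℕ) : ℝ)

/-- Halves `n`. -/
def halveProg : Prog := .loop (.nlt 4 5) (block [.nadd 4 4 1, .nsub 5 5 1])

theorem halveProg_halts {σ : State} {n : ℕ} (h1 : σ.nvar 1 = 1) (h4 : σ.nvar 4 = 0)
    (h5 : σ.nvar 5 = n) :
    Halts halveProg σ (4 * n + 1) fun τ => τ.nvar 4 = n - n / 2 ∧ τ.nvar 5 = n / 2 := by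
  refine (halts_loop_frame (N := n - n / 2) (c := 3) (I := fun i τ =>
    τ.nvar 4 = i ∧ τ.nvar 5 = n - i) ?_ ?_ ?_).mono (by omega) ?_
  · exact ⟨h4, h5⟩
  · rintro i hi τ hF ⟨e4, e5⟩
    have d1 := (hF.n 1 rfl).trans h1
    refine ⟨by simp only [Test.Holds, e4, e5]; omega, halts_block ?_⟩
    simp [Instr.apply, State.setN, e4, e5, d1]
    omega
  · rintro τ - ⟨e4, e5⟩
    simp only [Test.Holds, e4, e5]; omega
  · rintro τ ⟨⟨e4, e5⟩, -⟩
    exact ⟨e4, by omega⟩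

/-- Computes the degree of the polynomial and the two thresholds. -/
def degreeProg : Prog :=
  .loop (.rlt 7 2) (block [.nadd 8 8 1, .nadd 9 9 17, .nadd 10 10 18, .radd 7 7 10])

/-- The machine cannot round, so the ceiling is found by counting up while `1024 i < l`. It cannot
multiply naturals either, so the thresholds grow by repeated addition. -/
theorem degreeProg_halts {σ : State} {l : ℝ} (h1 : σ.nvar 1 = 1)
    (h8 : σ.nvar 8 = 0) (h9 : σ.nvar 9 = 0) (h10 : σ.nvar 10 = 0) (h17 : σ.nvar 17 = 512)
    (h18 : σ.nvar 18 = 2 ^ 15) (r7 : σ.rvar 7 = 0) (r2 : σ.rvar 2 = l) (r10 : σ.rvar 10 = 1024) :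
    Halts degreeProg σ (6 * ⌈l / 1024⌉₊ + 1) fun τ => τ.nvar 8 = ⌈l / 1024⌉₊ ∧
      τ.nvar 9 = 512 * ⌈l / 1024⌉₊ ∧ τ.nvar 10 = 2 ^ 15 * ⌈l / 1024⌉₊ := by
  refine (halts_loop_frame (N := ⌈l / 1024⌉₊) (c := 5) (I := fun i τ =>
    τ.nvar 8 = i ∧ τ.nvar 9 = 512 * i ∧ τ.nvar 10 = 2 ^ 15 * i ∧ τ.rvar 7 = 1024 * i)
    ?_ ?_ ?_).mono (by omega) ?_
  · simp [h8, h9, h10, r7]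
  · rintro i hi τ hF ⟨e8, e9, e10, e7⟩
    have d1 := (hF.n 1 rfl).trans h1
    have d17 := (hF.n 17 rfl).trans h17
    have d18 := (hF.n 18 rfl).trans h18
    have d2 := (hF.r 2 rfl).trans r2
    have d10 := (hF.r 10 rfl).trans r10
    refine ⟨?_, halts_block ?_⟩
    · simp only [Test.Holds, e7, d2]
      have := Nat.lt_ceil.mp hi
      rw [lt_div_iff₀ (by norm_num)] at this
      linarith
    · simp [Instr.apply, State.setN, State.setR, e8, e9, e10, e7, d1, d17, d18, d10]
      refine ⟨by ring, by ring, by ring⟩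
  · rintro τ hF ⟨-, -, -, e7⟩
    have d2 := (hF.r 2 rfl).trans r2
    simp only [Test.Holds, e7, d2, not_lt]
    have := Nat.le_ceil (l / 1024)
    rw [div_le_iff₀ (by norm_num)] at this
    linarith
  · rintro τ ⟨⟨e8, e9, e10, -⟩, -⟩
    exact ⟨e8, e9, e10⟩

/-- Adds a log-frequency to the result. -/
def frequentProg : Prog := block [.rcast 28 7, .rdiv 28 28 12, .rlog 28 28, .rsub 20 20 28]

/-- Adds up the estimates. -/
def hybridSumProg : Prog :=
  .loop (.nlt 3 0) <|
    .seq (block [.nload 6 0 3, .nload 21 1 6, .nload 7 2 6]) <|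
    .seq (.branch (.nlt 9 21) frequentProg <| .branch (.nlt 10 7) frequentProg <|
      block [.nsub 14 7 1, .rload 28 0 14, .radd 20 20 28]) <|
    .instr (.nadd 3 3 1)

theorem hybridSumProg_halts {σ : State} {ε : ℝ} {L n q₁ q₂ : ℕ} (h0 : σ.nvar 0 = n)
    (h1 : σ.nvar 1 = 1) (h3 : σ.nvar 3 = q₁) (h9 : σ.nvar 9 = 512 * L)
    (h10 : σ.nvar 10 = 2 ^ 15 * L) (hq : q₁ + q₂ = n) (r12 : σ.rvar 12 = q₂)
    (r20 : σ.rvar 20 = 0) (a1 : σ.narr 1 = countIn (σ.narr 0) 0 q₁)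
    (a2 : σ.narr 2 = countIn (σ.narr 0) q₁ n)
    (htab : ∀ N < 2 ^ 15 * L, σ.rarr 0 N = logEst L (q₂ - 1) (invWidth L q₂) (radius ε L) N) :
    Halts hybridSumProg σ (13 * n + 1) fun τ => τ.rvar 20 =
      ∑ j ∈ Finset.Ico q₁ n, hybridEst ε L q₂ (countIn (σ.narr 0) 0 q₁ (σ.narr 0 j))
        (countIn (σ.narr 0) q₁ n (σ.narr 0 j)) := by
  set xs := σ.narr 0 with hxs
  refine (halts_loop_frame (N := q₂) (c := 4 + (7 + 1)) (I := fun i τ => τ.nvar 3 = q₁ + i ∧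
    τ.rvar 20 = ∑ j ∈ Finset.Ico q₁ (q₁ + i), hybridEst ε L q₂ (countIn xs 0 q₁ (xs j))
        (countIn xs q₁ n (xs j))) ?_ ?_ ?_).mono (by omega) ?_
  · simp [h3, r20]
  · rintro i hi τ hF ⟨e3, e20⟩
    have d0 := (hF.n 0 rfl).trans h0
    have d1 := (hF.n 1 rfl).trans h1
    have d9 := (hF.n 9 rfl).trans h9
    have d10 := (hF.n 10 rfl).trans h10
    have d12 := (hF.r 12 rfl).trans r12
    have da0 := (hF.na 0 rfl).trans hxs.symm
    have da1 := (hF.na 1 rfl).trans a1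
    have da2 := (hF.na 2 rfl).trans a2
    have dtab := hF.ra 0 rfl
    refine ⟨by simp only [Test.Holds, e3, d0]; omega,
      halts_seq (halts_block (l := [_, _, _]) ?_)⟩
    set τ₁ := [Instr.nload 6 0 3, .nload 21 1 6, .nload 7 2 6].foldl (fun τ i => i.apply τ) τ with hτ₁
    set a := countIn xs 0 q₁ (xs (q₁ + i)) with ha
    set c := countIn xs q₁ n (xs (q₁ + i)) with hc
    -- The sample being processed lies in the second half itself, so `c - 1` is a genuine
    -- predecessor and, for `c` up to the cutoff, a valid index of the table.
    have hc1 : 1 ≤ c := one_le_countIn xs (by omega) (by omega)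
    have f1 : τ₁.nvar 1 = 1 := by simp [hτ₁, Instr.apply, State.setN, d1]
    have f3 : τ₁.nvar 3 = q₁ + i := by simp [hτ₁, Instr.apply, State.setN, e3]
    have f21 : τ₁.nvar 21 = a := by simp [hτ₁, Instr.apply, State.setN, e3, da0, da1, ha]
    have f7 : τ₁.nvar 7 = c := by simp [hτ₁, Instr.apply, State.setN, e3, da0, da2, hc]
    have f9 : τ₁.nvar 9 = 512 * L := by simp [hτ₁, Instr.apply, State.setN, d9]
    have f10 : τ₁.nvar 10 = 2 ^ 15 * L := by simp [hτ₁, Instr.apply, State.setN, d10]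
    have f12 : τ₁.rvar 12 = q₂ := by simp [hτ₁, Instr.apply, State.setN, d12]
    have f20 : τ₁.rvar 20 = _ := (by simp [hτ₁, Instr.apply, State.setN] :
      τ₁.rvar 20 = τ.rvar 20).trans e20
    have ftab : τ₁.rarr 0 = σ.rarr 0 := by simp [hτ₁, Instr.apply, State.setN, dtab]
    set s := ∑ j ∈ Finset.Ico q₁ (q₁ + i), hybridEst ε L q₂ (countIn xs 0 q₁ (xs j))
        (countIn xs q₁ n (xs j)) with hs
    have hfreq : ¬ (a ≤ 512 * L ∧ c ≤ 2 ^ 15 * L) →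
        Halts frequentProg τ₁ 5 fun ρ => ρ.rvar 20 = s + hybridEst ε L q₂ a c := by
      intro hac
      refine halts_block (l := [_, _, _, _]) ?_
      have hv : hybridEst ε L q₂ a c = -Real.log ((c : ℝ) / q₂) := if_neg hac
      simp [Instr.apply, State.setR, f7, f12, f20, hv, sub_eq_add_neg]
    have hsum : Halts (.branch (.nlt 9 21) frequentProg <| .branch (.nlt 10 7) frequentProg <|
        block [.nsub 14 7 1, .rload 28 0 14, .radd 20 20 28]) τ₁ 7 fun ρ =>
        ρ.rvar 20 = s + hybridEst ε L q₂ a c := by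
      refine halts_branch (T := 6) (fun hb => ?_) fun hb => ?_
      · simp only [Test.Holds, f9, f21] at hb
        exact (hfreq fun h => by omega).mono (by omega) fun _ h => h
      simp only [Test.Holds, f9, f21] at hb
      refine halts_branch (T := 5) (fun hb' => ?_) fun hb' => ?_
      · simp only [Test.Holds, f10, f7] at hb'
        exact hfreq fun h => by omega
      simp only [Test.Holds, f10, f7] at hb'
      refine (halts_block (l := [_, _, _]) ?_).mono (by simp) fun _ h => h
      have hac : a ≤ 512 * L ∧ c ≤ 2 ^ 15 * L := by omega
      have hv : hybridEst ε L q₂ a c =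
          logEst L (q₂ - 1) (invWidth L q₂) (radius ε L) (c - 1) := if_pos hac
      simp [Instr.apply, State.setN, State.setR, f7, f1, f20, ftab, hv,
        htab (c - 1) (by omega)]
    refine halts_seq (hsum.frame.mono le_rfl ?_)
    rintro τ₂ ⟨g20, hF₂⟩
    have g1 := (hF₂.n 1 rfl).trans f1
    have g3 := (hF₂.n 3 rfl).trans f3
    refine halts_instr ⟨by simp [Instr.apply, State.setN, g3, g1, add_assoc], ?_⟩
    rw [← add_assoc, Finset.sum_Ico_succ_top (by omega)]
    simp only [Instr.apply, State.setN, g20, hs, ha, hc]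
  · rintro τ hF ⟨e3, -⟩
    have d0 := (hF.n 0 rfl).trans h0
    simp only [Test.Holds, e3, d0]; omega
  · rintro τ ⟨⟨-, e20⟩, -⟩
    rw [hq] at e20
    exact e20

/-- Sets up the real parameters. -/
def paramProg : Prog :=
  block [.rcast 11 8, .rcast 12 5, .rmul 13 10 11, .rdiv 13 12 13, .nsub 14 5 1, .rcast 14 14,
    .rcast 4 1, .radd 15 4 4, .rlog 16 0, .rdiv 16 16 15, .rexp 16 16, .nconst 14 16384,
    .rcast 17 14, .rmul 17 17 16, .rmul 17 17 11, .rdiv 17 4 17, .rsub 17 4 17, .rmul 18 13 17,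
    .rlog 18 18, .nadd 16 8 1, .nconst 12 0]

theorem paramProg_halts {σ : State} {ε : ℝ} {L q₂ : ℕ} (hε : 0 < ε) (h1 : σ.nvar 1 = 1)
    (h5 : σ.nvar 5 = q₂) (h8 : σ.nvar 8 = L) (r0 : σ.rvar 0 = ε) (r10 : σ.rvar 10 = 1024) :
    Halts paramProg σ 22 fun τ => τ.nvar 16 = L + 1 ∧ τ.nvar 12 = 0 ∧ τ.rvar 4 = 1 ∧
      τ.rvar 12 = q₂ ∧ τ.rvar 13 = invWidth L q₂ ∧ τ.rvar 14 = ((q₂ - 1 : ℕ) : ℝ) ∧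
      τ.rvar 15 = 2 ∧ τ.rvar 17 = radius ε L ∧
      τ.rvar 18 = Real.log (invWidth L q₂ * radius ε L) := by
  -- The square root is obtained from `log` and `exp`, which requires `ε > 0`.
  have hs : Real.exp (Real.log ε / 2) = √ε := by
    rw [Real.sqrt_eq_rpow, Real.rpow_def_of_pos hε]; ring_nf
  refine halts_block ?_
  simp only [List.foldl, Instr.apply, State.setN, State.setR, Function.update_apply, h1, h5, h8,
    r0, r10]
  norm_num [hs, invWidth, radius]

/-- Computes the amplified estimate. -/
def hybridProg : Prog :=
  .seq (block [.nconst 3 0, .nconst 4 0, .nadd 5 0 4]) <|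
  .seq halveProg <|
  .seq (countProg 4 1) <|
  .seq (countProg 0 2) <|
  .seq (block [.nconst 17 512, .nconst 18 32768, .nconst 19 1024, .rcast 10 19, .nconst 8 0,
    .nconst 9 0, .nconst 10 0, .rcast 7 8]) <|
  .seq degreeProg <|
  .seq paramProg <|
  .seq tableProg <|
  .seq (block [.nconst 20 0, .nadd 3 4 20, .rsub 20 4 4]) <|
  .seq hybridSumProg (.instr (.rdiv 0 20 12))

theorem hybridProg_halts {σ : State} {ε : ℝ} {n L : ℕ} (hε : 0 < ε) (h0 : σ.nvar 0 = n)
    (h1 : σ.nvar 1 = 1) (r0 : σ.rvar 0 = ε) (r2 : σ.rvar 2 = Real.log n)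
    (hz1 : σ.narr 1 = fun _ => 0) (hz2 : σ.narr 2 = fun _ => 0) (hL : L = ⌈Real.log n / 1024⌉₊) :
    Halts hybridProg σ (50 * n + 100 + 6 * L + 2 ^ 15 * L * (L * (18 * L + 34) + 10)) fun τ =>
      τ.rvar 0 = hybridSeq ε L (n - n / 2) n (σ.narr 0) := by
  set q₁ := n - n / 2 with hq₁
  have key : Halts hybridProg σ (4 + (4 * n + 1 + ((q₁ - 0) * 7 + 1 + ((n - q₁) * 7 + 1 +
      (9 + (6 * L + 1 + (22 + (2 ^ 15 * L * (L * (18 * L + 34) + 10) + 1 +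
      (4 + (13 * n + 1 + 1)))))))))) fun τ =>
      τ.rvar 0 = hybridSeq ε L q₁ n (σ.narr 0) := by
    refine halts_seq ((halts_block (l := [_, _, _])
      (Q := fun τ => τ.nvar 3 = 0 ∧ τ.nvar 4 = 0 ∧ τ.nvar 5 = n) ?_).frame.mono le_rfl ?_)
    · simp [Instr.apply, State.setN, h0]
    rintro σ₁ ⟨⟨a3, a4, a5⟩, F₁⟩
    have n1 := (F₁.n 1 rfl).trans h1
    refine halts_seq ((halveProg_halts n1 a4 a5).frame.mono le_rfl ?_)
    rintro σ₂ ⟨⟨b4, b5⟩, F₂⟩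
    have A₂ : ∀ a, σ₂.narr a = σ.narr a := fun a => (F₂.na a rfl).trans (F₁.na a rfl)
    refine halts_seq ((countProg_halts (lo := 0) (H := q₁) (hi := 4) (a := 1)
      ((F₂.n 1 rfl).trans n1) ((F₂.n 3 rfl).trans a3) b4 (Nat.zero_le _) ((A₂ 1).trans hz1)
      (by norm_num) (by norm_num) (by norm_num) (by norm_num)).frame.mono le_rfl ?_)
    rintro σ₃ ⟨⟨c3, ca⟩, F₃⟩
    rw [A₂ 0] at ca
    have A₃ : σ₃.narr 0 = σ.narr 0 := (F₃.na 0 rfl).trans (A₂ 0)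
    -- Natural variable `3` still holds `q₁` from the first count, so this run covers exactly the
    -- second half.
    refine halts_seq ((countProg_halts (lo := q₁) (H := n) (hi := 0) (a := 2)
      ((F₃.n 1 rfl).trans ((F₂.n 1 rfl).trans n1)) c3
      ((F₃.n 0 rfl).trans ((F₂.n 0 rfl).trans ((F₁.n 0 rfl).trans h0))) (by omega)
      ((F₃.na 2 rfl).trans ((A₂ 2).trans hz2))
      (by norm_num) (by norm_num) (by norm_num) (by norm_num)).frame.mono le_rfl ?_)
    rintro σ₄ ⟨⟨-, da⟩, F₄⟩
    rw [A₃] at da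
    have A₄ : σ₄.narr 0 = σ.narr 0 := (F₄.na 0 rfl).trans A₃
    have A₄1 : σ₄.narr 1 = countIn (σ.narr 0) 0 q₁ := (F₄.na 1 rfl).trans ca
    have n₄1 : σ₄.nvar 1 = 1 :=
      (F₄.n 1 rfl).trans ((F₃.n 1 rfl).trans ((F₂.n 1 rfl).trans n1))
    have n₄0 : σ₄.nvar 0 = n := (F₄.n 0 rfl).trans
      ((F₃.n 0 rfl).trans ((F₂.n 0 rfl).trans ((F₁.n 0 rfl).trans h0)))
    have n₄4 : σ₄.nvar 4 = q₁ := (F₄.n 4 rfl).trans ((F₃.n 4 rfl).trans b4)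
    have n₄5 : σ₄.nvar 5 = n / 2 := (F₄.n 5 rfl).trans ((F₃.n 5 rfl).trans b5)
    have r₄ : ∀ v, σ₄.rvar v = σ.rvar v := fun v =>
      (F₄.r v rfl).trans ((F₃.r v rfl).trans ((F₂.r v rfl).trans (F₁.r v rfl)))
    refine halts_seq ((halts_block (l := [_, _, _, _, _, _, _, _])
      (Q := fun τ => τ.nvar 17 = 512 ∧ τ.nvar 18 = 2 ^ 15 ∧ τ.nvar 8 = 0 ∧ τ.nvar 9 = 0 ∧
        τ.nvar 10 = 0 ∧ τ.rvar 10 = 1024 ∧ τ.rvar 7 = 0) ?_).frame.mono le_rfl ?_)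
    · simp [Instr.apply, State.setN, State.setR]
    rintro σ₅ ⟨⟨e17, e18, e8, e9, e10, er10, er7⟩, F₅⟩
    refine halts_seq ((degreeProg_halts ((F₅.n 1 rfl).trans n₄1) e8 e9 e10 e17 e18 er7
      ((F₅.r 2 rfl).trans ((r₄ 2).trans r2)) er10).frame.mono (by rw [hL]) ?_)
    rw [← hL]
    rintro σ₆ ⟨⟨f8, f9, f10⟩, F₆⟩
    have n₆1 : σ₆.nvar 1 = 1 := (F₆.n 1 rfl).trans ((F₅.n 1 rfl).trans n₄1)
    have n₆5 : σ₆.nvar 5 = n / 2 := (F₆.n 5 rfl).trans ((F₅.n 5 rfl).trans n₄5)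
    have r₆0 : σ₆.rvar 0 = ε := (F₆.r 0 rfl).trans ((F₅.r 0 rfl).trans ((r₄ 0).trans r0))
    refine halts_seq ((paramProg_halts hε n₆1 n₆5 f8 r₆0
      ((F₆.r 10 rfl).trans er10)).frame.mono le_rfl ?_)
    rintro σ₇ ⟨⟨g16, g12, gr4, gr12, gr13, gr14, gr15, gr17, gr18⟩, F₇⟩
    refine halts_seq ((tableProg_halts (W := 2 ^ 15 * L) ((F₇.n 1 rfl).trans n₆1)
      ((F₇.n 8 rfl).trans f8) ((F₇.n 10 rfl).trans f10) g16 gr4 gr13 gr14 gr15 gr17 gr18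
      g12).frame.mono le_rfl ?_)
    rintro σ₈ ⟨htab, F₈⟩
    have n₈1 : σ₈.nvar 1 = 1 := (F₈.n 1 rfl).trans ((F₇.n 1 rfl).trans n₆1)
    have n₈0 : σ₈.nvar 0 = n := (F₈.n 0 rfl).trans ((F₇.n 0 rfl).trans
      ((F₆.n 0 rfl).trans ((F₅.n 0 rfl).trans n₄0)))
    have n₈4 : σ₈.nvar 4 = q₁ := (F₈.n 4 rfl).trans ((F₇.n 4 rfl).trans
      ((F₆.n 4 rfl).trans ((F₅.n 4 rfl).trans n₄4)))
    have n₈9 : σ₈.nvar 9 = 512 * L := (F₈.n 9 rfl).trans ((F₇.n 9 rfl).trans f9)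
    have n₈10 : σ₈.nvar 10 = 2 ^ 15 * L := (F₈.n 10 rfl).trans ((F₇.n 10 rfl).trans f10)
    have A₈ : ∀ a, σ₈.narr a = σ₄.narr a := fun a => (F₈.na a rfl).trans ((F₇.na a rfl).trans
      ((F₆.na a rfl).trans (F₅.na a rfl)))
    refine halts_seq ((halts_block (l := [_, _, _])
      (Q := fun τ => τ.nvar 3 = q₁ ∧ τ.rvar 20 = 0) ?_).frame.mono le_rfl ?_)
    · simp [Instr.apply, State.setN, State.setR, n₈4]
    rintro σ₉ ⟨⟨i3, i20⟩, F₉⟩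
    have A₉ : ∀ a, σ₉.narr a = σ₄.narr a := fun a => (F₉.na a rfl).trans (A₈ a)
    have A₉0 : σ₉.narr 0 = σ.narr 0 := (A₉ 0).trans A₄
    have r₉12 : σ₉.rvar 12 = ((n / 2 : ℕ) : ℝ) :=
      (F₉.r 12 rfl).trans ((F₈.r 12 rfl).trans gr12)
    refine halts_seq ((hybridSumProg_halts (ε := ε) (L := L) (n := n) (q₁ := q₁) (q₂ := n / 2)
      ((F₉.n 0 rfl).trans n₈0) ((F₉.n 1 rfl).trans n₈1) i3 ((F₉.n 9 rfl).trans n₈9)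
      ((F₉.n 10 rfl).trans n₈10) (by omega) r₉12 i20 ?_ ?_ ?_).frame.mono le_rfl ?_)
    · rw [A₉0, A₉ 1, A₄1]
    · rw [A₉0, A₉ 2, da]
    · intro N hN
      rw [F₉.ra 0 rfl]
      exact htab N hN
    rintro σ' ⟨j20, F'⟩
    refine halts_instr ?_
    have hq : n - q₁ = n / 2 := by omega
    have j12 : σ'.rvar 12 = ((n / 2 : ℕ) : ℝ) := (F'.r 12 rfl).trans r₉12
    simp only [Instr.apply, State.setR, Function.update_self, j20, j12, hybridSeq, hq, A₉0]
  exact key.mono (by omega) fun _ h => h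

/-! ### Rounding and the complete program -/

/-- Counting up produces the ceiling; rounding down corrects it by one exactly when the counter has
overshot `s`. -/
theorem ceil_sub_one_eq_floor {s : ℝ} (h : s < ⌈s⌉₊) : ⌈s⌉₊ - 1 = ⌊s⌋₊ := by
  rcases Nat.eq_zero_or_pos ⌈s⌉₊ with h0 | h0
  · rw [h0, Nat.floor_of_nonpos (Nat.ceil_eq_zero.mp h0)]
  · have h1 : ((⌈s⌉₊ - 1 : ℕ) : ℝ) < s := Nat.lt_ceil.mp (by omega)
    refine ((Nat.floor_eq_iff ((Nat.cast_nonneg _).trans h1.le)).mpr ⟨h1.le, ?_⟩).symm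
    have : ((⌈s⌉₊ - 1 : ℕ) : ℝ) + 1 = ⌈s⌉₊ := by exact_mod_cast Nat.sub_add_cancel h0
    rwa [this]

theorem ceil_eq_floor {s : ℝ} (h : (⌈s⌉₊ : ℝ) ≤ s) : ⌈s⌉₊ = ⌊s⌋₊ :=
  le_antisymm (Nat.le_floor h) (Nat.floor_le_ceil s)

/-- Computes the rounding of `ε n log n`, capped at `n + 1`, in variable `2`. -/
def roundProg (down : Bool) : Prog :=
  .seq (block [.nconst 1 1, .rcast 1 0, .rlog 2 1, .rmul 3 0 1, .rmul 3 3 2, .rcast 4 1,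
    .radd 5 1 4, .nconst 2 0, .rcast 7 2]) <|
  .seq (.branch (.rlt 5 3) (.instr (.rmul 6 5 4)) (.instr (.rmul 6 3 4))) <|
  .seq (.loop (.rlt 7 6) (block [.nadd 2 2 1, .rcast 7 2])) <|
  if down then .branch (.rlt 6 7) (.instr (.nsub 2 2 1)) .skip else .skip

/-- The cap bounds the counting loop by `n + 1` rounds even when `ε n log n` is much larger than
`n`. -/
theorem roundProg_halts {σ : State} {ε : ℝ} {n : ℕ} (down : Bool) (h0 : σ.nvar 0 = n)
    (r0 : σ.rvar 0 = ε) :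
    Halts (roundProg down) σ (4 * n + 20) fun τ => τ.nvar 1 = 1 ∧ τ.rvar 2 = Real.log n ∧
      τ.nvar 2 = if down then ⌊min (ε * n * Real.log n) (n + 1)⌋₊
        else ⌈min (ε * n * Real.log n) (n + 1)⌉₊ := by
  set y := ε * n * Real.log n with hy
  set s := min y (n + 1) with hs
  have hsn : ⌈s⌉₊ ≤ n + 1 := by
    refine Nat.ceil_le.mpr ?_
    push_cast; exact min_le_right _ _
  have key : Halts (roundProg down) σ (10 + (2 + (⌈s⌉₊ * 4 + 1 + 2))) fun τ => τ.nvar 1 = 1 ∧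
      τ.rvar 2 = Real.log n ∧ τ.nvar 2 = if down then ⌊s⌋₊ else ⌈s⌉₊ := by
    refine halts_seq ((halts_block (l := [_, _, _, _, _, _, _, _, _]) (Q := fun τ =>
      τ.nvar 1 = 1 ∧ τ.rvar 2 = Real.log n ∧ τ.rvar 3 = y ∧ τ.rvar 4 = 1 ∧ τ.rvar 5 = n + 1 ∧
      τ.nvar 2 = 0 ∧ τ.rvar 7 = 0) ?_).mono le_rfl ?_)
    · simp [Instr.apply, State.setN, State.setR, h0, r0, hy]
    rintro σ₁ ⟨a1, b2, b3, b4, b5, a2, b7⟩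
    refine halts_seq ((halts_branch (T := 1) (Q := fun τ => τ.rvar 6 = s)
      (fun hb => halts_instr ?_) fun hb => halts_instr ?_).frame.mono le_rfl ?_)
    · simp only [Test.Holds, b5, b3] at hb
      simp [Instr.apply, State.setR, b5, b4, hs, min_eq_right hb.le]
    · simp only [Test.Holds, b5, b3, not_lt] at hb
      simp [Instr.apply, State.setR, b3, b4, hs, min_eq_left hb]
    rintro σ₂ ⟨c6, F₂⟩
    refine halts_seq ((halts_loop_frame (N := ⌈s⌉₊) (c := 3) (I := fun i τ =>
      τ.nvar 2 = i ∧ τ.rvar 7 = i) ?_ ?_ ?_).mono le_rfl ?_)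
    · exact ⟨(F₂.n 2 rfl).trans a2, by rw [F₂.r 7 rfl, b7]; simp⟩
    · rintro i hi τ hF ⟨e2, e7⟩
      have d1 := (hF.n 1 rfl).trans ((F₂.n 1 rfl).trans a1)
      have d6 := (hF.r 6 rfl).trans c6
      refine ⟨by simp only [Test.Holds, e7, d6]; exact Nat.lt_ceil.mp hi, halts_block ?_⟩
      simp [Instr.apply, State.setN, State.setR, e2, d1]
    · rintro τ hF ⟨e2, e7⟩
      have d6 := (hF.r 6 rfl).trans c6
      simp only [Test.Holds, e7, d6, not_lt]
      exact Nat.le_ceil s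
    rintro σ₃ ⟨⟨e2, e7⟩, F₃⟩
    have d1 := (F₃.n 1 rfl).trans ((F₂.n 1 rfl).trans a1)
    have d2 := (F₃.r 2 rfl).trans ((F₂.r 2 rfl).trans b2)
    have d6 := (F₃.r 6 rfl).trans c6
    cases down with
    | false => exact (halts_skip ⟨d1, d2, e2⟩).mono (by omega) fun _ h => h
    | true =>
      refine halts_branch (T := 1) (fun hb => ?_) fun hb => ?_
      · simp only [Test.Holds, e7, d6] at hb
        refine halts_instr ⟨?_, ?_, ?_⟩
        · simp [Instr.apply, State.setN, d1]
        · simp [Instr.apply, State.setN, d2]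
        · simp only [Instr.apply, State.setN, d1, e2, Function.update_self, if_true]
          exact ceil_sub_one_eq_floor hb
      · simp only [Test.Holds, e7, d6, not_lt] at hb
        refine halts_skip ⟨d1, d2, ?_⟩
        rw [e2, if_pos rfl]
        exact ceil_eq_floor hb
  exact key.mono (by omega) fun _ h => h

end EntropyAmplification

namespace EntropyAmplification

open RealRAM

/-! ### The estimator and its program -/

/-- Rounding down or up. -/
noncomputable def roundBy (down : Bool) (y : ℝ) : ℕ := if down then ⌊y⌋₊ else ⌈y⌉₊

/-- A finite sequence, continued by zeros. -/
def extend {n : ℕ} (x : Fin n → ℕ) (j : ℕ) : ℕ := if h : j < n then x ⟨j, h⟩ else 0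

/-- With `m` the rounding of `ε n log n`: the empirical entropy of the first `m` samples if
`m ≤ n` (of all samples if `n` is below an absolute constant), otherwise the amplified estimate. -/
noncomputable def entropyEstimator (down : Bool) : ParamEstimator := fun ε n x =>
  if n < 2 ^ 15 ∨ roundBy down (ε * n * Real.log n) ≤ n then
    plugIn (extend x) (min (roundBy down (ε * n * Real.log n)) n)
  else hybridSeq ε ⌈Real.log n / 1024⌉₊ (n - n / 2) n (extend x)

/-- The program of the estimator. -/
def entropyProg (down : Bool) : Prog :=
  .seq (roundProg down) <|
  .seq (.instr (.nconst 15 32768)) <|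
  .branch (.nlt 0 15) plugInProg <| .branch (.nlt 0 2) hybridProg plugInProg

/-- Monotone maps commute with minima and rounding fixes `n + 1`. Hence capping preserves both the
comparison with `n` and the minimum with `n`. -/
theorem roundBy_min (down : Bool) (y : ℝ) (n : ℕ) :
    roundBy down (min y (n + 1)) = min (roundBy down y) (n + 1) := by
  cases down with
  | false =>
    have : (⌈min y ((n + 1 : ℕ) : ℝ)⌉₊) = min ⌈y⌉₊ ⌈((n + 1 : ℕ) : ℝ)⌉₊ := Nat.ceil_mono.map_min
    rw [Nat.ceil_natCast] at this
    push_cast at this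
    simpa [roundBy] using this
  | true =>
    have : (⌊min y ((n + 1 : ℕ) : ℝ)⌋₊) = min ⌊y⌋₊ ⌊((n + 1 : ℕ) : ℝ)⌋₊ := Nat.floor_mono.map_min
    rw [Nat.floor_natCast] at this
    push_cast at this
    simpa [roundBy] using this

theorem lt_of_lt_roundBy {down : Bool} {y : ℝ} {n : ℕ} (h : n < roundBy down y) : (n : ℝ) < y := by
  cases down with
  | false => exact Nat.lt_ceil.mp h
  | true =>
    have h : n < ⌊y⌋₊ := h
    have h1 : (n : ℝ) < ⌊y⌋₊ := by exact_mod_cast h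
    exact h1.trans_le (Nat.floor_le (Nat.pos_of_floor_pos (by omega)).le)

theorem roundBy_le (down : Bool) {y : ℝ} (hy : 0 ≤ y) : (roundBy down y : ℝ) ≤ y + 1 := by
  cases down with
  | false => exact (Nat.ceil_lt_add_one hy).le
  | true => exact (Nat.floor_le hy).trans (by linarith)

/-- From `L³/6 ≤ exp L` and `exp L ≤ e n`, since `6 e < 18`. -/
theorem degree_cube_le {n : ℕ} (hn : 1 ≤ n) : ⌈Real.log n / 1024⌉₊ ^ 3 ≤ 18 * n := by
  have hn' : (1 : ℝ) ≤ n := by exact_mod_cast hn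
  have hlog := Real.log_nonneg hn'
  set L := ⌈Real.log n / 1024⌉₊
  have h1 : (L : ℝ) ≤ Real.log n + 1 := by
    have := (Nat.ceil_lt_add_one (show 0 ≤ Real.log n / 1024 by positivity)).le
    have : Real.log n / 1024 ≤ Real.log n := div_le_self hlog (by norm_num)
    linarith
  have h2 := Real.pow_div_factorial_le_exp (L : ℝ) (by positivity) 3
  have h3 : Real.exp L ≤ n * 2.72 := by
    calc Real.exp L ≤ Real.exp (Real.log n + 1) := Real.exp_le_exp.mpr h1
      _ = n * Real.exp 1 := by rw [Real.exp_add, Real.exp_log (by linarith)]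
      _ ≤ n * 2.72 := by
        have := Real.exp_one_lt_d9
        gcongr
        linarith
  have h4 : (L : ℝ) ^ 3 ≤ 18 * n := by
    rw [div_le_iff₀ (by positivity)] at h2
    norm_num [Nat.factorial] at h2
    linarith
  exact_mod_cast h4

theorem linearTime_entropyEstimator (down : Bool) : LinearTime (entropyEstimator down) := by
  -- The table dominates: `L`, `L²` and `L³` are all at most `18 n`, so it costs at most `2 ^ 15 *
  -- (18 + 34 + 10) * 18 n`, below `37000000 n`.
  refine ⟨entropyProg down, 40000000, fun ε hε0 _ n hn x => ?_⟩
  set σ := input ε x with hσ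
  set y := ε * n * Real.log n with hy
  have i0 : σ.nvar 0 = n := by simp [hσ, input]
  have ir : σ.rvar 0 = ε := by simp [hσ, input]
  have ia : σ.narr 0 = extend x := by
    ext j; simp [hσ, input, extend]
  have ia1 : σ.narr 1 = fun _ => 0 := by ext j; simp [hσ, input]
  have ia2 : σ.narr 2 = fun _ => 0 := by ext j; simp [hσ, input]
  set L := ⌈Real.log n / 1024⌉₊ with hL
  set B := 50 * n + 100 + 6 * L + 2 ^ 15 * L * (L * (18 * L + 34) + 10) with hB
  have key : Halts (entropyProg down) σ (4 * n + 20 + (1 + (B + 1 + 1))) fun τ =>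
      τ.rvar 0 = entropyEstimator down ε n x := by
    refine halts_seq ((roundProg_halts down i0 ir).frame.mono le_rfl ?_)
    rintro σ₁ ⟨⟨a1, b2, a2⟩, F₁⟩
    refine halts_seq (halts_instr (Q := fun τ => Halts _ τ _ _) ?_)
    set σ₂ := (Instr.nconst 15 32768).apply σ₁ with hσ₂
    have hm : σ₂.nvar 2 = min (roundBy down y) (n + 1) := by
      rw [← roundBy_min]
      simpa [hσ₂, Instr.apply, State.setN, roundBy] using a2
    have c15 : σ₂.nvar 15 = 2 ^ 15 := by simp [hσ₂, Instr.apply, State.setN]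
    have c1 : σ₂.nvar 1 = 1 := by simpa [hσ₂, Instr.apply, State.setN] using a1
    have keepN : (roundProg down).all (·.keepsN 0) = true := by cases down <;> rfl
    have keepR : (roundProg down).all (·.keepsR 0) = true := by cases down <;> rfl
    have keepA : ∀ a, (roundProg down).all (·.keepsNArr a) = true := fun a => by
      cases down <;> rfl
    have c0 : σ₂.nvar 0 = n := by
      simpa [hσ₂, Instr.apply, State.setN] using (F₁.n 0 keepN).trans i0
    have cr : σ₂.rvar 0 = ε := by
      simpa [hσ₂, Instr.apply, State.setN] using (F₁.r 0 keepR).trans ir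
    have cr2 : σ₂.rvar 2 = Real.log n := by simpa [hσ₂, Instr.apply, State.setN] using b2
    have ca : ∀ a, σ₂.narr a = σ.narr a := fun a => by
      simpa [hσ₂, Instr.apply, State.setN] using F₁.na a (keepA a)
    have hplug : n < 2 ^ 15 ∨ roundBy down y ≤ n → Halts plugInProg σ₂ B fun τ =>
        τ.rvar 0 = entropyEstimator down ε n x := by
      intro hc
      refine (plugInProg_halts c0 c1 hm ((ca 1).trans ia1)).mono (by omega) fun τ hτ => ?_
      have hest : entropyEstimator down ε n x = plugIn (extend x) (min (roundBy down y) n) :=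
        if_pos hc
      rw [hτ, hest, ca 0, ia]
      congr 1
      omega
    refine halts_branch (T := B + 1) (fun hb => ?_) fun hb => ?_
    · simp only [Test.Holds, c0, c15] at hb
      exact (hplug (Or.inl hb)).mono (by omega) fun _ h => h
    simp only [Test.Holds, c0, c15] at hb
    refine halts_branch (fun hb' => ?_) fun hb' => ?_
    · simp only [Test.Holds, c0, hm] at hb'
      have hlt : n < roundBy down y := by omega
      -- At `ε = 0` nothing is amplified, so the logarithm of `ε` is never taken there.
      have hεpos : 0 < ε := by
        rcases hε0.eq_or_lt with rfl | h
        · have := lt_of_lt_roundBy hlt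
          simp only [hy, zero_mul] at this
          exact absurd this (not_lt.mpr (Nat.cast_nonneg n))
        · exact h
      refine (hybridProg_halts hεpos c0 c1 cr cr2 ((ca 1).trans ia1) ((ca 2).trans ia2)
        hL).mono le_rfl fun τ hτ => ?_
      have hc : ¬ (n < 2 ^ 15 ∨ roundBy down y ≤ n) := by omega
      have hest : entropyEstimator down ε n x = hybridSeq ε L (n - n / 2) n (extend x) := if_neg hc
      rw [hτ, hest, ca 0, ia]
    · simp only [Test.Holds, c0, hm] at hb'
      exact hplug (Or.inr (by omega))
  obtain ⟨t, τ, he, ht, hq⟩ := key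
  refine ⟨t, τ, he, ht.trans ?_, hq⟩
  have hcube := degree_cube_le hn
  rw [← hL] at hcube
  have h1 : L ≤ L ^ 3 := Nat.le_self_pow (by norm_num) L
  have h2 : L ^ 2 ≤ L ^ 3 := by
    rcases Nat.eq_zero_or_pos L with h0 | h0
    · simp [h0]
    · exact Nat.pow_le_pow_right h0 (by norm_num)
  have h3 : 2 ^ 15 * L * (L * (18 * L + 34) + 10) =
      2 ^ 15 * (18 * L ^ 3 + 34 * L ^ 2 + 10 * L) := by ring
  rw [hB, h3]
  omega

/-! ### The loss of the estimator -/

theorem sum_Ico_eq_sum_fin {b : ℕ} {α M : Type*} [AddCommMonoid M] (a : ℕ) (xs : ℕ → ℕ)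
    (y : Fin b → α) (g : α → ℕ) (hy : ∀ j : Fin b, xs (a + j) = g (y j)) (f : ℕ → M) :
    ∑ j ∈ Finset.Ico a (a + b), f (xs j) = ∑ j, f (g (y j)) := by
  rw [Finset.sum_Ico_eq_sum_range, Nat.add_sub_cancel_left, Finset.sum_range]
  exact Finset.sum_congr rfl fun j _ => by rw [hy]

theorem countIn_eq_symbolCount {k b : ℕ} (a : ℕ) (xs : ℕ → ℕ) (y : Fin b → Fin k)
    (hy : ∀ j : Fin b, xs (a + j) = y j) (i : Fin k) :
    countIn xs a (a + b) i = symbolCount y i := by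
  rw [countIn, symbolCount, Finset.card_filter, Finset.card_filter,
    sum_Ico_eq_sum_fin a xs y Fin.val hy fun s => if s = (i : ℕ) then 1 else 0]
  simp only [Fin.val_inj]

theorem plugIn_eq_empiricalEntropy {k m : ℕ} (xs : ℕ → ℕ) (y : Fin m → Fin k)
    (hy : ∀ j : Fin m, xs j = y j) : plugIn xs m = empiricalEntropy y := by
  have hy' : ∀ j : Fin m, xs (0 + j) = y j := fun j => by rw [zero_add, hy]
  have hc := countIn_eq_symbolCount 0 xs y hy'
  rw [zero_add] at hc
  have h := sum_Ico_eq_sum_fin 0 xs y Fin.val hy' fun s => -Real.log ((countIn xs 0 m s : ℝ) / m)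
  rw [zero_add] at h
  rw [plugIn, Finset.range_eq_Ico, h]
  simp only [hc]
  rw [sum_apply_symbol y fun i => -Real.log ((symbolCount y i : ℝ) / m), empiricalEntropy,
    Finset.sum_div]
  exact Finset.sum_congr rfl fun i _ => by rw [Real.negMulLog]; ring

theorem extend_apply {k n : ℕ} (x : Fin n → Fin k) (j : Fin n) :
    extend (fun j => (x j : ℕ)) j = x j := by
  simp [extend]

theorem hybridSeq_eq_hybridEntropy {k q₁ q₂ : ℕ} (ε : ℝ) (L : ℕ) (x : Fin (q₁ + q₂) → Fin k) :
    hybridSeq ε L q₁ (q₁ + q₂) (extend fun j => (x j : ℕ)) = hybridEntropy ε L x := by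
  set xs := extend fun j => (x j : ℕ)
  set u : Fin q₁ → Fin k := fun j => x (Fin.castAdd q₂ j) with hu
  set v : Fin q₂ → Fin k := fun j => x (Fin.natAdd q₁ j) with hv
  have hu' : ∀ j : Fin q₁, xs (0 + j) = u j := fun j => by
    rw [zero_add]; exact extend_apply x (Fin.castAdd q₂ j)
  have hv' : ∀ j : Fin q₂, xs (q₁ + j) = v j := fun j => extend_apply x (Fin.natAdd q₁ j)
  have hc1 := countIn_eq_symbolCount 0 xs u hu'
  rw [zero_add] at hc1
  have hc2 := countIn_eq_symbolCount q₁ xs v hv'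
  rw [hybridSeq, Nat.add_sub_cancel_left, sum_Ico_eq_sum_fin q₁ xs v Fin.val hv' fun s =>
    hybridEst ε L q₂ (countIn xs 0 q₁ s) (countIn xs q₁ (q₁ + q₂) s)]
  simp only [hc1, hc2]
  rw [sum_apply_symbol v fun i => hybridEst ε L q₂ (symbolCount u i) (symbolCount v i),
    Finset.sum_div, hybridEntropy]
  exact Finset.sum_congr rfl fun i _ => by rw [hybridTerm]; ring

theorem regime_of_large {ε : ℝ} {n : ℕ} (hε0 : 0 ≤ ε) (hε1 : ε ≤ 1) (hn : 2 ^ 15 ≤ n)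
    (h : (n : ℝ) < ε * n * Real.log n) :
    Regime ε n (n - n / 2) (n / 2) ⌈Real.log n / 1024⌉₊ := by
  have hn' : (2 : ℝ) ^ 15 ≤ n := by exact_mod_cast hn
  have hn0 : (0 : ℝ) < n := by linarith [show (0 : ℝ) < 2 ^ 15 by norm_num]
  have hlog : 0 < Real.log n := Real.log_pos (by linarith [show (1 : ℝ) < 2 ^ 15 by norm_num])
  have h1 : 1 ≤ ε * Real.log n := by nlinarith
  have hL := (Nat.ceil_lt_add_one (show 0 ≤ Real.log n / 1024 by positivity)).le
  set L := ⌈Real.log n / 1024⌉₊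
  refine ⟨by omega, by omega, by omega, Nat.ceil_pos.mpr (by positivity), ?_, by linarith, ?_, ?_,
    hε1, h1⟩
  · have := Nat.le_ceil (Real.log n / 1024)
    rw [div_le_iff₀ (by norm_num)] at this
    linarith
  -- With `8192 L ≤ 8 log n + 8192`, this linear bound on `log n` leaves a requirement that `n ≥ 2 ^
  -- 15` meets; it fixes the threshold between small and large samples.
  · have h2 : Real.log n ≤ n / 64 + 63 := by
      have h3 := Real.log_le_sub_one_of_pos (show (0 : ℝ) < n / 64 by positivity)
      rw [Real.log_div hn0.ne' (by norm_num)] at h3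
      have h4 := Real.log_le_sub_one_of_pos (show (0 : ℝ) < 64 by norm_num)
      linarith
    have h5 : 8192 * (L : ℝ) + 1 ≤ n / 2 := by linarith [show (2 : ℝ) ^ 15 = 32768 by norm_num]
    have h6 : 2 * (8192 * L + 1) ≤ n := by
      have : 2 * (8192 * (L : ℝ) + 1) ≤ n := by linarith
      exact_mod_cast this
    omega
  · rcases hε0.eq_or_lt with rfl | h
    · simp at h1; linarith
    · exact h

theorem shannonEntropy_nonneg {k : ℕ} {p : Fin k → ℝ} (hp : p ∈ stdSimplex ℝ (Fin k)) :
    0 ≤ shannonEntropy p :=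
  Finset.sum_nonneg fun i _ => Real.negMulLog_nonneg (hp.1 i) (by
    rw [← hp.2]; exact Finset.single_le_sum (fun j _ => hp.1 j) (Finset.mem_univ i))

/-- Below an absolute sample size all losses differ by at most a constant. -/
theorem loss_empiricalEntropy_le_of_small {k n m : ℕ} {ε : ℝ} (hε1 : ε ≤ 1) (hn1 : 1 ≤ n)
    (hn : n < 2 ^ 15) (hnm : n < m) (hm : (m : ℝ) ≤ ε * n * Real.log n + 1)
    (h : (n : ℝ) < ε * n * Real.log n) {p : Fin k → ℝ} (hp : p ∈ stdSimplex ℝ (Fin k)) :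
    meanAbsError shannonEntropy (empiricalEntropy : (Fin n → Fin k) → ℝ) p ≤
      meanAbsError shannonEntropy (empiricalEntropy : (Fin m → Fin k) → ℝ) p +
      2 ^ 47 * min ε ((supportSize p : ℝ) / n + 1 / (n : ℝ) ^ (0.49 : ℝ)) := by
  have hn1' : (1 : ℝ) ≤ n := by exact_mod_cast hn1
  have hn' : (n : ℝ) ≤ 2 ^ 15 := by exact_mod_cast hn.le
  have hn0 : (0 : ℝ) < n := by linarith
  have hlogn : Real.log n ≤ n := by linarith [Real.log_le_sub_one_of_pos hn0]
  have hlog0 := Real.log_nonneg hn1'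
  have hH := shannonEntropy_nonneg hp
  have h1 : meanAbsError shannonEntropy (empiricalEntropy : (Fin n → Fin k) → ℝ) p ≤
      Real.log n + shannonEntropy p := by
    rw [meanAbsError_eq_expect, ← expect_const (n := n) hp.2 (Real.log n + shannonEntropy p)]
    refine expect_mono hp.1 fun x => ?_
    have := empiricalEntropy_nonneg x
    have := empiricalEntropy_le hn1 x
    rw [abs_le]; constructor <;> linarith
  have h2 := bias_le_meanAbsError (m := m) hp
  have h3 : expect m p empiricalEntropy ≤ Real.log m := by
    rw [← expect_const (n := m) hp.2 (Real.log m)]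
    exact expect_mono hp.1 fun x => empiricalEntropy_le (by omega) x
  have hm0 : (0 : ℝ) < m := by exact_mod_cast (by omega)
  have h4 : Real.log m ≤ 2 ^ 30 := by
    have e1 := Real.log_le_sub_one_of_pos hm0
    have e2 : ε * n * Real.log n ≤ 1 * 2 ^ 15 * 2 ^ 15 := by
      have : Real.log n ≤ 2 ^ 15 := hlogn.trans hn'
      gcongr
    norm_num at e2 ⊢
    linarith
  -- Here `ε ≥ 1/log n ≥ 1/2 ^ 15`, so the error term is at least `2 ^ 32`, more than `log n + log
  -- m`. The entropy itself is at most the competitor's loss plus `log m`.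
  have h5 : 1 / 2 ^ 15 ≤ min ε ((supportSize p : ℝ) / n + 1 / (n : ℝ) ^ (0.49 : ℝ)) := by
    refine le_min ?_ ?_
    · rw [div_le_iff₀ (by norm_num)]
      have : 1 ≤ ε * Real.log n := by nlinarith
      nlinarith
    · have e1 : (n : ℝ) ^ (0.49 : ℝ) ≤ 2 ^ 15 := by
        calc (n : ℝ) ^ (0.49 : ℝ) ≤ (n : ℝ) ^ (1 : ℝ) :=
              Real.rpow_le_rpow_of_exponent_le hn1' (by norm_num)
          _ = n := Real.rpow_one _
          _ ≤ _ := hn'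
      have e2 := one_div_le_one_div_of_le (by positivity) e1
      have : 0 ≤ (supportSize p : ℝ) / n := by positivity
      linarith
  generalize min ε _ = δ at h5 ⊢
  linarith

theorem loss_entropyEstimator_le (down : Bool) {ε : ℝ} (hε0 : 0 ≤ ε) (hε1 : ε ≤ 1) {n : ℕ}
    (hn : 1 ≤ n) {k : ℕ} {p : Fin k → ℝ} (hp : p ∈ stdSimplex ℝ (Fin k)) :
    meanAbsError shannonEntropy
        (fun x : Fin n → Fin k => entropyEstimator down ε n fun j => (x j : ℕ)) p ≤
      meanAbsError shannonEntropy (empiricalEntropy :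
        (Fin (roundBy down (ε * n * Real.log n)) → Fin k) → ℝ) p +
      (2 ^ 47 + 3 * (6 * (2 ^ 28 * Real.exp 10))) *
        min ε ((supportSize p : ℝ) / n + 1 / (n : ℝ) ^ (0.49 : ℝ)) := by
  set m := roundBy down (ε * n * Real.log n) with hm
  set δ := min ε ((supportSize p : ℝ) / n + 1 / (n : ℝ) ^ (0.49 : ℝ)) with hδ
  have hδ0 : 0 ≤ δ := le_min hε0 (by positivity)
  have hexp := Real.exp_pos 10
  have hn1 : (1 : ℝ) ≤ n := by exact_mod_cast hn
  have hlog := Real.log_nonneg hn1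
  rcases le_or_gt m n with hmn | hmn
  · have hest : ∀ x : Fin n → Fin k, entropyEstimator down ε n (fun j => (x j : ℕ)) =
        empiricalEntropy fun j : Fin m => x (Fin.castLE hmn j) := by
      intro x
      rw [entropyEstimator, if_pos (Or.inr hmn), min_eq_left hmn]
      exact plugIn_eq_empiricalEntropy _ _ fun j => extend_apply x (Fin.castLE hmn j)
    simp only [hest]
    have : meanAbsError shannonEntropy
        (fun x : Fin n → Fin k => empiricalEntropy fun j : Fin m => x (Fin.castLE hmn j)) p =
        meanAbsError shannonEntropy (empiricalEntropy : (Fin m → Fin k) → ℝ) p := by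
      -- With `n = m + r`, the `r` unused samples integrate out.
      clear_value m δ
      clear hest hδ0
      obtain ⟨r, rfl⟩ := Nat.exists_eq_add_of_le hmn
      rw [meanAbsError_eq_expect, meanAbsError_eq_expect, expect_append]
      have : ∀ (u : Fin m → Fin k) (v : Fin r → Fin k),
          (fun j : Fin m => Fin.append u v (Fin.castLE hmn j)) = u :=
        fun u v => funext fun j => Fin.append_left u v j
      simp only [this, expect_const hp.2]
    rw [this]
    have : 0 ≤ (2 ^ 47 + 3 * (6 * (2 ^ 28 * Real.exp 10))) * δ := by positivity
    linarith
  have hlt := lt_of_lt_roundBy hmn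
  have hmle : (m : ℝ) ≤ ε * n * Real.log n + 1 := roundBy_le down (by positivity)
  rcases lt_or_ge n (2 ^ 15) with hsmall | hlarge
  · have hest : ∀ x : Fin n → Fin k, entropyEstimator down ε n (fun j => (x j : ℕ)) =
        empiricalEntropy x := by
      intro x
      rw [entropyEstimator, if_pos (Or.inl hsmall), min_eq_right hmn.le]
      exact plugIn_eq_empiricalEntropy _ _ fun j => extend_apply x j
    simp only [hest]
    have := loss_empiricalEntropy_le_of_small hε1 hn hsmall hmn hmle hlt hp
    have : 0 ≤ 3 * (6 * (2 ^ 28 * Real.exp 10)) * δ := by positivity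
    linarith
  · have hreg := regime_of_large hε0 hε1 hlarge hlt
    -- Since `ε n log n > n ≥ 1`, the rounding error of at most `1` is absorbed by a factor `2`.
    have hloss := hreg.loss_hybridEntropy_le (m := m) (by omega) (by linarith) hp
    have heq : meanAbsError shannonEntropy
        (fun x : Fin n → Fin k => entropyEstimator down ε n fun j => (x j : ℕ)) p =
        meanAbsError shannonEntropy (hybridEntropy ε ⌈Real.log n / 1024⌉₊ :
          (Fin (n - n / 2 + n / 2) → Fin k) → ℝ) p := by
      have hcond : ¬ (n < 2 ^ 15 ∨ m ≤ n) := by omega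
      have hest : ∀ x : Fin n → Fin k, entropyEstimator down ε n (fun j => (x j : ℕ)) =
          hybridSeq ε ⌈Real.log n / 1024⌉₊ (n - n / 2) n (extend fun j => (x j : ℕ)) :=
        fun x => if_neg hcond
      simp only [hest]
      generalize ⌈Real.log n / 1024⌉₊ = L
      clear * -
      obtain ⟨q₁, q₂, h1, h2, rfl⟩ : ∃ q₁ q₂, n - n / 2 = q₁ ∧ n / 2 = q₂ ∧ n = q₁ + q₂ :=
        ⟨_, _, rfl, rfl, by omega⟩
      rw [h1, h2]
      simp only [hybridSeq_eq_hybridEntropy]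
    rw [heq]
    rw [← hδ] at hloss
    refine hloss.trans ?_
    have : (2 ^ 31 : ℝ) * δ ≤ 2 ^ 47 * δ := by gcongr <;> norm_num
    linarith

end EntropyAmplification

theorem theorem1 :
    ∃ c : ℝ, 0 < c ∧
      ∀ round : ℝ → ℕ, (round = Nat.floor ∨ round = Nat.ceil) →
        ∃ Hhat : ParamEstimator, LinearTime Hhat ∧
          ∀ ε : ℝ, 0 ≤ ε → ε ≤ 1 → ∀ n : ℕ, 1 ≤ n →
            ∀ (k : ℕ) (p : Fin k → ℝ), p ∈ stdSimplex ℝ (Fin k) →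
              meanAbsError shannonEntropy (fun x : Fin n → Fin k => Hhat ε n fun j => (x j : ℕ)) p
                ≤ meanAbsError shannonEntropy
                    (empiricalEntropy :
                      (Fin (round (ε * (n : ℝ) * Real.log (n : ℝ))) → Fin k) → ℝ) p
                  + c * min ε ((supportSize p : ℝ) / n + 1 / (n : ℝ) ^ (0.49 : ℝ)) := by
  refine ⟨2 ^ 47 + 3 * (6 * (2 ^ 28 * Real.exp 10)), by positivity, fun round hround => ?_⟩
  obtain ⟨down, rfl⟩ : ∃ down, round = EntropyAmplification.roundBy down := by
    rcases hround with rfl | rfl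
    · exact ⟨true, rfl⟩
    · exact ⟨false, rfl⟩
  exact ⟨EntropyAmplification.entropyEstimator down,
    EntropyAmplification.linearTime_entropyEstimator down,
    fun ε hε0 hε1 n hn k p hp =>
      EntropyAmplification.loss_entropyEstimator_le down hε0 hε1 hn hp⟩
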